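/- Let $M$ be a smooth real supermanifold of dimension $p|q$ (Hausdorff, second countable; for $q=0$ an ordinary smooth $p$-dimensional manifold). In local coordinates $(x^a)$, with parities $p(a)\in\mathbb Z/2$ and left derivatives $\partial_a$, let $S=S^{ab}\,\partial_b\otimes\partial_a$ be a symmetric contravariant tensor field of rank 2 on $M$ of parity $\varepsilon\in\mathbb Z/2$, i.e. $p(S^{ab})=\varepsilon+p(a)+p(b)$ and $S^{ab}=(-1)^{p(a)p(b)}S^{ba}$, with $S^{a'b'}=\sum_{a,b}(-1)^{p(b)(p(a)+p(a'))}S^{ab}\,\partial_a x^{a'}\,\partial_b x^{b'}$ under a change of coordinates. $S$ may be degenerate, e.g. zero. A half-density $\mathbf s=s(x)|Dx|^{1/2}$ is given in each coordinate system by a function $s$, with $s(x)=s'(x')\,|\mathrm{Ber}(\partial x'/\partial x)|^{1/2}$ under a change of coordinates (for $q=0$ the Berezinian is the Jacobian determinant). The scalar product of two half-densities is $\langle \mathbf s_1,\mathbf s_2\rangle=\int s_1(x)s_2(x)\,|Dx|$ (Berezin integral), where $\mathbf s_1$ has compact support in a coordinate domain. Let $\mathcal F_S$ be the class of linear operators $\Delta$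 on the half-densities on $M$ such that * $\Delta$ is a differential operator of order $\le 2$ with principal symbol $S$: in every coordinate system $\Delta=\tfrac12 S^{ab}(x)\,\partial_b\partial_a+L^a(x)\,\partial_a+U(x)$ for some functions $L^a$, $U$; * $\Delta$ has parity $\varepsilon$, i.e. $p(\Delta\mathbf s)=\varepsilon+p(\mathbf s)$ for homogeneous $\mathbf s$ (no condition if $q=0$, $\varepsilon=0$); * $\Delta$ is self-adjoint: $\langle\Delta\mathbf s_1,\mathbf s_2\rangle=(-1)^{\varepsilon p(\mathbf s_1)}\langle\mathbf s_1,\Delta\mathbf s_2\rangle$ for all half-densities $\mathbf s_1,\mathbf s_2$ with $\mathbf s_1$ homogeneous and compactly supported in a coordinate domain (when the local Berezin integrals fit together to a global integral, in particular for $q=0$, it is the same to require this for all compactly supported $\mathbf s_1,\mathbf s_2$). Then $\mathcal F_S$ is an affine space associated with the vector space of functions on $M$ of parity $\varepsilon$ (all smooth functions on $M$ if $q=0$ and $\varepsilon=0$), that is: 1. $\mathcal F_S$ is not empty; 2. for any $\Delta,\Delta'\in\mathcal F_S$ there is exactly one function $F$ on $M$ of parity $\varepsilon$ such that $\Delta'-\Delta$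 is multiplication by $F$; 3. if $\Delta\in\mathcal F_S$ and $F$ is a function on $M$ of parity $\varepsilon$, then $\Delta+F\in\mathcal F_S$. -/

import Mathlib

open CategoryTheory TopologicalSpace Opposite
open scoped ContDiff

universe u

noncomputable section

namespace SuperGeom

/-! ### Signs and indices -/

/-- The sign `(-1)^i` of a parity `i : ZMod 2`. -/
def sgn (i : ZMod 2) : ℝ := if i = 0 then 1 else -1

/-- Labels of the coordinates on a superdomain of dimension `p|q`: `p` even ones, `q` odd ones. -/
abbrev Idx (p q : ℕ) := Fin p ⊕ Fin q

/-- The parity of a coordinate. -/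
def par {p q : ℕ} : Idx p q → ZMod 2 := Sum.elim (fun _ => 0) (fun _ => 1)

/-! ### The model: superfunctions on open subsets of `ℝ^p` -/

/-- The Grassmann algebra on generators `θ^0, …, θ^(q-1)`. -/
abbrev Grassmann (q : ℕ) := ExteriorAlgebra ℝ (Fin q → ℝ)

/-- The monomials `θ^I` (factors in increasing order), a basis of the Grassmann algebra. -/
def monomial (q : ℕ) : Module.Basis (Finset (Fin q)) ℝ (Grassmann q) :=
  (Pi.basisFun ℝ (Fin q)).ExteriorAlgebra

/-- The coefficient of `θ^I` in a Grassmann-valued function on `V`, extended by zero outside `V`. -/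
def coeff {p q : ℕ} {V : Opens (Fin p → ℝ)} (f : V → Grassmann q) (I : Finset (Fin q)) :
    (Fin p → ℝ) → ℝ :=
  Function.extend Subtype.val (fun x => (monomial q).repr (f x) I) 0

theorem coeff_apply {p q : ℕ} {V : Opens (Fin p → ℝ)} (f : V → Grassmann q)
    (I : Finset (Fin q)) (x : V) : coeff f I x = (monomial q).repr (f x) I :=
  Subtype.val_injective.extend_apply _ _ x

/-- A Grassmann-valued function on `V` is smooth if all its coefficients are. -/
def IsSmooth {p q : ℕ} {V : Opens (Fin p → ℝ)} (f : V → Grassmann q) : Prop :=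
  ∀ I, ContDiffOn ℝ ∞ (coeff f I) V

theorem IsSmooth.of_repr {p q : ℕ} {V : Opens (Fin p → ℝ)} {f : V → Grassmann q}
    (g : Finset (Fin q) → (Fin p → ℝ) → ℝ) (hg : ∀ I, ContDiffOn ℝ ∞ (g I) V)
    (h : ∀ I (x : V), (monomial q).repr (f x) I = g I x) : IsSmooth f := fun I =>
  (hg I).congr fun x hx => by rw [← h I ⟨x, hx⟩, ← coeff_apply f I ⟨x, hx⟩]

/-- If every value of `f` is the image of values of `g` under a fixed linear map, and `g` is
smooth, then `f` is smooth. -/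
theorem IsSmooth.map {p q : ℕ} {V : Opens (Fin p → ℝ)} {g : V → Grassmann q} (hg : IsSmooth g)
    (T : Grassmann q →ₗ[ℝ] Grassmann q) : IsSmooth (fun x => T (g x)) := by
  refine IsSmooth.of_repr
    (fun I x => ∑ J, coeff g J x * (monomial q).repr (T (monomial q J)) I) (fun I => ?_) ?_
  · exact ContDiffOn.sum fun J _ => (hg J).mul contDiffOn_const
  · intro I x
    conv_lhs => rw [← (monomial q).sum_repr (g x)]
    simp only [map_sum, map_smul, Finsupp.finsetSum_apply, Finsupp.smul_apply, smul_eq_mul,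
      coeff_apply]

theorem IsSmooth.const {p q : ℕ} {V : Opens (Fin p → ℝ)} (a : Grassmann q) :
    IsSmooth (fun _ : V => a) :=
  IsSmooth.of_repr (fun I _ => (monomial q).repr a I) (fun _ => contDiffOn_const) fun _ _ => rfl

/-- The algebra of smooth superfunctions `C^∞(V) ⊗ Λ(θ^0, …, θ^(q-1))` on an open `V ⊆ ℝ^p`,
realized as smooth functions on `V` with values in the Grassmann algebra. -/
def SuperFun (p q : ℕ) (V : Opens (Fin p → ℝ)) : Subalgebra ℝ (V → Grassmann q) where
  carrier := {f | IsSmooth f}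
  mul_mem' := by
    intro f g hf hg
    refine IsSmooth.of_repr (fun I x => ∑ J, ∑ K, coeff f J x * coeff g K x *
      (monomial q).repr (monomial q J * monomial q K) I) (fun I => ?_) ?_
    · exact ContDiffOn.sum fun J _ => ContDiffOn.sum fun K _ =>
        ((hf J).mul (hg K)).mul contDiffOn_const
    · intro I x
      conv_lhs => rw [Pi.mul_apply, ← (monomial q).sum_repr (f x), ← (monomial q).sum_repr (g x)]
      simp only [Finset.sum_mul_sum, map_sum, Finsupp.finsetSum_apply, smul_mul_smul_comm,
        map_smul, Finsupp.smul_apply, smul_eq_mul, coeff_apply]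
  add_mem' := by
    intro f g hf hg
    refine IsSmooth.of_repr (fun I x => coeff f I x + coeff g I x)
      (fun I => (hf I).add (hg I)) fun I x => ?_
    simp [coeff_apply]
  algebraMap_mem' := fun r => IsSmooth.const (algebraMap ℝ (Grassmann q) r)

variable {p q : ℕ}

/-- Restriction of superfunctions to a smaller open set. -/
def SuperFun.res {V V' : Opens (Fin p → ℝ)} (h : V' ≤ V) (f : SuperFun p q V) :
    SuperFun p q V' :=
  ⟨fun x => f.1 ⟨x, h x.2⟩, IsSmooth.of_repr (coeff f.1) (fun I => (f.2 I).mono h) fun I x =>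
    (coeff_apply f.1 I ⟨x, h x.2⟩).symm⟩

/-- The parity involution of superfunctions: `f ↦ (-1)^{p(f)} f`, that is, `θ^j ↦ -θ^j`. -/
def SuperFun.invol {V : Opens (Fin p → ℝ)} (f : SuperFun p q V) : SuperFun p q V :=
  ⟨fun x => CliffordAlgebra.involute (f.1 x), IsSmooth.map f.2 CliffordAlgebra.involute.toLinearMap⟩

/-- The partial derivative `∂/∂x^i` along an even coordinate. -/
def SuperFun.dEven {V : Opens (Fin p → ℝ)} (i : Fin p) (f : SuperFun p q V) : SuperFun p q V :=
  ⟨fun x => ∑ I, fderiv ℝ (coeff f.1 I) x (Pi.single i 1) • monomial q I, by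
    refine IsSmooth.of_repr (fun I x => fderiv ℝ (coeff f.1 I) x (Pi.single i 1)) (fun I => ?_) ?_
    · exact ((f.2 I).fderiv_of_isOpen V.isOpen (by simp)).clm_apply contDiffOn_const
    · intro I x
      simp [Finsupp.single_apply]⟩

/-- The left partial derivative `∂/∂θ^j` along an odd coordinate: the odd derivation
with `∂θ^k/∂θ^j = δ^k_j`. -/
def SuperFun.dOdd {V : Opens (Fin p → ℝ)} (j : Fin q) (f : SuperFun p q V) : SuperFun p q V :=
  ⟨fun x => CliffordAlgebra.contractLeft (LinearMap.proj j : (Fin q → ℝ) →ₗ[ℝ] ℝ) (f.1 x),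
    IsSmooth.map f.2 (CliffordAlgebra.contractLeft (LinearMap.proj j : (Fin q → ℝ) →ₗ[ℝ] ℝ))⟩

/-- The left partial derivatives `∂_a` on a superdomain. -/
def SuperFun.d {V : Opens (Fin p → ℝ)} (a : Idx p q) (f : SuperFun p q V) : SuperFun p q V :=
  Sum.elim (fun i => SuperFun.dEven i f) (fun j => SuperFun.dOdd j f) a

/-- The standard coordinate superfunctions `x^0, …, x^(p-1), θ^0, …, θ^(q-1)`. -/
def SuperFun.coord {V : Opens (Fin p → ℝ)} : Idx p q → SuperFun p q V
  | Sum.inl i => ⟨fun x => algebraMap ℝ (Grassmann q) (x.1 i), by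
      refine IsSmooth.of_repr (fun I x => x i * (monomial q).repr 1 I) (fun I => ?_) fun I x => ?_
      · exact ContDiffOn.mul (by fun_prop) contDiffOn_const
      · rw [Algebra.algebraMap_eq_smul_one]; simp⟩
  | Sum.inr j => ⟨fun _ => ExteriorAlgebra.ι ℝ (Pi.single j 1), IsSmooth.const _⟩

/-- The body of a superfunction: its value at `θ = 0`. -/
def SuperFun.body {V : Opens (Fin p → ℝ)} (f : SuperFun p q V) (x : V) : ℝ :=
  ExteriorAlgebra.algebraMapInv (f.1 x)

/-- The Berezin integral `∫ f D(x,θ)`: the Lebesgue integral over `V` of the coefficient of the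
top monomial `θ^0 θ^1 ⋯ θ^(q-1)`. -/
def SuperFun.berezin {V : Opens (Fin p → ℝ)} (f : SuperFun p q V) : ℝ :=
  ∫ x, coeff f.1 Finset.univ x

/-! ### Supermanifolds -/

/-- A super ringed space: a topological space with a sheaf of supercommutative real
superalgebras. The `ℤ/2`-grading is recorded by its parity involution `f ↦ (-1)^{p(f)} f`,
whose `±1`-eigenspaces are the even and the odd sections. -/
structure SuperRingedSpace where
  space : TopCat.{u}
  sheaf : TopCat.Sheaf (AlgCat.{u} ℝ) space
  invol : sheaf.1 ⟶ sheaf.1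
  invol_invol : invol ≫ invol = 𝟙 sheaf.1
  even_comm : ∀ (U : Opens space) (f g : sheaf.1.obj (op U)),
    (invol.app (op U)).hom f = f → f * g = g * f
  odd_anticomm : ∀ (U : Opens space) (f g : sheaf.1.obj (op U)),
    (invol.app (op U)).hom f = -f → (invol.app (op U)).hom g = -g → f * g = -(g * f)

namespace SuperRingedSpace

variable (M : SuperRingedSpace.{u})

/-- The algebra of sections of the structure sheaf over `U`, the superfunctions on `U`. -/
abbrev Fun (U : Opens M.space) : Type u := M.sheaf.1.obj (op U)

/-- Restriction of superfunctions. -/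
def res {U V : Opens M.space} (h : V ≤ U) : M.Fun U →ₐ[ℝ] M.Fun V :=
  (M.sheaf.1.map (homOfLE h).op).hom

/-- The parity involution on superfunctions over `U`. -/
def inv (U : Opens M.space) : M.Fun U →ₐ[ℝ] M.Fun U := (M.invol.app (op U)).hom

theorem inv_inv (U : Opens M.space) (f : M.Fun U) : M.inv U (M.inv U f) = f := by
  have h := congrArg (fun t => (t.app (op U)).hom f) M.invol_invol
  simpa [inv] using h

/-- `f` is homogeneous of parity `ε`. -/
def HasParity {U : Opens M.space} (ε : ZMod 2) (f : M.Fun U) : Prop :=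
  M.inv U f = sgn ε • f

/-- The commutative algebra of even superfunctions over `U`. -/
def even (U : Opens M.space) : Subalgebra ℝ (M.Fun U) :=
  AlgHom.equalizer (M.inv U) (AlgHom.id ℝ (M.Fun U))

instance (U : Opens M.space) : CommRing (M.even U) :=
  { (M.even U).toRing with
    mul_comm := fun a b => Subtype.ext (M.even_comm U a.1 b.1 a.2) }

/-- The projection to the even part; it is the identity on even superfunctions. -/
def evenPart {U : Opens M.space} (f : M.Fun U) : M.even U :=
  ⟨(1 / 2 : ℝ) • (f + M.inv U f), by
    change M.inv U _ = _
    rw [map_smul, map_add, inv_inv, add_comm]; rfl⟩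

end SuperRingedSpace

/-- The image of an open set under a chart map, as an open subset of `ℝ^p`. -/
def imageOpens {X : TopCat.{u}} (φ : OpenPartialHomeomorph X (Fin p → ℝ)) (W : Opens X)
    (h : (W : Set X) ⊆ φ.source) : Opens (Fin p → ℝ) :=
  ⟨φ '' W, φ.isOpen_image_of_subset_source W.isOpen h⟩

theorem imageOpens_mono {X : TopCat.{u}} (φ : OpenPartialHomeomorph X (Fin p → ℝ)) {W W' : Opens X}
    (h : (W : Set X) ⊆ φ.source) (h' : (W' : Set X) ⊆ φ.source) (hle : W' ≤ W) :
    imageOpens φ W' h' ≤ imageOpens φ W h :=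
  Set.image_mono hle

/-- A system of local coordinates of dimension `p|q` on a super ringed space: an isomorphism of
super ringed spaces from an open subset onto a superdomain, i.e. a homeomorphism onto an open
subset of `ℝ^p` with parity preserving isomorphisms, compatible with restrictions, between the
superfunctions on `M` and those on the superdomain. -/
structure Chart (p q : ℕ) (M : SuperRingedSpace.{u}) where
  φ : OpenPartialHomeomorph M.space (Fin p → ℝ)
  equiv : ∀ (W : Opens M.space) (h : (W : Set M.space) ⊆ φ.source),
    M.Fun W ≃ₐ[ℝ] SuperFun p q (imageOpens φ W h)
  equiv_res : ∀ (W W' : Opens M.space) (h : (W : Set M.space) ⊆ φ.source)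
    (h' : (W' : Set M.space) ⊆ φ.source) (hle : W' ≤ W) (f : M.Fun W),
    equiv W' h' (M.res hle f) = SuperFun.res (imageOpens_mono φ h h' hle) (equiv W h f)
  equiv_inv : ∀ (W : Opens M.space) (h : (W : Set M.space) ⊆ φ.source) (f : M.Fun W),
    equiv W h (M.inv W f) = SuperFun.invol (equiv W h f)

namespace Chart

variable {M : SuperRingedSpace.{u}} (c c' : Chart p q M)

/-- The coordinate domain. -/
def dom : Opens M.space := ⟨c.φ.source, c.φ.open_source⟩

variable {W : Opens M.space} (h : W ≤ c.dom) (h' : W ≤ c'.dom)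

/-- The partial derivatives `∂_a = ∂/∂x^a` of the coordinate system, acting on superfunctions. -/
def d (a : Idx p q) (f : M.Fun W) : M.Fun W := (c.equiv W h).symm (SuperFun.d a (c.equiv W h f))

/-- The coordinate functions `x^a`. -/
def coord (a : Idx p q) : M.Fun W := (c.equiv W h).symm (SuperFun.coord a)

/-- The Berezin integral `∫ f |Dx|` over the coordinate domain. -/
def integral (f : M.Fun c.dom) : ℝ := SuperFun.berezin (c.equiv c.dom le_rfl f)

/-- The entry `∂_a x^{a'}` of the Jacobi matrix `∂x'/∂x` of a change of coordinates
(row `a`, column `a'`). -/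
def jac (a a' : Idx p q) : M.Fun W := c.d h a (c'.coord h' a')

/-- The even-even block of the Jacobi matrix. -/
def jacEE : Matrix (Fin p) (Fin p) (M.even W) :=
  Matrix.of fun i j => M.evenPart (c.jac c' h h' (Sum.inl i) (Sum.inl j))

/-- The odd-odd block of the Jacobi matrix. -/
def jacOO : Matrix (Fin q) (Fin q) (M.even W) :=
  Matrix.of fun i j => M.evenPart (c.jac c' h h' (Sum.inr i) (Sum.inr j))

/-- The product `B D⁻¹ C`, where `J = (A B; C D)` is the Jacobi matrix in block form. -/
def jacCorrection : Matrix (Fin p) (Fin p) (M.even W) :=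
  Matrix.of fun i j => M.evenPart (∑ k, ∑ l, c.jac c' h h' (Sum.inl i) (Sum.inr k) *
    ((c.jacOO c' h h')⁻¹ k l : M.Fun W) * c.jac c' h h' (Sum.inr l) (Sum.inl j))

/-- The Berezinian `Ber(∂x'/∂x) = det(A - B D⁻¹ C) · (det D)⁻¹`; it is `det(∂x'/∂x)`
if `q = 0`. (All entries of `A`, `D` and `B D⁻¹ C` are even; passing to even parts in the
definitions of these blocks only puts the entries into the commutative ring of even functions.) -/
def ber : M.even W :=
  (c.jacEE c' h h' - c.jacCorrection c' h h').det * Ring.inverse (c.jacOO c' h h').det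

/-- `r = |J|^{1/2}` for an even superfunction `J` whose body vanishes nowhere: the unique even
superfunction with positive body such that `r⁴ = J²`. -/
def IsSqrtAbs (J r : M.even W) : Prop :=
  (∀ x, 0 < SuperFun.body (c.equiv W h (r : M.Fun W)) x) ∧ r ^ 4 = J ^ 2

/-- The half-density transition factor `|Ber(∂x'/∂x)|^{1/2}`. -/
def sqrtAbsBer : M.even W := Classical.epsilon fun r => c.IsSqrtAbs h (c.ber c' h h') r

end Chart

/-- A (smooth, real) supermanifold of dimension `p|q`: a Hausdorff, second countable super ringed
space which is locally isomorphic to a superdomain of dimension `p|q`. For `q = 0` this is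
an ordinary smooth manifold of dimension `p`. -/
structure Supermanifold (p q : ℕ) extends SuperRingedSpace.{u} where
  t2 : T2Space space
  secondCountable : SecondCountableTopology space
  exists_chart : ∀ x : space, ∃ c : Chart p q toSuperRingedSpace, x ∈ c.dom

/-! ### Half-densities -/

variable (M : Supermanifold.{u} p q)

/-- Coordinate systems on `M`. -/
abbrev Coords := Chart p q M.toSuperRingedSpace

/-- Half-densities on `M`: in each coordinate system `s = s(x) |Dx|^{1/2}`, and under a change of
coordinates `s(x) = s'(x') |Ber(∂x'/∂x)|^{1/2}`. -/
def HalfDensity : Submodule ℝ (∀ c : Coords M, M.Fun c.dom) where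
  carrier := {s | ∀ c c' : Coords M,
    M.res inf_le_left (s c) = M.res inf_le_right (s c') *
      (c.sqrtAbsBer c' (W := c.dom ⊓ c'.dom) inf_le_left inf_le_right : M.Fun _)}
  add_mem' := by
    intro s t hs ht c c'
    simp only [Pi.add_apply, map_add, add_mul]
    rw [hs c c', ht c c']
  zero_mem' := by intro c c'; simp
  smul_mem' := by
    intro r s hs c c'
    simp only [Pi.smul_apply, map_smul, smul_mul_assoc]
    rw [hs c c']

variable {M}

/-- The half-density `s` is homogeneous of parity `ε`. -/
def HalfDensity.HasParity (ε : ZMod 2) (s : HalfDensity M) : Prop :=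
  ∀ c : Coords M, M.HasParity ε (s.1 c)

/-- The half-density `s` has compact support contained in the open set `U`: there is a compact
subset of `U` outside of which `s` vanishes. -/
def HalfDensity.CompactSupportIn (s : HalfDensity M) (U : Opens M.space) : Prop :=
  ∃ K : Set M.space, IsCompact K ∧ K ⊆ U ∧
    ∀ (c : Coords M) (W : Opens M.space) (h : W ≤ c.dom), Disjoint (W : Set M.space) K →
      M.res h (s.1 c) = 0

theorem res_res {U V W : Opens M.space} (h : V ≤ U) (h' : W ≤ V) (f : M.Fun U) :
    M.res h' (M.res h f) = M.res (h'.trans h) f := by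
  simp only [SuperRingedSpace.res, ← AlgCat.comp_apply, ← M.sheaf.1.map_comp]
  rfl

/-- Multiplication of half-densities by a superfunction on `M`, as an operator. -/
def mulOp (F : M.Fun ⊤) : Module.End ℝ (HalfDensity M) where
  toFun s := ⟨fun c => M.res le_top F * s.1 c, fun c c' => by
    rw [map_mul, map_mul, res_res, res_res, s.2 c c', mul_assoc]⟩
  map_add' s t := Subtype.ext (funext fun c => mul_add _ _ _)
  map_smul' r s := Subtype.ext (funext fun c => mul_smul_comm _ _ _)

/-! ### Symmetric contravariant tensors and second order operators -/

variable (M)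

/-- A symmetric contravariant tensor field `S = S^{ab} ∂_b ⊗ ∂_a` of rank 2 and parity `ε`, given
by its components in all coordinate systems:
`p(S^{ab}) = ε + p(a) + p(b)`, `S^{ab} = (-1)^{p(a)p(b)} S^{ba}`, and
`S^{a'b'} = ∑_{a,b} (-1)^{p(b)(p(a)+p(a'))} S^{ab} (∂_a x^{a'}) (∂_b x^{b'})`
under a change of coordinates. The signs are those that come from `∂_a = (∂_a x^{a'}) ∂_{a'}`
in the second order part of `S^{ab} ∂_b ∂_a`; there are none if `q = 0`. -/
structure SymTensor (ε : ZMod 2) where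
  comp : ∀ c : Coords M, Idx p q → Idx p q → M.Fun c.dom
  parity : ∀ c a b, M.HasParity (ε + par a + par b) (comp c a b)
  symm : ∀ c a b, comp c a b = sgn (par a * par b) • comp c b a
  transform : ∀ (c c' : Coords M) (a' b' : Idx p q),
    M.res (V := c.dom ⊓ c'.dom) inf_le_right (comp c' a' b') =
      ∑ a, ∑ b, sgn (par b * (par a + par a')) •
        (M.res (V := c.dom ⊓ c'.dom) inf_le_left (comp c a b) *
          c.jac c' inf_le_left inf_le_right a a' * c.jac c' inf_le_left inf_le_right b b')

variable {M}

/-- `Δ` is a differential operator of order at most 2 on half-densities with principal symbol `S`: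
in each coordinate system `Δ = ½ S^{ab} ∂_b ∂_a + L^a ∂_a + U`. -/
def HasSymbol {ε : ZMod 2} (S : SymTensor M ε) (Δ : Module.End ℝ (HalfDensity M)) : Prop :=
  ∀ c : Coords M, ∃ (L : Idx p q → M.Fun c.dom) (U : M.Fun c.dom), ∀ s : HalfDensity M,
    (Δ s).1 c = (1 / 2 : ℝ) • ∑ a, ∑ b, S.comp c a b * c.d le_rfl b (c.d le_rfl a (s.1 c)) +
      ∑ a, L a * c.d le_rfl a (s.1 c) + U * s.1 c

/-- The operator `Δ` is homogeneous of parity `ε`: `p(Δ s) = ε + p(s)`. -/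
def OpHasParity (ε : ZMod 2) (Δ : Module.End ℝ (HalfDensity M)) : Prop :=
  ∀ (δ : ZMod 2) (s : HalfDensity M), HalfDensity.HasParity δ s → HalfDensity.HasParity (ε + δ) (Δ s)

/-- The natural scalar product `⟨s₁, s₂⟩ = ∫ s₁(x) s₂(x) |Dx|` of half-densities one of which
has compact support in the domain of the coordinate system `c`. -/
def pairing (c : Coords M) (s₁ s₂ : HalfDensity M) : ℝ := c.integral (s₁.1 c * s₂.1 c)

/-- An operator `Δ` of parity `ε` is self-adjoint:
`⟨Δ s₁, s₂⟩ = (-1)^{ε p(s₁)} ⟨s₁, Δ s₂⟩`.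
By bilinearity of the scalar product and a partition of unity it is enough to have this for `s₁`
with compact support in a coordinate domain, where the scalar product is a Berezin integral in the
coordinates; in this form the condition makes sense on all supermanifolds (if the odd directions
are not orientable, these local integrals do not fit together to an integral over `M`, because
Berezin integrals change sign under odd coordinate changes of negative determinant). -/
def IsSelfAdjoint (ε : ZMod 2) (Δ : Module.End ℝ (HalfDensity M)) : Prop :=
  ∀ (c : Coords M) (δ : ZMod 2) (s₁ s₂ : HalfDensity M), HalfDensity.HasParity δ s₁ →
    HalfDensity.CompactSupportIn s₁ c.dom → pairing c (Δ s₁) s₂ = sgn (ε * δ) * pairing c s₁ (Δ s₂)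

/-- The class `F_S` of self-adjoint second order operators on half-densities with principal
symbol `S`; the operators have the parity of `S`. -/
def classF {ε : ZMod 2} (S : SymTensor M ε) : Set (Module.End ℝ (HalfDensity M)) :=
  {Δ | HasSymbol S Δ ∧ OpHasParity ε Δ ∧ IsSelfAdjoint ε Δ}

end SuperGeom

end

/-! In a chart, take the divergence form D s = ½ Σ ± ∂_b(S^{ab} ∂_a s) (`Chart.div`). It has
principal symbol S and no zeroth order term. Because S is symmetric, (D f) g − (±) f (D g) is a
total derivative (`Chart.exists_div_mul_eq`), so D is formally self-adjoint. D is not invariant, but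
with r = |Ber|^{1/2} it satisfies D(r f) = r D'f + D(r) f (`Chart.div_mul_of_isPiola`), so the
failure of invariance is only multiplication by a function.

Existence. Choose an even half-density σ with positive body (`Supermanifold.exists_positive`) and
put Δ s = D s − (Dσ/σ) s. The quotient s/σ is a genuine function, and s and σ produce the same
anomaly under a change of chart, so Δ is globally defined (`SymTensor.op_mem`). The subtracted
potential has parity ε, and multiplication by such a function is self-adjoint, so Δ lies in the
class (`SymTensor.op_mem_classF`). The same remark shows that functions of parity ε may be added
freely.

Uniqueness. The difference X of two operators is self-adjoint and locally of the form L^a ∂_a + U.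
Its supercommutator with x^a is multiplication by L^a. Self-adjointness on the pairs (x^a s₁, s₂)
and (s₁, x^a s₂) then gives 2∫ L^a s₁ s₂ = 0 for all test half-densities, hence L^a = 0
(`IsFirstOrder.eq_zero`). So X is multiplication by a function, which must be Xσ/σ
(`exists_eq_mulOp`).

Most of the work is the geometry behind the anomaly formula. The chain rule follows from Hadamard's
lemma (`Chart.chain_rule`). A Jacobi formula gives ∂_b log Ber = str(∂_b J · J⁻¹) (`Chart.d_ber`).
Hence r² satisfies the Piola identity (`Chart.isPiola_sqrtAbsBer`), which rewrites ρ ∂_{a'} as a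
divergence in the other coordinates. The cocycle property of r (`Chart.sqrtAbsBer_comp`) is needed
to extend local objects by zero. It is not derived from multiplicativity of the Berezinian: both
sides have squares satisfying the same Piola identity, so the ratio of these squares has zero
derivatives, and the bodies are compared by ordinary determinants. -/

open CategoryTheory TopologicalSpace Opposite
open scoped ContDiff

noncomputable section

namespace SuperGeom

variable {p q : ℕ}

section

/-! ### The Grassmann algebra -/

namespace Grassmann

/-- Left contraction with the `j`-th dual basis vector, the derivative along `θ^j`. -/
abbrev contr (j : Fin q) : Grassmann q →ₗ[ℝ] Grassmann q :=
  CliffordAlgebra.contractLeft (LinearMap.proj j : (Fin q → ℝ) →ₗ[ℝ] ℝ)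

/-- The generator `θ^j`. -/
abbrev θ (j : Fin q) : Grassmann q := ExteriorAlgebra.ι ℝ (Pi.single j 1)

/-- The parity involution. -/
abbrev inv : Grassmann q →ₐ[ℝ] Grassmann q := CliffordAlgebra.involute

/-- The body, i.e. the component of degree zero. -/
abbrev body : Grassmann q →ₐ[ℝ] ℝ := ExteriorAlgebra.algebraMapInv

theorem contr_ι_mul (j : Fin q) (v : Fin q → ℝ) (b : Grassmann q) :
    contr j (ExteriorAlgebra.ι ℝ v * b) = v j • b - ExteriorAlgebra.ι ℝ v * contr j b :=
  CliffordAlgebra.contractLeft_ι_mul _ _ _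

theorem inv_ι (v : Fin q → ℝ) : inv (ExteriorAlgebra.ι ℝ v) = -ExteriorAlgebra.ι ℝ v :=
  CliffordAlgebra.involute_ι v

theorem contr_mul (j : Fin q) (a b : Grassmann q) :
    contr j (a * b) = contr j a * b + inv a * contr j b := by
  induction a using CliffordAlgebra.left_induction with
  | algebraMap r =>
    rw [← Algebra.smul_def, map_smul, CliffordAlgebra.contractLeft_algebraMap, AlgHom.commutes,
      ← Algebra.smul_def, zero_mul, zero_add]
  | add x y hx hy => simp only [add_mul, map_add, hx, hy]; abel
  | ι_mul x v hx =>
    change contr j (ExteriorAlgebra.ι ℝ v * x * b) = contr j (ExteriorAlgebra.ι ℝ v * x) * b +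
      inv (ExteriorAlgebra.ι ℝ v * x) * contr j b
    rw [mul_assoc, contr_ι_mul, contr_ι_mul, hx, map_mul, inv_ι]
    simp only [mul_add, sub_mul, smul_mul_assoc, neg_mul, mul_assoc]
    abel

theorem inv_contr (j : Fin q) (a : Grassmann q) : inv (contr j a) = -contr j (inv a) := by
  induction a using CliffordAlgebra.left_induction with
  | algebraMap r => simp [CliffordAlgebra.contractLeft_algebraMap]
  | add x y hx hy => simp only [map_add, hx, hy]; abel
  | ι_mul x v hx =>
    change inv (contr j (ExteriorAlgebra.ι ℝ v * x)) = -contr j (inv (ExteriorAlgebra.ι ℝ v * x))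
    rw [contr_ι_mul, map_mul, inv_ι, map_sub, map_smul, map_mul, hx, inv_ι, neg_mul, neg_mul,
      map_neg, contr_ι_mul]
    simp only [mul_neg]
    abel

theorem body_inv (a : Grassmann q) : body (inv a) = body a := by
  have : (body.comp inv : Grassmann q →ₐ[ℝ] ℝ) = body := by
    apply ExteriorAlgebra.hom_ext
    ext i
    simp [ExteriorAlgebra.algebraMapInv, inv, body]
  exact DFunLike.congr_fun this a

/-- The Euler operator `∑ θ^j ∂/∂θ^j`. -/
def euler : Grassmann q →ₗ[ℝ] Grassmann q := ∑ j, LinearMap.mulLeft ℝ (θ j) ∘ₗ contr j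

theorem euler_apply (x : Grassmann q) : euler x = ∑ j, θ j * contr j x := by
  simp [euler]

/-- Contracting the new factor reproduces it, since Σ v_j θ^j is the vector itself. In the other
terms two signs cancel, one from the contraction and one from anticommuting θ^j past the vector. -/
theorem euler_ι_mul (v : Fin q → ℝ) (x : Grassmann q) :
    euler (ExteriorAlgebra.ι ℝ v * x) =
      ExteriorAlgebra.ι ℝ v * x + ExteriorAlgebra.ι ℝ v * euler x := by
  have hv : ExteriorAlgebra.ι ℝ v = ∑ j, v j • θ j := by
    conv_lhs => rw [pi_eq_sum_univ' v]
    simp [map_sum]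
  simp only [euler_apply, contr_ι_mul, mul_sub, Finset.sum_sub_distrib, Finset.mul_sum]
  have h1 : ∑ j, θ j * v j • x = ExteriorAlgebra.ι ℝ v * x := by
    rw [hv, Finset.sum_mul]; simp
  have h2 : ∀ j, θ j * (ExteriorAlgebra.ι ℝ v * contr j x) =
      -(ExteriorAlgebra.ι ℝ v * (θ j * contr j x)) := by
    intro j
    rw [← mul_assoc, ← mul_assoc, eq_neg_of_add_eq_zero_left (ExteriorAlgebra.ι_add_mul_swap _ v),
      neg_mul]
  rw [h1, Finset.sum_congr rfl fun j _ => h2 j, Finset.sum_neg_distrib, sub_neg_eq_add]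

theorem euler_ιMulti (n : ℕ) (v : Fin n → Fin q → ℝ) :
    euler (ExteriorAlgebra.ιMulti ℝ n v) = (n : ℝ) • ExteriorAlgebra.ιMulti ℝ n v := by
  induction n with
  | zero => simp [euler_apply]
  | succ n ih =>
    rw [ExteriorAlgebra.ιMulti_succ_apply, euler_ι_mul, ih]
    push_cast
    rw [add_smul, one_smul, mul_smul_comm, add_comm]

theorem euler_monomial (I : Finset (Fin q)) :
    euler (monomial q I) = (I.card : ℝ) • monomial q I := by
  rw [monomial, ExteriorAlgebra.basis_apply]
  exact euler_ιMulti _ _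

/-- The Euler operator is diagonal in the monomial basis with the degree as eigenvalue. It serves
below to read off degrees without computing contractions of monomials. -/
theorem repr_euler (x : Grassmann q) (I : Finset (Fin q)) :
    (monomial q).repr (euler x) I = I.card * (monomial q).repr x I := by
  have : (monomial q).coord I ∘ₗ euler = (I.card : ℝ) • (monomial q).coord I := by
    refine (monomial q).ext fun J => ?_
    simp only [LinearMap.comp_apply, euler_monomial, LinearMap.smul_apply, map_smul,
      Module.Basis.coord_apply, Module.Basis.repr_self, smul_eq_mul]
    rcases eq_or_ne J I with rfl | h
    · rfl
    · simp [h]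
  exact DFunLike.congr_fun this x

theorem euler_contr (j : Fin q) (x : Grassmann q) :
    euler (contr j x) = contr j (euler x) - contr j x := by
  rw [euler_apply, euler_apply, map_sum]
  have : ∀ k, contr j (θ k * contr k x) =
      (Pi.single k 1 : Fin q → ℝ) j • contr k x + θ k * contr k (contr j x) := by
    intro k
    rw [contr_ι_mul, CliffordAlgebra.contractLeft_comm, mul_neg, sub_neg_eq_add]
  simp only [this, Finset.sum_add_distrib]
  have : ∑ k, (Pi.single k 1 : Fin q → ℝ) j • contr k x = contr j x := by
    simp [Pi.single_apply]
  rw [this]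
  abel

/-- The coefficient of the top monomial. -/
def top : Grassmann q →ₗ[ℝ] ℝ := (monomial q).coord Finset.univ

/-- Contraction lowers the degree by one (`euler_contr`), so a top coefficient could only come from
degree q + 1. This is the odd half of the statement that the Berezin integral of a derivative
vanishes. -/
theorem top_contr (j : Fin q) (x : Grassmann q) : top (contr j x) = 0 := by
  have : top ∘ₗ contr j = 0 := by
    refine (monomial q).ext fun I => ?_
    have h1 := repr_euler (contr j (monomial q I)) Finset.univ
    rw [euler_contr, euler_monomial, map_smul, map_sub, map_smul] at h1
    simp only [Finsupp.sub_apply, Finsupp.smul_apply, smul_eq_mul, Finset.card_univ,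
      Fintype.card_fin] at h1
    have h2 : (I.card : ℝ) ≤ q := by exact_mod_cast card_finset_fin_le I
    change (monomial q).repr (contr j (monomial q I)) Finset.univ = 0
    have h3 : ((q : ℝ) + 1 - I.card) * (monomial q).repr (contr j (monomial q I)) Finset.univ = 0 := by
      linarith
    rcases mul_eq_zero.1 h3 with h | h
    · linarith
    · exact h
  exact DFunLike.congr_fun this x

theorem monomial_empty : monomial q ∅ = 1 := by
  rw [monomial, ExteriorAlgebra.basis_apply_ofCard (n := 0) _ Finset.card_empty,
    ExteriorAlgebra.ιMulti_family, ExteriorAlgebra.ιMulti_zero_apply]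

theorem monomial_mul_of_not_disjoint {I J : Finset (Fin q)} (h : ¬Disjoint I J) :
    monomial q I * monomial q J = 0 :=
  ExteriorAlgebra.basis_mul_of_not_disjoint (Pi.basisFun ℝ (Fin q))
    (⟨I, rfl⟩ : Set.powersetCard (Fin q) I.card) (⟨J, rfl⟩ : Set.powersetCard (Fin q) J.card) h

theorem monomial_mul_of_disjoint {I J : Finset (Fin q)} (h : Disjoint I J) :
    ∃ s : ℝ, s ≠ 0 ∧ monomial q I * monomial q J = s • monomial q (I ∪ J) := by
  have := ExteriorAlgebra.basis_mul_of_disjoint (Pi.basisFun ℝ (Fin q))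
    (⟨I, rfl⟩ : Set.powersetCard (Fin q) I.card) (⟨J, rfl⟩ : Set.powersetCard (Fin q) J.card) h
  rw [Set.powersetCard.coe_disjUnion, Finset.disjUnion_eq_union] at this
  refine ⟨((Set.powersetCard.permOfDisjoint (s := (⟨I, rfl⟩ : Set.powersetCard (Fin q) I.card))
    (t := (⟨J, rfl⟩ : Set.powersetCard (Fin q) J.card)) h).sign : ℤ), by simp, this.trans ?_⟩
  rw [Units.smul_def, Int.cast_smul_eq_zsmul]
  rfl

theorem body_eq_repr (x : Grassmann q) : body x = (monomial q).repr x ∅ := by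
  have : body.toLinearMap = (monomial q).coord ∅ := by
    refine (monomial q).ext fun I => ?_
    simp only [Module.Basis.coord_apply, Module.Basis.repr_self, AlgHom.toLinearMap_apply]
    rcases eq_or_ne I ∅ with rfl | h
    · simp [monomial_empty]
    · rw [Finsupp.single_eq_of_ne h.symm, monomial, ExteriorAlgebra.basis_apply]
      obtain ⟨n, hn⟩ : ∃ n, I.card = n + 1 :=
        Nat.exists_eq_succ_of_ne_zero (Finset.card_ne_zero.2 (Finset.nonempty_iff_ne_empty.2 h))
      -- The arity is a free variable here so that it can be replaced by n + 1, which exposes a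
      -- leading generator killed by the body.
      have key : ∀ (m : ℕ) (_ : m = n + 1) (v : Fin m → Fin q → ℝ),
          body (ExteriorAlgebra.ιMulti ℝ m v) = 0 := by
        rintro m rfl v
        rw [ExteriorAlgebra.ιMulti_succ_apply, map_mul]
        simp [ExteriorAlgebra.algebraMapInv]
      exact key _ hn _
  exact DFunLike.congr_fun this x

theorem eq_algebraMap_body {x : Grassmann q} (h : ∀ j, contr j x = 0) :
    x = algebraMap ℝ _ (body x) := by
  have hE : euler x = 0 := by simp [euler_apply, h]
  refine (monomial q).ext_elem fun I => ?_
  rw [Algebra.algebraMap_eq_smul_one, ← monomial_empty, map_smul, Module.Basis.repr_self,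
    body_eq_repr, Finsupp.smul_apply]
  rcases eq_or_ne I ∅ with rfl | hI
  · simp
  · have := repr_euler x I
    rw [hE] at this
    simp only [map_zero, Finsupp.zero_apply, zero_eq_mul, Nat.cast_eq_zero,
      Finset.card_eq_zero, hI, false_or] at this
    simp [this, Finsupp.single_eq_of_ne hI]

/-- Nondegeneracy of the Berezin pairing on one fibre. If θ^J is a monomial of least degree in x,
multiply by θ^{Jᶜ}: any other monomial θ^K of x meets Jᶜ, since K ⊆ J would force K = J by
minimality. So only the coefficient of θ^J reaches the top degree. -/
theorem eq_zero_of_top_mul {x : Grassmann q} (h : ∀ I, top (x * monomial q I) = 0) : x = 0 := by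
  by_contra hx
  have hne : ((monomial q).repr x).support.Nonempty := by
    rw [Finsupp.support_nonempty_iff]
    simpa using hx
  obtain ⟨J, hJ, hmin⟩ := Finset.exists_min_image _ Finset.card hne
  have hJ' : (monomial q).repr x J ≠ 0 := by simpa using hJ
  obtain ⟨s, hs, hsJ⟩ := monomial_mul_of_disjoint (q := q) (disjoint_compl_right (a := J))
  have := h Jᶜ
  rw [← (monomial q).sum_repr x, Finset.sum_mul, map_sum, Finset.sum_eq_single J] at this
  · rw [smul_mul_assoc, hsJ, map_smul, map_smul, Finset.union_compl] at this
    simp [top, hs, hJ'] at this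
  · intro K _ hK
    by_cases hKs : (monomial q).repr x K = 0
    · simp [hKs]
    rw [smul_mul_assoc, map_smul]
    by_cases hd : Disjoint K Jᶜ
    · obtain ⟨t, -, ht⟩ := monomial_mul_of_disjoint hd
      have hsub : K ⊆ J := by simpa [disjoint_compl_right_iff] using hd
      exact absurd (Finset.eq_of_subset_of_card_le hsub (hmin K (by simpa using hKs))) hK
    · rw [monomial_mul_of_not_disjoint hd]; simp
  · simp

/-- The k-th power lies in the span of monomials of degree at least k, and there are none of degree
q + 1. -/
theorem pow_eq_zero_of_body {x : Grassmann q} (h : body x = 0) : x ^ (q + 1) = 0 := by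
  have key : ∀ k : ℕ, x ^ k ∈ Submodule.span ℝ (monomial q '' {I | k ≤ I.card}) := by
    intro k
    induction k with
    | zero =>
      simp only [zero_le, Set.ofPred_true, Set.image_univ, (monomial q).span_eq, Submodule.mem_top]
    | succ k ih =>
      rw [pow_succ]
      have hx : x ∈ Submodule.span ℝ (monomial q '' {I | 1 ≤ I.card}) := by
        rw [← (monomial q).sum_repr x]
        refine Submodule.sum_mem _ fun I _ => ?_
        rcases eq_or_ne I ∅ with rfl | hI
        · rw [← body_eq_repr, h, zero_smul]; exact zero_mem _
        · exact Submodule.smul_mem _ _ (Submodule.subset_span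
            ⟨I, Finset.card_pos.2 (Finset.nonempty_iff_ne_empty.2 hI), rfl⟩)
      have := Submodule.mul_mem_mul ih hx
      rw [Submodule.span_mul_span] at this
      refine Submodule.span_le.2 ?_ this
      rintro _ ⟨_, ⟨I, hI, rfl⟩, _, ⟨J, hJ, rfl⟩, rfl⟩
      by_cases hd : Disjoint I J
      · obtain ⟨s, -, hs⟩ := monomial_mul_of_disjoint hd
        simp only [hs]
        refine Submodule.smul_mem _ _ (Submodule.subset_span ⟨_, ?_, rfl⟩)
        rw [Set.mem_ofPred_eq, Finset.card_union_of_disjoint hd]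
        exact add_le_add hI hJ
      · simp only [monomial_mul_of_not_disjoint hd]
        exact zero_mem _
  have := key (q + 1)
  have he : {I : Finset (Fin q) | q + 1 ≤ I.card} = ∅ := by
    ext I
    have := card_finset_fin_le I
    simp only [Set.mem_ofPred_eq, Set.mem_empty_iff_false, iff_false]
    omega
  rw [he] at this
  simpa using this

end Grassmann

end

section

open Grassmann (contr θ contr_mul inv_contr)

theorem Grassmann.contr_algebraMap (j : Fin q) (r : ℝ) : contr j (algebraMap ℝ _ r) = 0 :=
  CliffordAlgebra.contractLeft_algebraMap _ _ _

theorem Grassmann.contr_ι (j : Fin q) (v : Fin q → ℝ) :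
    contr j (ExteriorAlgebra.ι ℝ v) = algebraMap ℝ _ (v j) :=
  CliffordAlgebra.contractLeft_ι _ _ _

theorem sgn_zero : sgn 0 = 1 := rfl

theorem sgn_one : sgn 1 = -1 := if_neg (by decide)

theorem sgn_add (i j : ZMod 2) : sgn (i + j) = sgn i * sgn j := by
  have key : ∀ i : ZMod 2, i = 0 ∨ i = 1 := by decide
  rcases key i with rfl | rfl <;> rcases key j with rfl | rfl <;>
    simp [sgn, show (1 + 1 : ZMod 2) = 0 by decide]

theorem sgn_mul_self (i : ZMod 2) : sgn i * sgn i = 1 := by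
  rw [← sgn_add, show i + i = 0 from CharTwo.add_self_eq_zero i, sgn_zero]

theorem zmod2_cases (i : ZMod 2) : i = 0 ∨ i = 1 := by
  revert i; decide

/-! ### Superfunctions on superdomains -/

namespace SuperFun

variable {V V' : Opens (Fin p → ℝ)}

theorem ext_repr {f g : SuperFun p q V}
    (h : ∀ (x : V) I, (monomial q).repr (f.1 x) I = (monomial q).repr (g.1 x) I) : f = g :=
  Subtype.ext (funext fun x => (monomial q).ext_elem (h x))

theorem differentiableAt_coeff (f : SuperFun p q V) (I : Finset (Fin q)) (x : V) :
    DifferentiableAt ℝ (coeff f.1 I) x :=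
  ((f.2 I).contDiffAt (V.isOpen.mem_nhds x.2)).differentiableAt (by simp)

theorem repr_dEven (i : Fin p) (f : SuperFun p q V) (I : Finset (Fin q)) (x : V) :
    (monomial q).repr ((dEven i f).1 x) I = fderiv ℝ (coeff f.1 I) x (Pi.single i 1) := by
  simp [dEven, Finsupp.single_apply]

/-- `coeff` is an extension by zero, so a formula for the coefficients is only available on V. As V
is open, agreement there suffices to differentiate. -/
theorem repr_dEven_of_hasFDerivAt {i : Fin p} {f : SuperFun p q V} {I : Finset (Fin q)} {x : V}
    {G : (Fin p → ℝ) → ℝ} {G' : (Fin p → ℝ) →L[ℝ] ℝ} (hG : HasFDerivAt G G' x)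
    (h : ∀ y : V, (monomial q).repr (f.1 y) I = G y) :
    (monomial q).repr ((dEven i f).1 x) I = G' (Pi.single i 1) := by
  rw [repr_dEven]
  have : coeff f.1 I =ᶠ[nhds (x : Fin p → ℝ)] G := by
    filter_upwards [V.isOpen.mem_nhds x.2] with y hy
    rw [coeff_apply f.1 I ⟨y, hy⟩, h]
  rw [this.fderiv_eq, hG.fderiv]

theorem hasFDerivAt_coeff (f : SuperFun p q V) (I : Finset (Fin q)) (x : V) :
    HasFDerivAt (coeff f.1 I) (fderiv ℝ (coeff f.1 I) x) x :=
  (differentiableAt_coeff f I x).hasFDerivAt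

theorem dEven_add (i : Fin p) (f g : SuperFun p q V) :
    dEven i (f + g) = dEven i f + dEven i g := by
  refine ext_repr fun x I => ?_
  rw [repr_dEven_of_hasFDerivAt ((hasFDerivAt_coeff f I x).add (hasFDerivAt_coeff g I x))
    (fun y => by simp [coeff_apply])]
  change _ = (monomial q).repr ((dEven i f).1 x + (dEven i g).1 x) I
  rw [map_add, Finsupp.add_apply, repr_dEven, repr_dEven]
  rfl

/-- Even derivatives commute with constant linear maps of the Grassmann algebra. This covers
scalars, the parity involution and the odd derivatives at once. -/
theorem dEven_map (i : Fin p) {f g : SuperFun p q V} (T : Grassmann q →ₗ[ℝ] Grassmann q)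
    (h : ∀ x, g.1 x = T (f.1 x)) (x : V) : (dEven i g).1 x = T ((dEven i f).1 x) := by
  refine (monomial q).ext_elem fun I => ?_
  have hT : ∀ y : Grassmann q, (monomial q).repr (T y) I =
      ∑ J, (monomial q).repr (T (monomial q J)) I * (monomial q).repr y J := by
    intro y
    conv_lhs => rw [← (monomial q).sum_repr y]
    simp only [map_sum, map_smul, Finsupp.finsetSum_apply, Finsupp.smul_apply, smul_eq_mul]
    exact Finset.sum_congr rfl fun _ _ => mul_comm _ _
  rw [repr_dEven_of_hasFDerivAt (HasFDerivAt.fun_sum (u := Finset.univ) fun J _ =>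
    (hasFDerivAt_coeff f J x).const_mul ((monomial q).repr (T (monomial q J)) I))
    (fun y => by rw [h, hT]; simp [coeff_apply]), hT]
  simp [repr_dEven]

theorem dEven_mul (i : Fin p) (f g : SuperFun p q V) :
    dEven i (f * g) = dEven i f * g + f * dEven i g := by
  refine ext_repr fun x K => ?_
  have hm : ∀ a b : Grassmann q, (monomial q).repr (a * b) K = ∑ I, ∑ J,
      (monomial q).repr a I * (monomial q).repr b J *
        (monomial q).repr (monomial q I * monomial q J) K := by
    intro a b
    conv_lhs => rw [← (monomial q).sum_repr a, ← (monomial q).sum_repr b]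
    simp only [Finset.sum_mul_sum, map_sum, Finsupp.finsetSum_apply, smul_mul_smul_comm,
      map_smul, Finsupp.smul_apply, smul_eq_mul]
  rw [repr_dEven_of_hasFDerivAt (HasFDerivAt.fun_sum (u := Finset.univ) fun I _ =>
    HasFDerivAt.fun_sum (u := Finset.univ) fun J _ =>
    ((hasFDerivAt_coeff f I x).mul (hasFDerivAt_coeff g J x)).mul_const
      ((monomial q).repr (monomial q I * monomial q J) K))
    (fun y => by
      change (monomial q).repr (f.1 y * g.1 y) K = _
      rw [hm]; simp [coeff_apply])]
  change _ = (monomial q).repr ((dEven i f).1 x * g.1 x + f.1 x * (dEven i g).1 x) K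
  rw [map_add, Finsupp.add_apply, hm, hm, ← Finset.sum_add_distrib]
  simp only [sum_apply]
  refine Finset.sum_congr rfl fun I _ => ?_
  rw [← Finset.sum_add_distrib]
  refine Finset.sum_congr rfl fun J _ => ?_
  simp only [repr_dEven, coeff_apply, smul_apply,
    add_apply, smul_eq_mul]
  ring

theorem dEven_comm (i j : Fin p) (f : SuperFun p q V) :
    dEven i (dEven j f) = dEven j (dEven i f) := by
  refine ext_repr fun x I => ?_
  have h2 : ContDiffAt ℝ 2 (coeff f.1 I) x :=
    ((f.2 I).contDiffAt (V.isOpen.mem_nhds x.2)).of_le (by exact WithTop.coe_le_coe.2 le_top)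
  have hd : DifferentiableAt ℝ (fderiv ℝ (coeff f.1 I)) x :=
    (h2.fderiv_right (m := 1) (by norm_num)).differentiableAt (by simp)
  have key : ∀ i j : Fin p, (monomial q).repr ((dEven i (dEven j f)).1 x) I =
      fderiv ℝ (fderiv ℝ (coeff f.1 I)) x (Pi.single i 1) (Pi.single j 1) := by
    intro i j
    rw [repr_dEven_of_hasFDerivAt (hd.hasFDerivAt.clm_apply (hasFDerivAt_const (Pi.single j 1) _))
      (fun y => by rw [repr_dEven])]
    simp
  rw [key, key]
  exact (h2.isSymmSndFDerivAt (by simp)).eq _ _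

theorem coeff_res (h : V' ≤ V) (f : SuperFun p q V) (I : Finset (Fin q)) (x : V') :
    coeff (res h f).1 I x = coeff f.1 I x := by
  rw [coeff_apply (res h f).1 I x, coeff_apply f.1 I ⟨x, h x.2⟩]
  rfl

theorem dEven_res (h : V' ≤ V) (i : Fin p) (f : SuperFun p q V) :
    dEven i (res h f) = res h (dEven i f) := by
  refine ext_repr fun x I => ?_
  have hG : HasFDerivAt (coeff f.1 I) (fderiv ℝ (coeff f.1 I) x) x :=
    hasFDerivAt_coeff f I ⟨x, h x.2⟩
  have h1 := repr_dEven_of_hasFDerivAt (i := i) (f := res h f) (x := x) hG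
    (fun y => by rw [← coeff_res h, coeff_apply (res h f).1 I y])
  have h2 := repr_dEven i f I ⟨x, h x.2⟩
  exact h1.trans h2.symm

/-- The `α`-fold iterate of the parity involution. -/
def tw (α : ZMod 2) (f : SuperFun p q V) : SuperFun p q V := if α = 0 then f else invol f

theorem d_inl (i : Fin p) (f : SuperFun p q V) : d (Sum.inl i) f = dEven i f := rfl

theorem d_add (a : Idx p q) (f g : SuperFun p q V) : d a (f + g) = d a f + d a g := by
  rcases a with i | j
  · exact dEven_add i f g
  · exact Subtype.ext (funext fun x => map_add (contr j) (f.1 x) (g.1 x))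

theorem d_smul (a : Idx p q) (r : ℝ) (f : SuperFun p q V) : d a (r • f) = r • d a f := by
  rcases a with i | j
  · refine Subtype.ext (funext fun x => ?_)
    have := dEven_map i (f := f) (g := r • f) (r • LinearMap.id) (fun _ => rfl) x
    exact this
  · exact Subtype.ext (funext fun x => map_smul (contr j) r (f.1 x))

/-- Writing the sign through `tw` keeps the Leibniz rule meaningful for inhomogeneous `f`, which has
no parity. -/
theorem d_mul (a : Idx p q) (f g : SuperFun p q V) :
    d a (f * g) = d a f * g + tw (par a) f * d a g := by
  rcases a with i | j
  · exact dEven_mul i f g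
  · exact Subtype.ext (funext fun x => contr_mul j (f.1 x) (g.1 x))

theorem d_invol (a : Idx p q) (f : SuperFun p q V) :
    d a (invol f) = sgn (par a) • invol (d a f) := by
  rcases a with i | j
  · refine Subtype.ext (funext fun x => ?_)
    have := dEven_map i (f := f) (g := invol f) Grassmann.inv.toLinearMap (fun _ => rfl) x
    rw [d_inl, this]
    exact (one_smul ℝ _).symm
  · refine Subtype.ext (funext fun x => ?_)
    have := inv_contr j (f.1 x)
    change contr j (Grassmann.inv (f.1 x)) = sgn 1 • Grassmann.inv (contr j (f.1 x))
    rw [this, sgn_one, smul_neg, neg_smul, one_smul, neg_neg]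

theorem d_comm (a b : Idx p q) (f : SuperFun p q V) :
    d a (d b f) = sgn (par a * par b) • d b (d a f) := by
  have h1 : ∀ g : SuperFun p q V, g = sgn 0 • g := fun g => (one_smul ℝ g).symm
  rcases a with i | j <;> rcases b with k | l
  · exact (dEven_comm i k f).trans (h1 _)
  · refine Eq.trans ?_ (h1 _)
    exact Subtype.ext (funext fun x => dEven_map i (contr l) (fun _ => rfl) x)
  · refine Eq.trans ?_ (h1 _)
    exact Subtype.ext (funext fun x => (dEven_map k (contr j) (fun _ => rfl) x).symm)
  · refine Subtype.ext (funext fun x => ?_)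
    change contr j (contr l (f.1 x)) = sgn (1 * 1) • contr l (contr j (f.1 x))
    rw [CliffordAlgebra.contractLeft_comm, mul_one, sgn_one, neg_smul, one_smul]

theorem d_res (h : V' ≤ V) (a : Idx p q) (f : SuperFun p q V) :
    d a (res h f) = res h (d a f) := by
  rcases a with i | j
  · exact dEven_res h i f
  · rfl

theorem coord_inr_apply (j : Fin q) (x : V) :
    (coord (Sum.inr j) : SuperFun p q V).1 x = θ j := rfl

theorem d_coord (a b : Idx p q) :
    d a (coord b : SuperFun p q V) = if a = b then 1 else 0 := by
  rcases a with i | j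
  · rcases b with k | l
    · refine ext_repr fun x I => ?_
      have h1 : HasFDerivAt (fun y : Fin p → ℝ => (monomial q).repr 1 I * y k)
          ((monomial q).repr 1 I • (ContinuousLinearMap.proj k : (Fin p → ℝ) →L[ℝ] ℝ)) x :=
        ((ContinuousLinearMap.proj k : (Fin p → ℝ) →L[ℝ] ℝ).hasFDerivAt).const_mul _
      rw [d_inl, repr_dEven_of_hasFDerivAt h1 (fun y => by
        simp only [coord]
        rw [Algebra.algebraMap_eq_smul_one]; simp [mul_comm])]
      by_cases h : i = k
      · subst h; simp
      · rw [if_neg (by simpa using h)]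
        simp [Ne.symm h]
    · refine ext_repr fun x I => ?_
      have h1 : HasFDerivAt (fun _ : Fin p → ℝ => (monomial q).repr (θ l) I)
          (0 : (Fin p → ℝ) →L[ℝ] ℝ) x :=
        hasFDerivAt_const _ _
      rw [d_inl, if_neg (by simp)]
      rw [repr_dEven_of_hasFDerivAt h1 (fun y => by rw [coord_inr_apply])]
      change (0 : ℝ) = (monomial q).repr 0 I
      simp
  · rcases b with k | l
    · refine Subtype.ext (funext fun x => ?_)
      exact Grassmann.contr_algebraMap _ _
    · refine Subtype.ext (funext fun x => ?_)
      refine (Grassmann.contr_ι _ _).trans ?_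
      by_cases h : j = l
      · subst h; simp
      · simp [h]

theorem invol_coord (a : Idx p q) :
    invol (coord a : SuperFun p q V) = sgn (par a) • coord a := by
  rcases a with i | j
  · refine Subtype.ext (funext fun x => ?_)
    exact (AlgHom.commutes _ _).trans (one_smul ℝ _).symm
  · refine Subtype.ext (funext fun x => ?_)
    refine (Grassmann.inv_ι _).trans ?_
    change _ = sgn 1 • θ j
    rw [sgn_one, neg_smul, one_smul]

end SuperFun

end

section

/-! ### Analytic preliminaries -/

section Analysis

open MeasureTheory Set Function

/-- A product of a smooth function and a function which is smooth near the support of the first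
factor is smooth. -/
theorem contDiff_mul_of_tsupport_subset {E : Type*} [NormedAddCommGroup E] [NormedSpace ℝ E]
    {χ g : E → ℝ} {V : Set E} (hV : IsOpen V) (hχ : ContDiff ℝ ∞ χ) (hs : tsupport χ ⊆ V)
    (hg : ContDiffOn ℝ ∞ g V) : ContDiff ℝ ∞ (fun x => χ x * g x) := by
  rw [contDiff_iff_contDiffAt]
  intro x
  by_cases hx : x ∈ V
  · exact hχ.contDiffAt.mul (hg.contDiffAt (hV.mem_nhds hx))
  · have : (fun y => χ y * g y) =ᶠ[nhds x] fun _ => 0 := by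
      have h0 := notMem_tsupport_iff_eventuallyEq.1 fun h => hx (hs h)
      filter_upwards [h0] with y hy
      simp [hy]
    exact contDiffAt_const.congr_of_eventuallyEq this

/-- Near each point of an open set there is a compactly supported smooth cutoff function. -/
theorem exists_cutoff {E : Type*} [NormedAddCommGroup E] [NormedSpace ℝ E] [FiniteDimensional ℝ E]
    {V : Set E} (hV : IsOpen V) {y : E} (hy : y ∈ V) :
    ∃ χ : E → ℝ, ContDiff ℝ ∞ χ ∧ HasCompactSupport χ ∧ tsupport χ ⊆ V ∧
      (∀ x, 0 ≤ χ x) ∧ ∀ᶠ x in nhds y, χ x = 1 := by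
  obtain ⟨ε, hε, hball⟩ := Metric.isOpen_iff.1 hV y hy
  let f : ContDiffBump y := ⟨ε / 4, ε / 2, by positivity, by linarith⟩
  refine ⟨f, f.contDiff, f.hasCompactSupport, ?_, fun x => f.nonneg, f.eventuallyEq_one⟩
  rw [f.tsupport_eq]
  exact (Metric.closedBall_subset_ball (by change ε / 2 < ε; linarith)).trans hball

/-- Integrals over `[0,1]` depend smoothly on parameters. -/
theorem contDiff_integral_Icc {E : Type*} [NormedAddCommGroup E] [NormedSpace ℝ E]
    {F : E × ℝ → ℝ} (hF : ContDiff ℝ ∞ F) :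
    ContDiff ℝ ∞ (fun x => ∫ t in Icc (0 : ℝ) 1, F (x, t)) := by
  -- The integral is the value at 0 of the convolution, in t, of the indicator of [0,1] with f(t)
  -- F(x, −t). The bump makes this kernel compactly supported in t and equals 1 on [−1, 0], the only
  -- part that is seen.
  let f : ContDiffBump (0 : ℝ) := ⟨2, 3, by norm_num, by norm_num⟩
  let g : E → ℝ → ℝ := fun x t => f t * F (x, -t)
  have hg : ContDiffOn ℝ ∞ ↿g (univ ×ˢ univ) := by
    refine ContDiff.contDiffOn ?_
    change ContDiff ℝ ∞ (fun z : E × ℝ => f z.2 * F (z.1, -z.2))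
    exact (f.contDiff.comp contDiff_snd).mul
      (hF.comp (contDiff_fst.prodMk contDiff_snd.neg))
  have hloc : LocallyIntegrable (indicator (Icc (0 : ℝ) 1) fun _ => (1 : ℝ)) volume :=
    ((integrableOn_const (by simp)).integrable_indicator measurableSet_Icc).locallyIntegrable
  have key := contDiffOn_convolution_right_with_param_comp (𝕜 := ℝ) (n := ⊤)
    (ContinuousLinearMap.lsmul ℝ ℝ : ℝ →L[ℝ] ℝ →L[ℝ] ℝ)
    (μ := volume) (s := (univ : Set E)) (v := fun _ => (0 : ℝ)) contDiffOn_const (g := g)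
    (k := Metric.closedBall 0 3) isOpen_univ (isCompact_closedBall _ _) (fun x t _ ht => by
      have : f t = 0 := f.zero_of_le_dist (by
        rw [Metric.mem_closedBall, not_le] at ht; exact ht.le)
      simp [g, this]) hloc hg
  rw [contDiffOn_univ] at key
  convert key using 2 with x
  rw [convolution_lsmul, ← integral_indicator measurableSet_Icc]
  refine integral_congr_ae (Filter.Eventually.of_forall fun t => ?_)
  by_cases ht : t ∈ Icc (0 : ℝ) 1
  · have : f (-t) = 1 := f.one_of_mem_closedBall (by
      rw [Metric.mem_closedBall, dist_zero_right, norm_neg, Real.norm_eq_abs, abs_of_nonneg ht.1]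
      exact ht.2.trans (by norm_num))
    simp [ht, g, this]
  · simp [ht]

/-- Hadamard's lemma. -/
theorem exists_eq_add_sum_mul {V : Set (Fin p → ℝ)} (hV : IsOpen V) {g : (Fin p → ℝ) → ℝ}
    (hg : ContDiffOn ℝ ∞ g V) {y : Fin p → ℝ} (hy : y ∈ V) :
    ∃ h : Fin p → (Fin p → ℝ) → ℝ, (∀ i, ContDiff ℝ ∞ (h i)) ∧
      ∀ᶠ x in nhds y, g x = g y + ∑ i, (x i - y i) * h i x := by
  -- After the cutoff the function is smooth everywhere, so the segment from y to x need not stay in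
  -- V. The witnesses are then the usual ∫₀¹ ∂_i G(y + t(x − y)) dt.
  obtain ⟨χ, hχ, -, hs, -, h1⟩ := exists_cutoff hV hy
  have hG := contDiff_mul_of_tsupport_subset hV hχ hs hg
  set G : (Fin p → ℝ) → ℝ := fun x => χ x * g x with hGdef
  have hG' : ContDiff ℝ ∞ (fderiv ℝ G) := hG.fderiv_right (by simp)
  refine ⟨fun i x => ∫ t in Icc (0 : ℝ) 1, fderiv ℝ G (y + t • (x - y)) (Pi.single i 1),
    fun i => contDiff_integral_Icc (F := fun z : (Fin p → ℝ) × ℝ =>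
      fderiv ℝ G (y + z.2 • (z.1 - y)) (Pi.single i 1)) ?_, ?_⟩
  · exact (hG'.comp (contDiff_const.add (contDiff_snd.smul (contDiff_fst.sub
      contDiff_const)))).clm_apply contDiff_const
  · have key : ∀ x, G x = G y + ∑ i, (x i - y i) *
        ∫ t in Icc (0 : ℝ) 1, fderiv ℝ G (y + t • (x - y)) (Pi.single i 1) := by
      intro x
      have hd : ∀ t ∈ uIcc (0 : ℝ) 1, HasDerivAt (fun t : ℝ => G (y + t • (x - y)))
          (fderiv ℝ G (y + t • (x - y)) (x - y)) t := by
        intro t _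
        have h2 : HasDerivAt (fun t : ℝ => y + t • (x - y)) (x - y) t := by
          simpa using ((hasDerivAt_id t).smul_const (x - y)).const_add y
        exact ((hG.differentiable (by simp)) _).hasFDerivAt.comp_hasDerivAt t h2
      have hc : ∀ v, Continuous fun t : ℝ => fderiv ℝ G (y + t • (x - y)) v := fun v =>
        (hG'.continuous.comp (by fun_prop)).clm_apply continuous_const
      have h3 := intervalIntegral.integral_eq_sub_of_hasDerivAt hd ((hc _).intervalIntegrable _ _)
      have h4 : ∀ t : ℝ, fderiv ℝ G (y + t • (x - y)) (x - y) =
          ∑ i, (x i - y i) * fderiv ℝ G (y + t • (x - y)) (Pi.single i 1) := by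
        intro t
        generalize fderiv ℝ G (y + t • (x - y)) = A
        conv_lhs => rw [pi_eq_sum_univ' (x - y)]
        rw [map_sum]
        refine Finset.sum_congr rfl fun i _ => ?_
        rw [map_smul, smul_eq_mul, Pi.sub_apply]
      simp only [h4, one_smul, add_sub_cancel, zero_smul, add_zero] at h3
      rw [intervalIntegral.integral_finsetSum
        (fun i _ => ((hc _).const_mul _).intervalIntegrable _ _)] at h3
      simp only [intervalIntegral.integral_const_mul] at h3
      rw [← sub_eq_iff_eq_add', ← h3]
      refine Finset.sum_congr rfl fun i _ => ?_
      rw [intervalIntegral.integral_of_le zero_le_one, integral_Icc_eq_integral_Ioc]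
    have hy1 : χ y = 1 := h1.self_of_nhds
    filter_upwards [h1] with x hx
    have := key x
    simpa [hGdef, hx, hy1] using this

/-- The integral of a partial derivative of a compactly supported function vanishes. -/
theorem integral_fderiv_eq_zero {E : Type*} [NormedAddCommGroup E] [NormedSpace ℝ E]
    [FiniteDimensional ℝ E] [MeasurableSpace E] [BorelSpace E] (μ : Measure E) [μ.IsAddHaarMeasure]
    {f : E → ℝ} (hf : ContDiff ℝ ∞ f) (hc : HasCompactSupport f) (v : E) :
    ∫ x, fderiv ℝ f x v ∂μ = 0 := by
  have h1 : Integrable (fun x => fderiv ℝ f x v) μ := by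
    refine Continuous.integrable_of_hasCompactSupport
      ((hf.continuous_fderiv (by simp)).clm_apply continuous_const) ?_
    exact hc.fderiv_apply ℝ v
  -- Integration by parts against the constant function 1.
  have := integral_mul_fderiv_eq_neg_fderiv_mul_of_integrable (μ := μ) (f := fun _ => (1 : ℝ))
    (g := f) (v := v) (by simp) (by simpa using h1)
    (by simpa using hf.continuous.integrable_of_hasCompactSupport hc)
    (fun x _ => differentiableAt_const _) (fun x _ => (hf.differentiable (by simp)) x)
  simpa using this

end Analysis

end

section

namespace SuperFun

open MeasureTheory

variable {V V' : Opens (Fin p → ℝ)}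

/-! ### Bodies, units, functions of the even coordinates -/

/-- The body at a point as an algebra homomorphism. -/
def bodyHom (x : V) : SuperFun p q V →ₐ[ℝ] ℝ :=
  Grassmann.body.comp ((Pi.evalAlgHom ℝ (fun _ : V => Grassmann q) x).comp (SuperFun p q V).val)

theorem bodyHom_invol (f : SuperFun p q V) (x : V) : bodyHom x (invol f) = bodyHom x f :=
  Grassmann.body_inv (f.1 x)

theorem bodyHom_eq_coeff (f : SuperFun p q V) (x : V) : bodyHom x f = coeff f.1 ∅ x := by
  rw [coeff_apply, ← Grassmann.body_eq_repr]
  rfl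

/-- A smooth function of the even coordinates as a superfunction. -/
def ofReal (V : Opens (Fin p → ℝ)) (g : (Fin p → ℝ) → ℝ) (hg : ContDiffOn ℝ ∞ g V) :
    SuperFun p q V :=
  ⟨fun x => algebraMap ℝ _ (g x), IsSmooth.of_repr (fun I x => g x * (monomial q).repr 1 I)
    (fun _ => hg.mul contDiffOn_const) fun I x => by
      rw [Algebra.algebraMap_eq_smul_one, map_smul]; rfl⟩

theorem ofReal_apply (g : (Fin p → ℝ) → ℝ) (hg : ContDiffOn ℝ ∞ g V) (x : V) :
    (ofReal V g hg : SuperFun p q V).1 x = algebraMap ℝ _ (g x) := rfl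

theorem bodyHom_ofReal (g : (Fin p → ℝ) → ℝ) (hg : ContDiffOn ℝ ∞ g V) (x : V) :
    bodyHom x (ofReal V g hg : SuperFun p q V) = g x := AlgHom.commutes _ _

theorem invol_ofReal (g : (Fin p → ℝ) → ℝ) (hg : ContDiffOn ℝ ∞ g V) :
    invol (ofReal V g hg : SuperFun p q V) = ofReal V g hg :=
  Subtype.ext (funext fun _ => AlgHom.commutes _ _)

/-- The superfunction obtained by dropping the odd coordinates. -/
def bodyFun (f : SuperFun p q V) : SuperFun p q V := ofReal V (coeff f.1 ∅) (f.2 ∅)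

theorem bodyFun_apply (f : SuperFun p q V) (x : V) :
    (bodyFun f).1 x = algebraMap ℝ _ (bodyHom x f) := by
  rw [bodyHom_eq_coeff]; rfl

theorem isNilpotent_sub_bodyFun (f : SuperFun p q V) : IsNilpotent (f - bodyFun f) := by
  refine ⟨q + 1, Subtype.ext (funext fun x => ?_)⟩
  refine Grassmann.pow_eq_zero_of_body (x := (f - bodyFun f).1 x) ?_
  change Grassmann.body (f.1 x - (bodyFun f).1 x) = 0
  rw [map_sub, bodyFun_apply, AlgHom.commutes]
  exact sub_self _

theorem isNilpotent_of_bodyHom {f : SuperFun p q V} (h : ∀ x, bodyHom x f = 0) :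
    IsNilpotent f := by
  have : bodyFun f = 0 := Subtype.ext (funext fun x => by rw [bodyFun_apply, h, map_zero]; rfl)
  simpa [this] using isNilpotent_sub_bodyFun f

/-- A superfunction is its body plus a nilpotent, and body functions are central. So it is
invertible exactly when the real function underneath is. -/
theorem isUnit_iff (f : SuperFun p q V) : IsUnit f ↔ ∀ x, bodyHom x f ≠ 0 := by
  constructor
  · exact fun h x => (h.map (bodyHom x)).ne_zero
  · intro h
    have hb : IsUnit (bodyFun f) := by
      have hg : ContDiffOn ℝ ∞ (fun x => (coeff f.1 ∅ x)⁻¹) V :=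
        (f.2 ∅).inv fun x hx => by
          have := h ⟨x, hx⟩
          rwa [bodyHom_eq_coeff] at this
      have h1 : ∀ x : V, coeff f.1 ∅ x ≠ 0 := fun x => bodyHom_eq_coeff f x ▸ h x
      refine isUnit_iff_exists.2 ⟨ofReal V _ hg, Subtype.ext (funext fun x => ?_),
        Subtype.ext (funext fun x => ?_)⟩
      · change algebraMap ℝ (Grassmann q) _ * algebraMap ℝ (Grassmann q) _ = 1
        rw [← map_mul, mul_inv_cancel₀ (h1 x), map_one]
      · change algebraMap ℝ (Grassmann q) _ * algebraMap ℝ (Grassmann q) _ = 1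
        rw [← map_mul, inv_mul_cancel₀ (h1 x), map_one]
    have := (isNilpotent_sub_bodyFun f).isUnit_add_left_of_commute hb
      (Subtype.ext (funext fun x => ?_))
    · simpa using this
    · exact (Algebra.commutes _ _).symm

theorem eq_bodyFun_of_dOdd {f : SuperFun p q V} (h : ∀ j, dOdd j f = 0) : f = bodyFun f := by
  refine Subtype.ext (funext fun x => ?_)
  rw [bodyFun_apply]
  exact Grassmann.eq_algebraMap_body fun j => congrFun (congrArg Subtype.val (h j)) x

/-- Vanishing odd derivatives leave only the body. No even derivatives are needed, because the body
is prescribed. -/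
theorem eq_one_of_dOdd {f : SuperFun p q V} (h : ∀ j, dOdd j f = 0)
    (h1 : ∀ x, bodyHom x f = 1) : f = 1 := by
  rw [eq_bodyFun_of_dOdd h]
  refine Subtype.ext (funext fun x => ?_)
  rw [bodyFun_apply, h1, map_one]
  rfl

/-! ### The Berezin integral -/

theorem coeff_eq_zero {f : V → Grassmann q} {I : Finset (Fin q)} {x : Fin p → ℝ}
    (h : ∀ hx : x ∈ V, f ⟨x, hx⟩ = 0) : coeff f I x = 0 := by
  by_cases hx : x ∈ V
  · rw [coeff_apply f I ⟨x, hx⟩, h hx]; simp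
  · exact Function.extend_apply' _ _ _ fun ⟨y, hy⟩ => hx (hy ▸ y.2)

/-- The superfunction `f` vanishes outside the set `K`. -/
def VanishesOff (f : SuperFun p q V) (K : Set (Fin p → ℝ)) : Prop :=
  ∀ x : V, (x : Fin p → ℝ) ∉ K → f.1 x = 0

variable {f g : SuperFun p q V} {K : Set (Fin p → ℝ)}

theorem VanishesOff.support_coeff (hf : VanishesOff f K) (I : Finset (Fin q)) :
    Function.support (coeff f.1 I) ⊆ K := fun x hx => by
  by_contra h
  exact hx (coeff_eq_zero fun hV => hf ⟨x, hV⟩ h)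

theorem VanishesOff.hasCompactSupport (hf : VanishesOff f K) (hK : IsCompact K)
    (I : Finset (Fin q)) : HasCompactSupport (coeff f.1 I) :=
  HasCompactSupport.of_support_subset_isCompact hK (hf.support_coeff I)

theorem VanishesOff.contDiff (hf : VanishesOff f K) (hK : IsCompact K) (hKV : K ⊆ V)
    (I : Finset (Fin q)) : ContDiff ℝ ∞ (coeff f.1 I) := by
  rw [contDiff_iff_contDiffAt]
  intro x
  by_cases hx : x ∈ V
  · exact (f.2 I).contDiffAt (V.isOpen.mem_nhds hx)
  · refine (contDiffAt_const (c := 0)).congr_of_eventuallyEq ?_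
    filter_upwards [hK.isClosed.isOpen_compl.mem_nhds fun h => hx (hKV h)] with y hy
    by_contra h
    exact hy (hf.support_coeff I h)

theorem VanishesOff.integrable (hf : VanishesOff f K) (hK : IsCompact K) (hKV : K ⊆ V)
    (I : Finset (Fin q)) : Integrable (coeff f.1 I) :=
  (hf.contDiff hK hKV I).continuous.integrable_of_hasCompactSupport (hf.hasCompactSupport hK I)

theorem coeff_add (f g : SuperFun p q V) (I : Finset (Fin q)) :
    coeff (f + g).1 I = coeff f.1 I + coeff g.1 I := by
  ext x
  by_cases hx : x ∈ V
  · have h := fun f : SuperFun p q V => coeff_apply f.1 I ⟨x, hx⟩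
    simp only [Pi.add_apply, h]
    change (monomial q).repr (f.1 _ + g.1 _) I = _
    simp
  · rw [Pi.add_apply, coeff_eq_zero fun h => absurd h hx, coeff_eq_zero fun h => absurd h hx,
      coeff_eq_zero fun h => absurd h hx, add_zero]

theorem coeff_smul (r : ℝ) (f : SuperFun p q V) (I : Finset (Fin q)) :
    coeff (r • f).1 I = r • coeff f.1 I := by
  ext x
  by_cases hx : x ∈ V
  · have h := fun f : SuperFun p q V => coeff_apply f.1 I ⟨x, hx⟩
    simp only [Pi.smul_apply, h]
    change (monomial q).repr (r • f.1 _) I = _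
    simp
  · rw [Pi.smul_apply, coeff_eq_zero fun h => absurd h hx, coeff_eq_zero fun h => absurd h hx,
      smul_zero]

theorem berezin_add (hf : VanishesOff f K) (hg : VanishesOff g K) (hK : IsCompact K)
    (hKV : K ⊆ V) : berezin (f + g) = berezin f + berezin g := by
  rw [berezin, coeff_add]
  exact integral_add (hf.integrable hK hKV _) (hg.integrable hK hKV _)

theorem berezin_smul (r : ℝ) (f : SuperFun p q V) : berezin (r • f) = r * berezin f := by
  rw [berezin, coeff_smul]
  exact integral_const_mul r _

/-- Along an even coordinate this is the vanishing of the integral of an ordinary partial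
derivative. Along an odd one the integrand itself is zero, since contraction never reaches the top
degree. -/
theorem berezin_d (hf : VanishesOff f K) (hK : IsCompact K) (hKV : K ⊆ V) (a : Idx p q) :
    berezin (d a f) = 0 := by
  rcases a with i | j
  · rw [← integral_fderiv_eq_zero volume (hf.contDiff hK hKV Finset.univ)
      (hf.hasCompactSupport hK Finset.univ) (Pi.single i 1)]
    refine integral_congr_ae (Filter.Eventually.of_forall fun x => ?_)
    by_cases hx : x ∈ V
    · exact (coeff_apply (dEven i f).1 Finset.univ ⟨x, hx⟩).trans (repr_dEven i f _ ⟨x, hx⟩)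
    · have h0 : coeff f.1 Finset.univ =ᶠ[nhds x] fun _ => 0 := by
        filter_upwards [hK.isClosed.isOpen_compl.mem_nhds fun h => hx (hKV h)] with y hy
        by_contra h
        exact hy (hf.support_coeff _ h)
      simp only
      rw [coeff_eq_zero fun h => absurd h hx, h0.fderiv_eq]
      simp
  · have : coeff (d (Sum.inr j) f).1 Finset.univ = 0 := by
      ext x
      by_cases hx : x ∈ V
      · exact (coeff_apply (dOdd j f).1 Finset.univ ⟨x, hx⟩).trans (Grassmann.top_contr j _)
      · exact coeff_eq_zero fun h => absurd h hx
    rw [berezin, this]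
    simp

/-- A superfunction which is orthogonal to all compactly supported superfunctions vanishes. -/
theorem eq_zero_of_berezin (h : ∀ (χ : (Fin p → ℝ) → ℝ) (hχ : ContDiff ℝ ∞ χ),
    HasCompactSupport χ → tsupport χ ⊆ V → ∀ I,
      berezin (f * (ofReal V χ hχ.contDiffOn * ⟨fun _ => monomial q I, IsSmooth.const _⟩)) = 0) :
    f = 0 := by
  refine Subtype.ext (funext fun x => Grassmann.eq_zero_of_top_mul fun I => ?_)
  let fI : SuperFun p q V := f * ⟨fun _ => monomial q I, IsSmooth.const _⟩
  change (monomial q).repr (fI.1 x) Finset.univ = 0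
  rw [← coeff_apply]
  have hloc : LocallyIntegrableOn (coeff fI.1 Finset.univ) V :=
    (fI.2 Finset.univ).continuousOn.locallyIntegrableOn V.isOpen.measurableSet
  -- The fundamental lemma of the calculus of variations, applied to the top coefficient of f θ^I.
  -- Continuity then upgrades almost everywhere to everywhere.
  have hae := V.isOpen.ae_eq_zero_of_integral_contDiff_smul_eq_zero (μ := volume) hloc
    (fun χ hχ hc hs => ?_)
  · have h2 : Set.EqOn (coeff fI.1 Finset.univ) 0 (V : Set (Fin p → ℝ)) := by
      refine Measure.eqOn_open_of_ae_eq (μ := volume) ?_ V.isOpen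
        (fI.2 Finset.univ).continuousOn continuousOn_const
      exact (ae_restrict_iff' V.isOpen.measurableSet).2 hae
    exact h2 x.2
  · rw [← h χ hχ hc hs I]
    refine integral_congr_ae (Filter.Eventually.of_forall fun y => ?_)
    by_cases hy : y ∈ V
    · simp only
      rw [coeff_apply _ _ ⟨y, hy⟩, coeff_apply _ _ ⟨y, hy⟩]
      change χ y • (monomial q).repr (f.1 ⟨y, hy⟩ * monomial q I) Finset.univ =
        (monomial q).repr (f.1 ⟨y, hy⟩ * (algebraMap ℝ (Grassmann q) (χ y) * monomial q I)) Finset.univ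
      rw [← Algebra.smul_def, mul_smul_comm, map_smul]
      rfl
    · simp only
      rw [coeff_eq_zero fun h => absurd h hy, coeff_eq_zero fun h => absurd h hy, smul_zero]

end SuperFun

end

section

/-! ### Parity on super ringed spaces -/

namespace SuperRingedSpace

variable {M : SuperRingedSpace.{u}} {U V W : Opens M.space}

/-- The `α`-fold iterate of the parity involution, as an algebra homomorphism. -/
def tw (M : SuperRingedSpace.{u}) (U : Opens M.space) (α : ZMod 2) : M.Fun U →ₐ[ℝ] M.Fun U :=
  if α = 0 then AlgHom.id ℝ _ else M.inv U

theorem tw_zero (f : M.Fun U) : M.tw U 0 f = f := rfl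

theorem tw_one (f : M.Fun U) : M.tw U 1 f = M.inv U f := by
  rw [tw, if_neg (by decide)]

theorem res_self (f : M.Fun U) : M.res le_rfl f = f := by
  simp [res]

theorem res_trans (h : V ≤ U) (h' : W ≤ V) (f : M.Fun U) :
    M.res h' (M.res h f) = M.res (h'.trans h) f := by
  simp only [SuperRingedSpace.res, ← AlgCat.comp_apply, ← M.sheaf.1.map_comp]
  rfl

theorem inv_res (h : V ≤ U) (f : M.Fun U) : M.inv V (M.res h f) = M.res h (M.inv U f) := by
  have := M.invol.naturality (homOfLE h).op
  exact (congrArg (fun t => t.hom f) this)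

namespace HasParity

variable {α β : ZMod 2} {f g : M.Fun U}

theorem eq (hf : M.HasParity α f) : M.inv U f = sgn α • f := hf

theorem tw (hf : M.HasParity α f) (β : ZMod 2) : M.tw U β f = sgn (β * α) • f := by
  rcases zmod2_cases β with rfl | rfl
  · rw [tw_zero, zero_mul, sgn_zero, one_smul]
  · rw [tw_one, hf.eq, one_mul]

theorem add (hf : M.HasParity α f) (hg : M.HasParity α g) : M.HasParity α (f + g) := by
  rw [HasParity, map_add, hf.eq, hg.eq, smul_add]

theorem smul (r : ℝ) (hf : M.HasParity α f) : M.HasParity α (r • f) := by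
  rw [HasParity, map_smul, hf.eq, smul_comm]

theorem sub (hf : M.HasParity α f) (hg : M.HasParity α g) : M.HasParity α (f - g) := by
  rw [HasParity, map_sub, hf.eq, hg.eq, smul_sub]

theorem sum {ι : Type*} {s : Finset ι} {f : ι → M.Fun U} (h : ∀ i ∈ s, M.HasParity α (f i)) :
    M.HasParity α (∑ i ∈ s, f i) := by
  rw [HasParity, map_sum, Finset.smul_sum]
  exact Finset.sum_congr rfl h

theorem mul (hf : M.HasParity α f) (hg : M.HasParity β g) : M.HasParity (α + β) (f * g) := by
  rw [HasParity, map_mul, hf.eq, hg.eq, smul_mul_smul_comm, sgn_add]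

theorem cast (hf : M.HasParity α f) (h : α = β) : M.HasParity β f := h ▸ hf

theorem res (hf : M.HasParity α f) (h : V ≤ U) : M.HasParity α (M.res h f) := by
  rw [HasParity, inv_res, hf.eq, map_smul]

theorem comm (hf : M.HasParity α f) (hg : M.HasParity β g) : f * g = sgn (α * β) • (g * f) := by
  rcases zmod2_cases α with rfl | rfl
  · rw [zero_mul, sgn_zero, one_smul]
    exact M.even_comm U f g (by have := hf.eq; rwa [sgn_zero, one_smul] at this)
  · rcases zmod2_cases β with rfl | rfl
    · rw [mul_zero, sgn_zero, one_smul]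
      exact (M.even_comm U g f (by have := hg.eq; rwa [sgn_zero, one_smul] at this)).symm
    · rw [mul_one, sgn_one, neg_smul, one_smul]
      refine M.odd_anticomm U f g ?_ ?_
      · have := hf.eq; rwa [sgn_one, neg_smul, one_smul] at this
      · have := hg.eq; rwa [sgn_one, neg_smul, one_smul] at this

/-- Even elements are central. -/
theorem commute (hf : M.HasParity 0 f) (g : M.Fun U) : f * g = g * f :=
  M.even_comm U f g (by have := hf.eq; rwa [sgn_zero, one_smul] at this)

theorem left_comm (hf : M.HasParity 0 f) (g k : M.Fun U) : f * (g * k) = g * (f * k) := by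
  rw [← mul_assoc, hf.commute, mul_assoc]

end HasParity

theorem hasParity_even (f : M.even U) : M.HasParity 0 (f : M.Fun U) := by
  rw [HasParity, sgn_zero, one_smul]; exact f.2

theorem mem_even {f : M.Fun U} (hf : M.HasParity 0 f) : f ∈ M.even U := by
  have := hf.eq; rwa [sgn_zero, one_smul] at this

theorem evenPart_coe {f : M.Fun U} (hf : M.HasParity 0 f) : (M.evenPart f : M.Fun U) = f := by
  have := hf.eq
  rw [sgn_zero, one_smul] at this
  change (1 / 2 : ℝ) • (f + M.inv U f) = f
  rw [this, ← two_smul ℝ f, smul_smul]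
  norm_num

theorem hasParity_evenPart (f : M.Fun U) : M.HasParity 0 ((1 / 2 : ℝ) • (f + M.inv U f)) := by
  rw [HasParity, sgn_zero, one_smul, map_smul, map_add, inv_inv, add_comm]

theorem hasParity_oddPart (f : M.Fun U) : M.HasParity 1 ((1 / 2 : ℝ) • (f - M.inv U f)) := by
  rw [HasParity, sgn_one, neg_smul, one_smul, map_smul, map_sub, inv_inv, ← smul_neg, neg_sub]

/-- To prove an additive statement it suffices to consider homogeneous elements. -/
theorem homogeneous_induction {P : M.Fun U → Prop} (f : M.Fun U)
    (hom : ∀ α (g : M.Fun U), M.HasParity α g → P g) (add : ∀ g k, P g → P k → P (g + k)) : P f := by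
  have h : f = (1 / 2 : ℝ) • (f + M.inv U f) + (1 / 2 : ℝ) • (f - M.inv U f) := by
    rw [← smul_add, add_add_sub_cancel, ← two_smul ℝ f, smul_smul]
    norm_num
  rw [h]
  exact add _ _ (hom 0 _ (hasParity_evenPart f)) (hom 1 _ (hasParity_oddPart f))

/-- An element which commutes with multiplication by the sign rule. -/
theorem mul_tw {α : ZMod 2} {f : M.Fun U} (hf : M.HasParity α f) (g : M.Fun U) :
    f * g = M.tw U α g * f := by
  induction g using homogeneous_induction with
  | hom β g hg => rw [hg.tw, hf.comm hg, smul_mul_assoc]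
  | add g k hg hk => rw [mul_add, hg, hk, map_add, add_mul]

theorem tw_tw (α β : ZMod 2) (f : M.Fun U) : M.tw U α (M.tw U β f) = M.tw U (α + β) f := by
  rcases zmod2_cases α with rfl | rfl <;> rcases zmod2_cases β with rfl | rfl
  · rfl
  · rfl
  · rfl
  · rw [tw_one, tw_one, inv_inv, show (1 + 1 : ZMod 2) = 0 by decide, tw_zero]

/-! ### Gluing -/

theorem ext_of_cover {ι : Type*} {U : Opens M.space} (V : ι → Opens M.space) (hV : ∀ i, V i ≤ U)
    (hcov : ∀ x ∈ U, ∃ i, x ∈ V i) {f g : M.Fun U} (h : ∀ i, M.res (hV i) f = M.res (hV i) g) :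
    f = g :=
  M.sheaf.eq_of_locally_eq' V U (fun i => homOfLE (hV i))
    (fun x hx => Opens.mem_iSup.2 (hcov x hx)) f g h

theorem exists_glue {ι : Type*} {U : Opens M.space} (V : ι → Opens M.space) (hV : ∀ i, V i ≤ U)
    (hcov : ∀ x ∈ U, ∃ i, x ∈ V i) (s : ∀ i, M.Fun (V i))
    (h : ∀ i j, M.res (inf_le_left : V i ⊓ V j ≤ V i) (s i) = M.res inf_le_right (s j)) :
    ∃ f : M.Fun U, ∀ i, M.res (hV i) f = s i :=
  (M.sheaf.existsUnique_gluing' V U (fun i => homOfLE (hV i))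
    (fun x hx => Opens.mem_iSup.2 (hcov x hx)) s h).exists

theorem ext_of_nhds {U : Opens M.space} {f g : M.Fun U}
    (h : ∀ x ∈ U, ∃ (V : Opens M.space) (hV : V ≤ U), x ∈ V ∧ M.res hV f = M.res hV g) : f = g := by
  choose V hV hx he using h
  exact ext_of_cover (fun x : U => V x.1 x.2) (fun x => hV x.1 x.2) (fun x hx' => ⟨⟨x, hx'⟩, hx x hx'⟩)
    fun x => he x.1 x.2

end SuperRingedSpace

/-! ### Differential calculus in a chart -/

namespace Chart

open SuperRingedSpace

variable {M : SuperRingedSpace.{u}} (c c' : Chart p q M) {W W' : Opens M.space}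
  (h : W ≤ c.dom) (h' : W ≤ c'.dom)

theorem equiv_d (a : Idx p q) (f : M.Fun W) :
    c.equiv W h (c.d h a f) = SuperFun.d a (c.equiv W h f) :=
  AlgEquiv.apply_symm_apply _ _

theorem equiv_coord (a : Idx p q) : c.equiv W h (c.coord h a) = SuperFun.coord a :=
  AlgEquiv.apply_symm_apply _ _

theorem equiv_invol (f : M.Fun W) :
    c.equiv W h (M.inv W f) = SuperFun.invol (c.equiv W h f) := c.equiv_inv W h f

theorem equiv_tw (α : ZMod 2) (f : M.Fun W) :
    c.equiv W h (M.tw W α f) = SuperFun.tw α (c.equiv W h f) := by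
  rcases zmod2_cases α with rfl | rfl
  · rfl
  · rw [tw_one, SuperFun.tw, if_neg (by decide)]
    exact c.equiv_inv W h f

/-- The partial derivative as a linear map. -/
def dL (a : Idx p q) : M.Fun W →ₗ[ℝ] M.Fun W where
  toFun := c.d h a
  map_add' f g := (c.equiv W h).injective <| by
    rw [equiv_d, map_add, SuperFun.d_add, map_add, equiv_d, equiv_d]
  map_smul' r f := (c.equiv W h).injective <| by
    rw [equiv_d, map_smul, SuperFun.d_smul, RingHom.id_apply, map_smul, equiv_d]

theorem dL_apply (a : Idx p q) (f : M.Fun W) : c.dL h a f = c.d h a f := rfl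

theorem d_add (a : Idx p q) (f g : M.Fun W) : c.d h a (f + g) = c.d h a f + c.d h a g :=
  map_add (c.dL h a) f g

theorem d_sub (a : Idx p q) (f g : M.Fun W) : c.d h a (f - g) = c.d h a f - c.d h a g :=
  map_sub (c.dL h a) f g

theorem d_smul (a : Idx p q) (r : ℝ) (f : M.Fun W) : c.d h a (r • f) = r • c.d h a f :=
  map_smul (c.dL h a) r f

theorem d_sum {ι : Type*} (a : Idx p q) (s : Finset ι) (f : ι → M.Fun W) :
    c.d h a (∑ i ∈ s, f i) = ∑ i ∈ s, c.d h a (f i) :=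
  map_sum (c.dL h a) f s

theorem d_zero (a : Idx p q) : c.d h a 0 = 0 := map_zero (c.dL h a)

theorem d_mul (a : Idx p q) (f g : M.Fun W) :
    c.d h a (f * g) = c.d h a f * g + M.tw W (par a) f * c.d h a g :=
  (c.equiv W h).injective <| by
    rw [equiv_d, map_mul, SuperFun.d_mul, map_add, map_mul, map_mul, equiv_d, equiv_d, equiv_tw]

theorem d_mul_of_hasParity {α : ZMod 2} (a : Idx p q) {f : M.Fun W} (hf : M.HasParity α f)
    (g : M.Fun W) :
    c.d h a (f * g) = c.d h a f * g + sgn (par a * α) • (f * c.d h a g) := by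
  rw [d_mul, hf.tw, smul_mul_assoc]

theorem d_one (a : Idx p q) : c.d h a 1 = 0 := by
  have := c.d_mul h a 1 1
  rw [map_one, one_mul, mul_one, one_mul] at this
  exact left_eq_add.1 this

theorem d_comm (a b : Idx p q) (f : M.Fun W) :
    c.d h a (c.d h b f) = sgn (par a * par b) • c.d h b (c.d h a f) :=
  (c.equiv W h).injective <| by
    rw [map_smul, equiv_d, equiv_d, equiv_d, equiv_d, SuperFun.d_comm]

theorem d_coord (a b : Idx p q) : c.d h a (c.coord h b) = if a = b then 1 else 0 :=
  (c.equiv W h).injective <| by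
    rw [equiv_d, equiv_coord, SuperFun.d_coord]
    split_ifs <;> simp

theorem d_res (hle : W' ≤ W) (a : Idx p q) (f : M.Fun W) :
    c.d (hle.trans h) a (M.res hle f) = M.res hle (c.d h a f) :=
  (c.equiv W' (hle.trans h)).injective <| by
    rw [equiv_d, c.equiv_res W W' h (hle.trans h) hle, c.equiv_res W W' h (hle.trans h) hle,
      SuperFun.d_res, equiv_d]

theorem coord_res (hle : W' ≤ W) (a : Idx p q) :
    M.res hle (c.coord h a) = c.coord (hle.trans h) a :=
  (c.equiv W' (hle.trans h)).injective <| by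
    rw [c.equiv_res W W' h (hle.trans h) hle, equiv_coord, equiv_coord]
    rcases a with i | j <;> rfl

theorem jac_res (hle : W' ≤ W) (a a' : Idx p q) :
    M.res hle (c.jac c' h h' a a') = c.jac c' (hle.trans h) (hle.trans h') a a' := by
  rw [jac, ← d_res, coord_res, jac]

theorem hasParity_coord (a : Idx p q) : M.HasParity (par a) (c.coord h a) :=
  (c.equiv W h).injective <| by
    rw [map_smul, equiv_invol, equiv_coord, SuperFun.invol_coord]

theorem hasParity_d {α : ZMod 2} (a : Idx p q) {f : M.Fun W} (hf : M.HasParity α f) :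
    M.HasParity (par a + α) (c.d h a f) := by
  have h1 : ∀ f, M.inv W (c.d h a f) = sgn (par a) • c.d h a (M.inv W f) := by
    intro f
    refine (c.equiv W h).injective ?_
    rw [map_smul, equiv_invol, equiv_d, equiv_d, equiv_invol, SuperFun.d_invol, smul_smul,
      sgn_mul_self, one_smul]
  rw [HasParity, h1, hf.eq, d_smul, smul_smul, sgn_add]

theorem hasParity_jac (a a' : Idx p q) : M.HasParity (par a + par a') (c.jac c' h h' a a') :=
  c.hasParity_d h a (c'.hasParity_coord h' a')

/-! ### Bodies -/

/-- The value of the body at a point, computed in a chart. -/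
def bodyHom (x : W) : M.Fun W →ₐ[ℝ] ℝ :=
  (SuperFun.bodyHom (⟨c.φ x, Set.mem_image_of_mem _ x.2⟩ : imageOpens c.φ W h)).comp
    (c.equiv W h).toAlgHom

theorem bodyHom_eq_coeff (x : W) (f : M.Fun W) :
    c.bodyHom h x f = coeff (c.equiv W h f).1 ∅ (c.φ x) :=
  SuperFun.bodyHom_eq_coeff (c.equiv W h f) ⟨c.φ x, Set.mem_image_of_mem _ x.2⟩

theorem bodyHom_inv (x : W) (f : M.Fun W) : c.bodyHom h x (M.inv W f) = c.bodyHom h x f := by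
  change SuperFun.bodyHom _ (c.equiv W h (M.inv W f)) = _
  rw [equiv_invol, SuperFun.bodyHom_invol]
  rfl

theorem bodyHom_odd (x : W) {f : M.Fun W} (hf : M.HasParity 1 f) : c.bodyHom h x f = 0 := by
  have := c.bodyHom_inv h x f
  rw [hf.eq, map_smul, sgn_one, smul_eq_mul] at this
  linarith

theorem bodyHom_evenPart (x : W) (f : M.Fun W) :
    c.bodyHom h x (M.evenPart f : M.Fun W) = c.bodyHom h x f := by
  change c.bodyHom h x ((1 / 2 : ℝ) • (f + M.inv W f)) = _
  rw [map_smul, map_add, bodyHom_inv, smul_eq_mul]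
  ring

theorem bodyHom_res (hle : W' ≤ W) (x : W') (f : M.Fun W) :
    c.bodyHom (hle.trans h) x (M.res hle f) = c.bodyHom h ⟨x, hle x.2⟩ f := by
  change SuperFun.bodyHom _ (c.equiv W' _ (M.res hle f)) = _
  rw [c.equiv_res W W' h (hle.trans h) hle]
  rfl

theorem forall_imageOpens {P : imageOpens c.φ W h → Prop} :
    (∀ y, P y) ↔ ∀ x : W, P ⟨c.φ x, Set.mem_image_of_mem _ x.2⟩ := by
  constructor
  · exact fun H x => H _
  · rintro H ⟨_, x, hx, rfl⟩
    exact H ⟨x, hx⟩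

theorem forall_body (f : M.Fun W) (P : ℝ → Prop) :
    (∀ y, P (SuperFun.body (c.equiv W h f) y)) ↔ ∀ x : W, P (c.bodyHom h x f) :=
  c.forall_imageOpens h

theorem isUnit_iff (f : M.Fun W) : IsUnit f ↔ ∀ x : W, c.bodyHom h x f ≠ 0 := by
  rw [← c.forall_body h f (· ≠ 0)]
  change _ ↔ ∀ y, SuperFun.bodyHom y (c.equiv W h f) ≠ 0
  rw [← SuperFun.isUnit_iff]
  exact (MulEquiv.isUnit_map (c.equiv W h)).symm

theorem continuousOn_bodyHom (f : M.Fun W) : Continuous fun x : W => c.bodyHom h x f := by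
  have h1 : ContinuousOn (coeff (c.equiv W h f).1 ∅) (imageOpens c.φ W h) :=
    ((c.equiv W h f).2 ∅).continuousOn
  have h2 : ContinuousOn c.φ W := c.φ.continuousOn.mono h
  have h3 := h1.comp h2 (fun x hx => Set.mem_image_of_mem _ hx)
  rw [continuousOn_iff_continuous_domRestrict] at h3
  exact h3.congr fun x => (c.bodyHom_eq_coeff h x f).symm

/-- The body does not depend on the chart. -/
theorem bodyHom_eq (x : W) (f : M.Fun W) : c.bodyHom h x f = c'.bodyHom h' x f := by
  by_contra hne
  set r := c.bodyHom h x f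
  -- On this open set f − r is invertible by the criterion in the second chart, while in the first
  -- chart its body vanishes at x. Invertibility does not refer to charts, so this is a
  -- contradiction.
  let W' : Opens M.space := ⟨(↑) '' {y : W | c'.bodyHom h' y f ≠ r},
    W.isOpen.isOpenMap_subtype_val _
      ((c'.continuousOn_bodyHom h' f).isOpen_preimage {r}ᶜ isOpen_compl_singleton)⟩
  have hW : W' ≤ W := by rintro _ ⟨y, -, rfl⟩; exact y.2
  have hx : (x : M.space) ∈ W' := ⟨x, Ne.symm hne, rfl⟩
  have hu : IsUnit (M.res hW (f - algebraMap ℝ _ r)) := by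
    rw [c'.isUnit_iff (hW.trans h')]
    rintro ⟨_, y, hy, rfl⟩
    rw [c'.bodyHom_res h' hW, map_sub, AlgHom.commutes]
    exact sub_ne_zero.2 hy
  rw [c.isUnit_iff (hW.trans h)] at hu
  refine hu ⟨x, hx⟩ ?_
  rw [bodyHom_res, map_sub, AlgHom.commutes]
  exact sub_self _

end Chart

end

/-! ### Hadamard's lemma and the chain rule between charts -/

section

namespace SuperFun

variable {V V' : Opens (Fin p → ℝ)}

/-- Constant superfunctions. -/
def constHom (V : Opens (Fin p → ℝ)) : Grassmann q →ₐ[ℝ] SuperFun p q V where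
  toFun a := ⟨fun _ => a, IsSmooth.const a⟩
  map_one' := rfl
  map_mul' _ _ := rfl
  map_zero' := rfl
  map_add' _ _ := rfl
  commutes' _ := rfl

/-- Hadamard's lemma for superfunctions. -/
theorem exists_hadamard (F : SuperFun p q V) (y : V) :
    ∃ G : Fin p → SuperFun p q ⊤, ∀ᶠ x in nhds (y : Fin p → ℝ), ∀ hx : x ∈ V,
      F.1 ⟨x, hx⟩ = F.1 y + ∑ i, (x i - y.1 i) • (G i).1 ⟨x, trivial⟩ := by
  choose h hs he using fun I => exists_eq_add_sum_mul V.isOpen (F.2 I) y.2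
  refine ⟨fun i => ⟨fun x => ∑ I, h I i x • monomial q I, IsSmooth.of_repr (fun I => h I i)
    (fun I => (hs I i).contDiffOn) fun I x => by simp [Finsupp.single_apply]⟩, ?_⟩
  filter_upwards [Filter.eventually_all.2 he] with x hx hxV
  refine (monomial q).ext_elem fun I => ?_
  have := hx I
  rw [coeff_apply F.1 I ⟨x, hxV⟩, coeff_apply F.1 I y] at this
  simp [this, Finsupp.single_apply]

end SuperFun

namespace Chart

open SuperRingedSpace

variable {M : SuperRingedSpace.{u}} (c c' : Chart p q M) {W W' : Opens M.space}
  (h : W ≤ c.dom) (h' : W ≤ c'.dom)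

/-- Superfunctions with constant coefficients in a chart. -/
def constHom : Grassmann q →ₐ[ℝ] M.Fun W :=
  (c.equiv W h).symm.toAlgHom.comp (SuperFun.constHom _)

theorem equiv_constHom (a : Grassmann q) :
    c.equiv W h (c.constHom h a) = SuperFun.constHom _ a :=
  AlgEquiv.apply_symm_apply _ _

theorem constHom_θ (j : Fin q) : c.constHom h (Grassmann.θ j) = c.coord h (Sum.inr j) :=
  (c.equiv W h).injective <| by rw [equiv_constHom, equiv_coord]; rfl

/-- The value of a superfunction at a point, in the Grassmann algebra of a chart. -/
def eval (x : W) : M.Fun W →ₐ[ℝ] Grassmann q :=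
  ((Pi.evalAlgHom ℝ (fun _ => Grassmann q)
    (⟨c.φ x, Set.mem_image_of_mem _ x.2⟩ : imageOpens c.φ W h)).comp
      (SuperFun p q _).val).comp (c.equiv W h).toAlgHom

theorem eval_res (hle : W' ≤ W) (x : W') (f : M.Fun W) :
    c.eval (hle.trans h) x (M.res hle f) = c.eval h ⟨x, hle x.2⟩ f := by
  change (c.equiv W' _ (M.res hle f)).1 _ = _
  rw [c.equiv_res W W' h (hle.trans h) hle]
  rfl

theorem eval_coord_inl (x : W) (i : Fin p) :
    c.eval h x (c.coord h (Sum.inl i)) = algebraMap ℝ _ (c.φ x i) := by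
  change (c.equiv W h _).1 _ = _
  rw [equiv_coord]
  rfl

theorem ext_eval {f g : M.Fun W} (H : ∀ x, c.eval h x f = c.eval h x g) : f = g := by
  refine (c.equiv W h).injective (Subtype.ext (funext ?_))
  rw [c.forall_imageOpens h (P := fun y => (c.equiv W h f).1 y = (c.equiv W h g).1 y)]
  exact H

/-- Only the even coordinates are expanded. The leading term is a whole Grassmann element, that is,
a polynomial in the odd coordinates with constant coefficients. -/
theorem exists_hadamard (f : M.Fun W) (y : W) :
    ∃ (W' : Opens M.space) (hle : W' ≤ W) (_ : (y : M.space) ∈ W') (g : Fin p → M.Fun W'),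
      M.res hle f = c.constHom (hle.trans h) (c.eval h y f) +
        ∑ i, (c.coord (hle.trans h) (Sum.inl i) - algebraMap ℝ _ (c.φ y i)) * g i := by
  obtain ⟨G, hG⟩ := SuperFun.exists_hadamard (c.equiv W h f)
    ⟨c.φ y, Set.mem_image_of_mem _ y.2⟩
  obtain ⟨N, hN, hNo, hyN⟩ := eventually_nhds_iff.1 hG
  let W' : Opens M.space := ⟨W ∩ (c.φ.source ∩ c.φ ⁻¹' N),
    W.isOpen.inter (c.φ.isOpen_inter_preimage hNo)⟩
  have hle : W' ≤ W := fun x hx => hx.1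
  refine ⟨W', hle, ⟨y.2, h y.2, hyN⟩,
    fun i => (c.equiv W' (hle.trans h)).symm (SuperFun.res le_top (G i)), ?_⟩
  refine c.ext_eval (hle.trans h) fun x => ?_
  rw [eval_res, map_add, map_sum]
  have h1 : c.eval (hle.trans h) x (c.constHom (hle.trans h) (c.eval h y f)) = c.eval h y f := by
    change (c.equiv W' _ (c.constHom _ _)).1 _ = _
    rw [equiv_constHom]; rfl
  have h2 : ∀ i, c.eval (hle.trans h) x
      ((c.equiv W' (hle.trans h)).symm (SuperFun.res le_top (G i))) =
      (G i).1 ⟨c.φ x, trivial⟩ := by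
    intro i
    change (c.equiv W' _ ((c.equiv W' _).symm _)).1 _ = _
    rw [AlgEquiv.apply_symm_apply]; rfl
  rw [h1]
  refine (hN (c.φ x) x.2.2.2 (Set.mem_image_of_mem _ (hle x.2))).trans ?_
  refine congrArg₂ _ rfl (Finset.sum_congr rfl fun i _ => ?_)
  rw [map_mul, map_sub, h2, eval_coord_inl, AlgHom.commutes, ← map_sub, ← Algebra.smul_def]

/-- The defect in the chain rule. -/
def chainDefect (a : Idx p q) : M.Fun W →ₗ[ℝ] M.Fun W :=
  c.dL h a - ∑ a', LinearMap.mulLeft ℝ (c.jac c' h h' a a') ∘ₗ c'.dL h' a'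

theorem chainDefect_apply (a : Idx p q) (f : M.Fun W) :
    chainDefect c c' h h' a f = c.d h a f - ∑ a', c.jac c' h h' a a' * c'.d h' a' f := by
  simp [chainDefect, dL_apply]

/-- The defect is a derivation of the parity of ∂_a. The Jacobi entry has parity a + a', so moving
it past the a'-twisted f leaves exactly the a-twist. -/
theorem chainDefect_mul (a : Idx p q) (f g : M.Fun W) :
    chainDefect c c' h h' a (f * g) =
      chainDefect c c' h h' a f * g + M.tw W (par a) f * chainDefect c c' h h' a g := by
  have key : ∀ a', c.jac c' h h' a a' * (M.tw W (par a') f * c'.d h' a' g) =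
      M.tw W (par a) f * (c.jac c' h h' a a' * c'.d h' a' g) := by
    intro a'
    rw [← mul_assoc, mul_tw (c.hasParity_jac c' h h' a a'), tw_tw, add_assoc,
      CharTwo.add_self_eq_zero, add_zero, mul_assoc]
  simp only [chainDefect_apply, d_mul, mul_add, Finset.sum_add_distrib, key, sub_mul, mul_sub,
    Finset.sum_mul, Finset.mul_sum, mul_assoc]
  abel

theorem chainDefect_coord (a b : Idx p q) :
    chainDefect c c' h h' a (c'.coord h' b) = 0 := by
  simp [chainDefect_apply, d_coord, jac]

theorem chainDefect_res (hle : W' ≤ W) (a : Idx p q) (f : M.Fun W) :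
    chainDefect c c' (hle.trans h) (hle.trans h') a (M.res hle f) =
      M.res hle (chainDefect c c' h h' a f) := by
  simp only [chainDefect_apply, map_sub, map_sum, map_mul, ← d_res, jac_res]

theorem chainDefect_algebraMap (a : Idx p q) (r : ℝ) :
    chainDefect c c' h h' a (algebraMap ℝ _ r) = 0 := by
  rw [Algebra.algebraMap_eq_smul_one, map_smul, chainDefect_apply]
  simp [d_one]

theorem chainDefect_constHom (a : Idx p q) (x : Grassmann q) :
    chainDefect c c' h h' a (c'.constHom h' x) = 0 := by
  induction x using ExteriorAlgebra.induction with
  | algebraMap r => rw [AlgHom.commutes, chainDefect_algebraMap]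
  | ι v =>
    rw [pi_eq_sum_univ' v]
    simp only [map_sum, map_smul, constHom_θ, chainDefect_coord, smul_zero,
      Finset.sum_const_zero]
  | mul x y hx hy => rw [map_mul, chainDefect_mul, hx, hy, zero_mul, mul_zero, add_zero]
  | add x y hx hy => rw [map_add, map_add, hx, hy, add_zero]

/-- The chain rule `∂_a = (∂_a x^{a'}) ∂_{a'}`. -/
theorem chain_rule (a : Idx p q) (f : M.Fun W) :
    c.d h a f = ∑ a', c.jac c' h h' a a' * c'.d h' a' f := by
  rw [← sub_eq_zero, ← chainDefect_apply]
  refine c'.ext_eval h' fun y => ?_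
  -- The defect kills Grassmann constants and coordinates, so of the Hadamard expansion only the
  -- terms (x'^i − y^i) · defect(g_i) remain, and these vanish at y.
  obtain ⟨W', hle, hy, g, hg⟩ := c'.exists_hadamard h' f y
  have := c'.eval_res h' hle ⟨y, hy⟩ (chainDefect c c' h h' a f)
  rw [map_zero, ← this, ← chainDefect_res, hg, map_add, chainDefect_constHom, zero_add, map_sum,
    map_sum]
  refine Finset.sum_eq_zero fun i _ => ?_
  have h0 : M.tw W' (par a) (c'.coord (hle.trans h') (Sum.inl i) - algebraMap ℝ _ (c'.φ y i)) =
      c'.coord (hle.trans h') (Sum.inl i) - algebraMap ℝ _ (c'.φ y i) := by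
    rw [map_sub, AlgHom.commutes, (c'.hasParity_coord (hle.trans h') (Sum.inl i)).tw]
    change sgn (par a * 0) • _ - _ = _
    rw [mul_zero, sgn_zero, one_smul]
  rw [chainDefect_mul, map_sub, chainDefect_coord, chainDefect_algebraMap, sub_zero, zero_mul,
    zero_add, h0, map_mul, map_sub, eval_coord_inl, AlgHom.commutes, sub_self, zero_mul]

theorem jac_mul_jac (c'' : Chart p q M) (h'' : W ≤ c''.dom) (a b : Idx p q) :
    ∑ a', c.jac c' h h' a a' * c'.jac c'' h' h'' a' b = c.jac c'' h h'' a b :=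
  (c.chain_rule c' h h' a _).symm

theorem jac_self (a b : Idx p q) : c.jac c h h a b = if a = b then 1 else 0 :=
  c.d_coord h a b

theorem jac_mul_jac_inv (a b : Idx p q) :
    ∑ a', c.jac c' h h' a a' * c'.jac c h' h a' b = if a = b then 1 else 0 := by
  rw [jac_mul_jac, jac_self]

end Chart

end

section

/-! ### Derivations and determinants -/

section Det

variable {R A : Type*} [CommRing R] [Ring A] (v : R →+* A) (δ : R →+ A)

/-- Determinants live in the commutative ring R of even functions, but an odd derivative leads out
of it into the noncommutative algebra A. Hence Jacobi's formula is developed for an additive map R →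
A with coefficients written on the left. -/
theorem map_prod_of_leibniz (hδ : ∀ f g, δ (f * g) = v f * δ g + v g * δ f) {ι : Type*}
    [DecidableEq ι] (s : Finset ι) (f : ι → R) :
    δ (∏ i ∈ s, f i) = ∑ i ∈ s, v (∏ j ∈ s.erase i, f j) * δ (f i) := by
  have h1 : δ 1 = 0 := by
    have := hδ 1 1
    simp only [mul_one, map_one v, one_mul] at this
    exact left_eq_add.1 this
  induction s using Finset.induction_on with
  | empty => simp [h1]
  | insert a s ha ih =>
    rw [Finset.prod_insert ha, hδ, ih, Finset.sum_insert ha, Finset.erase_insert ha, Finset.mul_sum,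
      add_comm]
    refine congrArg₂ _ rfl (Finset.sum_congr rfl fun i hi => ?_)
    have hia : a ≠ i := fun h => ha (h ▸ hi)
    rw [Finset.erase_insert_of_ne hia, Finset.prod_insert (fun h => ha (Finset.mem_of_mem_erase h)),
      map_mul, mul_assoc]

theorem map_det_of_leibniz (hδ : ∀ f g, δ (f * g) = v f * δ g + v g * δ f) {n : Type*}
    [DecidableEq n] [Fintype n] (X : Matrix n n R) :
    δ X.det = ∑ i, ∑ j, v (X.adjugate j i) * δ (X i j) := by
  -- The cofactor is the Leibniz expansion restricted to permutations sending j to i, with that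
  -- factor removed. These are the terms produced by differentiating the entry X i j.
  have hadj : ∀ i j, X.adjugate j i = ∑ σ : Equiv.Perm n,
      if σ j = i then σ.sign • ∏ k ∈ Finset.univ.erase j, X (σ k) k else 0 := by
    intro i j
    rw [Matrix.adjugate_apply, Matrix.det_apply]
    refine Finset.sum_congr rfl fun σ _ => ?_
    split_ifs with h
    · rw [← Finset.mul_prod_erase _ _ (Finset.mem_univ j), h, Matrix.updateRow_self,
        Pi.single_eq_same, one_mul]
      refine congrArg _ (Finset.prod_congr rfl fun k hk => ?_)
      rw [Matrix.updateRow_ne]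
      intro hki
      exact (Finset.ne_of_mem_erase hk) (σ.injective (hki.trans h.symm))
    · rw [Finset.prod_eq_zero (Finset.mem_univ (σ.symm i)), smul_zero]
      rw [Equiv.apply_symm_apply, Matrix.updateRow_self, Pi.single_eq_of_ne]
      intro hj
      exact h (by rw [← hj, Equiv.apply_symm_apply])
  rw [Finset.sum_comm, Matrix.det_apply, map_sum]
  have h1 : ∀ σ : Equiv.Perm n, δ (σ.sign • ∏ i, X (σ i) i) = ∑ j, ∑ i,
      v (if σ j = i then σ.sign • ∏ k ∈ Finset.univ.erase j, X (σ k) k else 0) * δ (X i j) := by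
    intro σ
    rw [Units.smul_def, map_zsmul, map_prod_of_leibniz v δ hδ, Finset.smul_sum]
    refine Finset.sum_congr rfl fun j _ => ?_
    rw [Finset.sum_eq_single (σ j) (fun i _ hi => by rw [if_neg hi.symm, map_zero, zero_mul])
      (by simp), if_pos rfl, Units.smul_def, map_zsmul, smul_mul_assoc]
  rw [Finset.sum_congr rfl fun σ _ => h1 σ, Finset.sum_comm]
  refine Finset.sum_congr rfl fun j _ => ?_
  rw [Finset.sum_comm]
  refine Finset.sum_congr rfl fun i _ => ?_
  rw [hadj, map_sum, Finset.sum_mul]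

theorem map_det_of_leibniz_of_mul_eq_one (hδ : ∀ f g, δ (f * g) = v f * δ g + v g * δ f)
    {n : Type*} [DecidableEq n] [Fintype n] {X Y : Matrix n n R} (h : X * Y = 1) :
    δ X.det = v X.det * ∑ i, ∑ j, v (Y j i) * δ (X i j) := by
  have hY : X.adjugate = X.det • Y := by
    calc X.adjugate = X.adjugate * (X * Y) := by rw [h, mul_one]
      _ = X.det • Y := by rw [← mul_assoc, Matrix.adjugate_mul, smul_mul_assoc, one_mul]
  rw [map_det_of_leibniz v δ hδ, hY, Finset.mul_sum]
  refine Finset.sum_congr rfl fun i _ => ?_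
  rw [Finset.mul_sum]
  refine Finset.sum_congr rfl fun j _ => ?_
  rw [Matrix.smul_apply, smul_eq_mul, map_mul, mul_assoc]

end Det

/-! ### Matrices of superfunctions -/

namespace SuperRingedSpace

variable {M : SuperRingedSpace.{u}} {W : Opens M.space}

/-- All entries of the matrix have parity `α`. -/
def MatParity {m n : Type*} (α : ZMod 2) (P : Matrix m n (M.Fun W)) : Prop :=
  ∀ i j, M.HasParity α (P i j)

section

variable {m n k : Type*} {α β : ZMod 2}

theorem MatParity.mul [Fintype n] {P : Matrix m n (M.Fun W)} {Q : Matrix n k (M.Fun W)} (hP : MatParity α P)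
    (hQ : MatParity β Q) : MatParity (α + β) (P * Q) := fun i j => by
  rw [Matrix.mul_apply]
  exact HasParity.sum fun l _ => (hP i l).mul (hQ l j)

/-- Cyclicity of the ordinary trace survives for homogeneous entries up to one global sign. This
sign is what later turns the traces into a supertrace. -/
theorem MatParity.trace_mul_comm [Fintype m] [Fintype n] {P : Matrix m n (M.Fun W)} {Q : Matrix n m (M.Fun W)}
    (hP : MatParity α P) (hQ : MatParity β Q) :
    (P * Q).trace = sgn (α * β) • (Q * P).trace := by
  simp only [Matrix.trace, Matrix.diag, Matrix.mul_apply, Finset.smul_sum]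
  rw [Finset.sum_comm]
  exact Finset.sum_congr rfl fun i _ => Finset.sum_congr rfl fun j _ => (hP j i).comm (hQ i j)

variable (δ : M.Fun W →ₗ[ℝ] M.Fun W) (d : ZMod 2)

theorem map_mul_matrix [Fintype n] (hδ : ∀ f g, δ (f * g) = δ f * g + M.tw W d f * δ g)
    {P : Matrix m n (M.Fun W)} (hP : MatParity α P) (Q : Matrix n k (M.Fun W)) :
    (P * Q).map δ = P.map δ * Q + sgn (d * α) • (P * Q.map δ) := by
  ext i j
  simp only [Matrix.map_apply, Matrix.mul_apply, map_sum, hδ, Finset.sum_add_distrib,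
    Matrix.add_apply, Matrix.smul_apply, Finset.smul_sum]
  refine congrArg₂ _ rfl (Finset.sum_congr rfl fun l _ => ?_)
  rw [(hP i l).tw, smul_mul_assoc]

/-- The logarithmic derivative of the Berezinian of a block matrix, before passing to
determinants. -/
theorem trace_log_derivative [Fintype m] [Fintype n] [DecidableEq m] [DecidableEq n]
    (hδ : ∀ f g, δ (f * g) = δ f * g + M.tw W d f * δ g)
    (hp : ∀ α f, M.HasParity α f → M.HasParity (d + α) (δ f))
    {A A' : Matrix m m (M.Fun W)} {B B' : Matrix m n (M.Fun W)} {C C' : Matrix n m (M.Fun W)}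
    {D D' Di : Matrix n n (M.Fun W)}
    (hA' : MatParity 0 A') (hB : MatParity 1 B) (hC : MatParity 1 C)
    (hD : MatParity 0 D) (hDi : MatParity 0 Di)
    (hDDi : D * Di = 1) (hDiD : Di * D = 1)
    (h21 : C * A' + D * C' = 0) (h12 : A' * B + B' * D = 0) (h22 : C' * B + D' * D = 1) :
    ((A - B * Di * C).map δ * A').trace - (D.map δ * Di).trace =
      (A.map δ * A').trace + (B.map δ * C').trace - (C.map δ * B').trace
        - (D.map δ * D').trace := by
  have hone : (1 : Matrix n n (M.Fun W)).map δ = 0 := by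
    have h1 : δ 1 = 0 := by
      have := hδ 1 1
      simp only [map_one (M.tw W d), one_mul, mul_one] at this
      exact left_eq_add.1 this
    ext i j
    by_cases hij : i = j
    · subst hij; simp [h1]
    · simp [hij]
  -- The primed blocks form the inverse matrix. Its block relations eliminate D⁻¹: D⁻¹CA' = −C',
  -- A'BD⁻¹ = −B', C'BD⁻¹ = D⁻¹ − D'.
  have e1 : Di * C * A' = -C' := by
    have : C * A' = -(D * C') := eq_neg_of_add_eq_zero_left h21
    rw [Matrix.mul_assoc, this, Matrix.mul_neg, ← Matrix.mul_assoc, hDiD, Matrix.one_mul]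
  have e2 : A' * B * Di = -B' := by
    rw [eq_neg_of_add_eq_zero_left h12, Matrix.neg_mul, Matrix.mul_assoc, hDDi, Matrix.mul_one]
  have e3 : C' * B * Di = Di - D' := by
    rw [eq_sub_of_add_eq h22, Matrix.sub_mul, Matrix.one_mul, Matrix.mul_assoc, hDDi, mul_one]
  have hdD : MatParity d (D.map δ) := fun i j => (hp 0 _ (hD i j)).cast (add_zero d)
  have hdC : MatParity (d + 1) (C.map δ) := fun i j => hp 1 _ (hC i j)
  have hdDi : Di.map δ = -(Di * D.map δ * Di) := by
    have h1 := map_mul_matrix δ d hδ hD Di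
    rw [hDDi, hone, mul_zero, sgn_zero, one_smul] at h1
    have h2 : Di * (D.map δ * Di + D * Di.map δ) = 0 := by rw [← h1, mul_zero]
    rw [mul_add, ← Matrix.mul_assoc, ← Matrix.mul_assoc, hDiD, Matrix.one_mul] at h2
    exact eq_neg_of_add_eq_zero_right h2
  have hBDi : MatParity 1 (B * Di) := fun i j => ((hB.mul hDi) i j).cast (add_zero 1)
  -- The sign for moving the odd matrix BD⁻¹ cyclically past a matrix of parity d + 1 under the
  -- trace.
  have hs : sgn (1 * (d + 1)) = - sgn d := by
    rw [one_mul, sgn_add, sgn_one, mul_neg_one]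
  have hmap : (A - B * Di * C).map δ = A.map δ - (B.map δ * Di * C +
      sgn d • (B * Di.map δ * C) + sgn d • (B * Di * C.map δ)) := by
    have h0 : (A - B * Di * C).map δ = A.map δ - (B * Di * C).map δ := by
      ext i j; simp
    rw [h0, map_mul_matrix δ d hδ hBDi, map_mul_matrix δ d hδ hB, mul_one, Matrix.add_mul, Matrix.smul_mul]
  have t1 : (B.map δ * Di * C * A').trace = -(B.map δ * C').trace := by
    rw [Matrix.mul_assoc (B.map δ), Matrix.mul_assoc, e1, Matrix.mul_neg, Matrix.trace_neg]
  have t2 : (B * Di * C.map δ * A').trace = sgn d • (C.map δ * B').trace := by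
    have h1 : MatParity (d + 1) (C.map δ * A') := fun i j =>
      ((hdC.mul hA') i j).cast (add_zero _)
    rw [Matrix.mul_assoc, hBDi.trace_mul_comm h1, hs, Matrix.mul_assoc, ← Matrix.mul_assoc A', e2, Matrix.mul_neg,
      Matrix.trace_neg, smul_neg, neg_smul, neg_neg]
  have t3 : (B * Di.map δ * C * A').trace =
      sgn d • ((D.map δ * D').trace - (D.map δ * Di).trace) := by
    have h1 : MatParity (d + 1) (D.map δ * (Di * C * A')) := fun i j =>
      ((hdD.mul ((hDi.mul hC).mul hA')) i j).cast (by ring)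
    have h2 : B * Di.map δ * C * A' = -((B * Di) * (D.map δ * (Di * C * A'))) := by
      rw [hdDi]; simp only [Matrix.mul_neg, Matrix.neg_mul, Matrix.mul_assoc]
    have h3 : D.map δ * (Di * C * A') * (B * Di) = D.map δ * D' - D.map δ * Di := by
      rw [e1, Matrix.mul_assoc, ← Matrix.mul_assoc (-C'), Matrix.neg_mul, Matrix.neg_mul, e3,
        neg_sub, Matrix.mul_sub]
    rw [h2, Matrix.trace_neg, hBDi.trace_mul_comm h1, hs, neg_smul, neg_neg, h3, Matrix.trace_sub]
  rw [hmap]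
  simp only [Matrix.sub_mul, Matrix.add_mul, Matrix.smul_mul, Matrix.trace_sub, Matrix.trace_add,
    Matrix.trace_smul, t1, t2, t3, smul_smul, sgn_mul_self, one_smul]
  abel

end

end SuperRingedSpace

end

section

/-! ### The Berezinian -/

namespace SuperRingedSpace

variable {M : SuperRingedSpace.{u}} {U W : Opens M.space}

theorem isUnit_even {f : M.even W} (hf : IsUnit (f : M.Fun W)) : IsUnit f := by
  obtain ⟨g, hfg, hgf⟩ := isUnit_iff_exists.1 hf
  have hg : M.inv W g = g := by
    have h1 : (f : M.Fun W) * M.inv W g = 1 := by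
      rw [← map_one (M.inv W), ← hfg, map_mul, f.2]; rfl
    calc M.inv W g = g * f * M.inv W g := by rw [hgf, one_mul]
      _ = g := by rw [mul_assoc, h1, mul_one]
  exact isUnit_iff_exists.2 ⟨⟨g, hg⟩, Subtype.ext hfg, Subtype.ext hgf⟩

theorem coe_mul (f g : M.even W) : ((f * g : M.even W) : M.Fun W) = f * g := rfl

theorem coe_one : ((1 : M.even W) : M.Fun W) = 1 := rfl

theorem coe_pow (f : M.even W) (n : ℕ) : ((f ^ n : M.even W) : M.Fun W) = (f : M.Fun W) ^ n := by
  induction n with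
  | zero => rw [pow_zero, pow_zero]; rfl
  | succ n ih => rw [pow_succ, pow_succ, coe_mul, ih]

/-- The inclusion of the even superfunctions. -/
def evenVal (M : SuperRingedSpace.{u}) (W : Opens M.space) : M.even W →+* M.Fun W where
  toFun f := f
  map_one' := rfl
  map_mul' _ _ := rfl
  map_zero' := rfl
  map_add' _ _ := rfl

theorem evenVal_apply (f : M.even W) : M.evenVal W f = f := rfl

/-- Restriction of even superfunctions. -/
def resEven (h : W ≤ U) : M.even U →+* M.even W where
  toFun f := ⟨M.res h f, M.mem_even ((hasParity_even f).res h)⟩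
  map_one' := Subtype.ext (map_one (M.res h))
  map_mul' f g := Subtype.ext (map_mul (M.res h) (f : M.Fun U) g)
  map_zero' := Subtype.ext (map_zero (M.res h))
  map_add' f g := Subtype.ext (map_add (M.res h) (f : M.Fun U) g)

theorem resEven_evenPart (h : W ≤ U) (f : M.Fun U) :
    resEven h (M.evenPart f) = M.evenPart (M.res h f) := by
  refine Subtype.ext ?_
  change M.res h ((1 / 2 : ℝ) • (f + M.inv U f)) = (1 / 2 : ℝ) • (M.res h f + M.inv W (M.res h f))
  rw [map_smul, map_add, inv_res]

end SuperRingedSpace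

namespace Chart

open SuperRingedSpace

variable {M : SuperRingedSpace.{u}} (c c' : Chart p q M) {W W' : Opens M.space}
  (h : W ≤ c.dom) (h' : W ≤ c'.dom)

/-- The body of an even superfunction at a point. -/
def evenBody (x : W) : M.even W →+* ℝ := (c.bodyHom h x).toRingHom.comp (M.evenVal W)

theorem evenBody_apply (x : W) (f : M.even W) : c.evenBody h x f = c.bodyHom h x (f : M.Fun W) :=
  rfl

theorem isUnit_even_iff (f : M.even W) : IsUnit f ↔ ∀ x : W, c.evenBody h x f ≠ 0 := by
  simp only [evenBody_apply]
  rw [← c.isUnit_iff h]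
  exact ⟨fun hf => hf.map (M.evenVal W), isUnit_even⟩

theorem jac_block_mul (a b : Idx p q) :
    (∑ k, c.jac c' h h' a (Sum.inl k) * c'.jac c h' h (Sum.inl k) b) +
      ∑ k, c.jac c' h h' a (Sum.inr k) * c'.jac c h' h (Sum.inr k) b = if a = b then 1 else 0 := by
  rw [← c.jac_mul_jac_inv c' h h' a b, Fintype.sum_sum_type]

/-- The off-diagonal blocks are odd and have zero body, so on bodies the Jacobi matrix is block
diagonal and its diagonal blocks are invertible separately. -/
theorem evenBody_jacOO_mul (x : W) :
    (c.jacOO c' h h').map (c.evenBody h x) * (c'.jacOO c h' h).map (c.evenBody h x) = 1 := by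
  ext i j
  have := congrArg (c.bodyHom h x) (c.jac_block_mul c' h h' (Sum.inr i) (Sum.inr j))
  simp only [map_add, map_sum, map_mul] at this
  rw [Finset.sum_eq_zero (s := Finset.univ) (f := fun k => _ * c.bodyHom h x
    (c'.jac c h' h (Sum.inl k) (Sum.inr j))) (fun k _ => by
    rw [c.bodyHom_odd h x (c'.hasParity_jac c h' h (Sum.inl k) (Sum.inr j)), mul_zero]),
    zero_add] at this
  simp only [Matrix.mul_apply, Matrix.map_apply, jacOO, Matrix.of_apply, evenBody_apply,
    bodyHom_evenPart, this, Matrix.one_apply, Sum.inr.injEq]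
  split_ifs <;> simp

theorem evenBody_det {n : Type*} [Fintype n] [DecidableEq n] (x : W)
    (X : Matrix n n (M.even W)) :
    c.evenBody h x X.det = (X.map (c.evenBody h x)).det :=
  RingHom.map_det _ _

theorem isUnit_det_jacOO : IsUnit (c.jacOO c' h h').det := by
  rw [c.isUnit_even_iff h]
  intro x hx
  have := congrArg Matrix.det (c.evenBody_jacOO_mul c' h h' x)
  rw [Matrix.det_mul, ← evenBody_det, hx, zero_mul, Matrix.det_one] at this
  exact zero_ne_one this

/-- The blocks of the Jacobi matrix as matrices of superfunctions. -/
def jacBlock {m n : Type*} (f : m → Idx p q) (g : n → Idx p q) : Matrix m n (M.Fun W) :=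
  Matrix.of fun i j => c.jac c' h h' (f i) (g j)

theorem jacEE_map : (c.jacEE c' h h').map (M.evenVal W) = c.jacBlock c' h h' Sum.inl Sum.inl := by
  ext i j
  exact evenPart_coe (c.hasParity_jac c' h h' (Sum.inl i) (Sum.inl j))

theorem jacOO_map : (c.jacOO c' h h').map (M.evenVal W) = c.jacBlock c' h h' Sum.inr Sum.inr := by
  ext i j
  exact evenPart_coe (c.hasParity_jac c' h h' (Sum.inr i) (Sum.inr j))

/-- The inverse of the odd-odd block of the Jacobi matrix. -/
def jacOOInv : Matrix (Fin q) (Fin q) (M.Fun W) := (c.jacOO c' h h')⁻¹.map (M.evenVal W)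

theorem matParity_jacOOInv : MatParity 0 (c.jacOOInv c' h h') := fun i j =>
  hasParity_even ((c.jacOO c' h h')⁻¹ i j)

theorem jacOO_mul_inv : c.jacBlock c' h h' Sum.inr Sum.inr * c.jacOOInv c' h h' = 1 := by
  rw [← jacOO_map, jacOOInv, ← Matrix.map_mul, Matrix.mul_nonsing_inv _ (c.isUnit_det_jacOO c' h h')]
  exact Matrix.map_one _ (map_zero _) (map_one _)

theorem inv_mul_jacOO : c.jacOOInv c' h h' * c.jacBlock c' h h' Sum.inr Sum.inr = 1 := by
  rw [← jacOO_map, jacOOInv, ← Matrix.map_mul, Matrix.nonsing_inv_mul _ (c.isUnit_det_jacOO c' h h')]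
  exact Matrix.map_one _ (map_zero _) (map_one _)

theorem matParity_jacBlock {m n : Type*} {f : m → Idx p q} {g : n → Idx p q} {α : ZMod 2}
    (hfg : ∀ i j, par (f i) + par (g j) = α) : MatParity α (c.jacBlock c' h h' f g) :=
  fun i j => (c.hasParity_jac c' h h' _ _).cast (hfg i j)

theorem jacCorrection_map : (c.jacCorrection c' h h').map (M.evenVal W) =
    c.jacBlock c' h h' Sum.inl Sum.inr * c.jacOOInv c' h h' *
      c.jacBlock c' h h' Sum.inr Sum.inl := by
  have hp : MatParity 0 (c.jacBlock c' h h' Sum.inl Sum.inr * c.jacOOInv c' h h' *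
      c.jacBlock c' h h' Sum.inr Sum.inl) :=
    ((c.matParity_jacBlock c' h h' (α := 1) fun _ _ => rfl).mul
      (c.matParity_jacOOInv c' h h')).mul (c.matParity_jacBlock c' h h' (α := 1) fun _ _ => rfl)
  ext i j
  have e : (c.jacBlock c' h h' Sum.inl Sum.inr * c.jacOOInv c' h h' *
      c.jacBlock c' h h' Sum.inr Sum.inl) i j = ∑ k, ∑ l, c.jac c' h h' (Sum.inl i) (Sum.inr k) *
        ((c.jacOO c' h h')⁻¹ k l : M.Fun W) * c.jac c' h h' (Sum.inr l) (Sum.inl j) := by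
    rw [Finset.sum_comm]
    simp only [Matrix.mul_apply, Finset.sum_mul]
    rfl
  rw [Matrix.map_apply, jacCorrection, Matrix.of_apply, ← e]
  exact evenPart_coe (hp i j)

/-- The Schur complement `A - B D⁻¹ C` of the odd-odd block. -/
def jacSchur : Matrix (Fin p) (Fin p) (M.even W) := c.jacEE c' h h' - c.jacCorrection c' h h'

theorem jacSchur_map : (c.jacSchur c' h h').map (M.evenVal W) =
    c.jacBlock c' h h' Sum.inl Sum.inl - c.jacBlock c' h h' Sum.inl Sum.inr *
      c.jacOOInv c' h h' * c.jacBlock c' h h' Sum.inr Sum.inl := by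
  rw [← jacCorrection_map, ← jacEE_map]
  ext i j
  exact map_sub (M.evenVal W) _ _

theorem jacBlock_mul {m n : Type*} (f : m → Idx p q) (g : n → Idx p q) :
    c.jacBlock c' h h' f Sum.inl * c'.jacBlock c h' h Sum.inl g +
      c.jacBlock c' h h' f Sum.inr * c'.jacBlock c h' h Sum.inr g =
    Matrix.of fun i j => if f i = g j then 1 else 0 := by
  ext i j
  simp only [Matrix.add_apply, Matrix.mul_apply]
  exact c.jac_block_mul c' h h' (f i) (g j)

theorem jacBlock_mul_inl : c.jacBlock c' h h' Sum.inl Sum.inl * c'.jacBlock c h' h Sum.inl Sum.inl +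
      c.jacBlock c' h h' Sum.inl Sum.inr * c'.jacBlock c h' h Sum.inr Sum.inl = 1 := by
  rw [jacBlock_mul]
  ext i j
  simp [Matrix.one_apply]

theorem jacBlock_mul_inr : c.jacBlock c' h h' Sum.inr Sum.inl * c'.jacBlock c h' h Sum.inl Sum.inr +
      c.jacBlock c' h h' Sum.inr Sum.inr * c'.jacBlock c h' h Sum.inr Sum.inr = 1 := by
  rw [jacBlock_mul]
  ext i j
  simp [Matrix.one_apply]

theorem jacBlock_mul_inr_inl :
    c.jacBlock c' h h' Sum.inr Sum.inl * c'.jacBlock c h' h Sum.inl Sum.inl +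
      c.jacBlock c' h h' Sum.inr Sum.inr * c'.jacBlock c h' h Sum.inr Sum.inl = 0 := by
  rw [jacBlock_mul]
  ext i j
  simp

theorem jacBlock_mul_inl_inr :
    c.jacBlock c' h h' Sum.inl Sum.inl * c'.jacBlock c h' h Sum.inl Sum.inr +
      c.jacBlock c' h h' Sum.inl Sum.inr * c'.jacBlock c h' h Sum.inr Sum.inr = 0 := by
  rw [jacBlock_mul]
  ext i j
  simp

/-- Block inversion: the Schur complement inverts the even-even block of the inverse Jacobi matrix.
-/
theorem jacSchur_mul : c.jacSchur c' h h' * c'.jacEE c h' h = 1 := by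
  have hinj : Function.Injective (fun X : Matrix (Fin p) (Fin p) (M.even W) =>
      X.map (M.evenVal W)) := Matrix.map_injective Subtype.val_injective
  refine hinj ?_
  simp only [Matrix.map_mul]
  rw [jacSchur_map, jacEE_map, Matrix.map_one _ (map_zero _) (map_one _), Matrix.sub_mul,
    Matrix.mul_assoc _ (c.jacBlock c' h h' Sum.inr Sum.inl),
    eq_neg_of_add_eq_zero_left (c.jacBlock_mul_inr_inl c' h h'), Matrix.mul_neg, sub_neg_eq_add,
    Matrix.mul_assoc, ← Matrix.mul_assoc (c.jacOOInv c' h h'), inv_mul_jacOO, Matrix.one_mul,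
    jacBlock_mul_inl]

/-- This gives Ber⁻¹ as a product of two determinants, free of matrix inverses. Invertibility of Ber
and its compatibility with restriction follow, the latter by uniqueness of inverses. -/
theorem ber_mul : c.ber c' h h' * ((c.jacOO c' h h').det * (c'.jacEE c h' h).det) = 1 := by
  have h1 := congrArg Matrix.det (c.jacSchur_mul c' h h')
  rw [Matrix.det_mul, Matrix.det_one] at h1
  change (c.jacSchur c' h h').det * Ring.inverse (c.jacOO c' h h').det * _ = 1
  rw [mul_assoc, ← mul_assoc (Ring.inverse _),
    Ring.inverse_mul_cancel _ (c.isUnit_det_jacOO c' h h'), one_mul, h1]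

theorem isUnit_ber : IsUnit (c.ber c' h h') := IsUnit.of_mul_eq_one _ (c.ber_mul c' h h')

theorem ber_mul_det : c.ber c' h h' * (c.jacOO c' h h').det = (c.jacSchur c' h h').det := by
  change (c.jacSchur c' h h').det * Ring.inverse (c.jacOO c' h h').det * _ = _
  rw [mul_assoc, Ring.inverse_mul_cancel _ (c.isUnit_det_jacOO c' h h'), mul_one]

theorem ber_res (hle : W' ≤ W) :
    resEven hle (c.ber c' h h') = c.ber c' (hle.trans h) (hle.trans h') := by
  have hOO : (resEven hle) (c.jacOO c' h h').det = (c.jacOO c' (hle.trans h) (hle.trans h')).det := by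
    rw [RingHom.map_det]
    congr 1
    ext i j
    simp only [RingHom.mapMatrix_apply, Matrix.map_apply, jacOO, Matrix.of_apply, resEven_evenPart,
      jac_res]
  have hEE : (resEven hle) (c'.jacEE c h' h).det = (c'.jacEE c (hle.trans h') (hle.trans h)).det := by
    rw [RingHom.map_det]
    congr 1
    ext i j
    simp only [RingHom.mapMatrix_apply, Matrix.map_apply, jacEE, Matrix.of_apply, resEven_evenPart,
      jac_res]
  have h1 := congrArg (resEven hle) (c.ber_mul c' h h')
  rw [map_mul, map_mul, map_one, hOO, hEE] at h1
  have h2 := c.ber_mul c' (hle.trans h) (hle.trans h')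
  rw [mul_comm] at h2
  exact (left_inv_eq_right_inv h1 h2)

/-- The logarithmic derivative of the Berezinian. -/
theorem d_ber (b : Idx p q) :
    c.d h b (c.ber c' h h' : M.Fun W) = (c.ber c' h h' : M.Fun W) *
      ∑ a, ∑ a', sgn (par a) • (c.d h b (c.jac c' h h' a a') * c'.jac c h' h a' a) := by
  -- On even functions the Leibniz rule carries no sign, so the determinant formula applies to ∂_b
  -- even when ∂_b is odd.
  let δ : M.even W →+ M.Fun W := (c.dL h b).toAddMonoidHom.comp (M.evenVal W).toAddMonoidHom
  have hδ_apply : ∀ f : M.even W, δ f = c.d h b (f : M.Fun W) := fun _ => rfl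
  have hδ : ∀ f g, δ (f * g) = M.evenVal W f * δ g + M.evenVal W g * δ f := by
    intro f g
    simp only [hδ_apply, coe_mul]
    rw [c.d_mul_of_hasParity h b (hasParity_even f), mul_zero, sgn_zero, one_smul, add_comm,
      ← (hasParity_even g).commute]
    rfl
  have tr : ∀ {n : Type} [Fintype n] [DecidableEq n] (X Y : Matrix n n (M.even W)),
      ∑ i, ∑ j, M.evenVal W (Y j i) * δ (X i j) =
        ((X.map (M.evenVal W)).map (c.dL h b) * Y.map (M.evenVal W)).trace := by
    intro n _ _ X Y
    simp only [Matrix.trace, Matrix.diag, Matrix.mul_apply, Matrix.map_apply]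
    exact Finset.sum_congr rfl fun i _ => Finset.sum_congr rfl fun j _ =>
      (hasParity_even (Y j i)).commute _
  have hdX := map_det_of_leibniz_of_mul_eq_one (M.evenVal W) δ hδ (c.jacSchur_mul c' h h')
  have hdD := map_det_of_leibniz_of_mul_eq_one (M.evenVal W) δ hδ
    (Matrix.mul_nonsing_inv _ (c.isUnit_det_jacOO c' h h'))
  rw [tr, jacSchur_map, jacEE_map] at hdX
  rw [tr, jacOO_map, ← jacOOInv] at hdD
  have key := trace_log_derivative (c.dL h b) (par b) (c.d_mul h b)
    (fun α f hf => c.hasParity_d h b hf)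
    (A := c.jacBlock c' h h' Sum.inl Sum.inl)
    (A' := c'.jacBlock c h' h Sum.inl Sum.inl) (B := c.jacBlock c' h h' Sum.inl Sum.inr)
    (B' := c'.jacBlock c h' h Sum.inl Sum.inr) (C := c.jacBlock c' h h' Sum.inr Sum.inl)
    (C' := c'.jacBlock c h' h Sum.inr Sum.inl) (D := c.jacBlock c' h h' Sum.inr Sum.inr)
    (D' := c'.jacBlock c h' h Sum.inr Sum.inr) (Di := c.jacOOInv c' h h')
    (matParity_jacBlock _ _ _ _ fun _ _ => rfl) (matParity_jacBlock _ _ _ _ fun _ _ => rfl)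
    (matParity_jacBlock _ _ _ _ fun _ _ => rfl) (matParity_jacBlock _ _ _ _ fun _ _ => show (1 + 1 : ZMod 2) = 0 by decide)
    (c.matParity_jacOOInv c' h h') (c.jacOO_mul_inv c' h h') (c.inv_mul_jacOO c' h h')
    (c.jacBlock_mul_inr_inl c' h h') (c'.jacBlock_mul_inl_inr c h' h) (c'.jacBlock_mul_inr c h' h)
  have hstr : ∑ a, ∑ a', sgn (par a) • (c.d h b (c.jac c' h h' a a') * c'.jac c h' h a' a) =
      ((c.jacBlock c' h h' Sum.inl Sum.inl).map (c.dL h b) *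
        c'.jacBlock c h' h Sum.inl Sum.inl).trace +
      ((c.jacBlock c' h h' Sum.inl Sum.inr).map (c.dL h b) *
        c'.jacBlock c h' h Sum.inr Sum.inl).trace -
      ((c.jacBlock c' h h' Sum.inr Sum.inl).map (c.dL h b) *
        c'.jacBlock c h' h Sum.inl Sum.inr).trace -
      ((c.jacBlock c' h h' Sum.inr Sum.inr).map (c.dL h b) *
        c'.jacBlock c h' h Sum.inr Sum.inr).trace := by
    have e0 : ∀ i : Fin p, sgn (par (Sum.inl i : Idx p q)) = 1 := fun _ => sgn_zero
    have e1 : ∀ i : Fin q, sgn (par (Sum.inr i : Idx p q)) = -1 := fun _ => sgn_one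
    simp only [Fintype.sum_sum_type, e0, e1, one_smul, neg_smul, Finset.sum_neg_distrib,
      Finset.sum_add_distrib, Matrix.trace, Matrix.diag, Matrix.mul_apply, Matrix.map_apply,
      jacBlock, Matrix.of_apply, dL_apply]
    abel
  rw [hstr, ← key]
  have hu := c.isUnit_det_jacOO c' h h'
  have huv : IsUnit ((c.jacOO c' h h').det : M.Fun W) := hu.map (M.evenVal W)
  -- Differentiate Ber · det D = det(A − B D⁻¹ C), insert both determinant formulas and cancel the
  -- unit det D.
  have hprod := congrArg δ (c.ber_mul_det c' h h')
  rw [hδ, hdX, hdD, ← c.ber_mul_det c' h h', map_mul] at hprod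
  simp only [evenVal_apply, hδ_apply] at hprod
  refine huv.mul_left_cancel ?_
  rw [(hasParity_even (c.jacOO c' h h').det).left_comm, mul_sub, mul_sub, ← mul_assoc, ← mul_assoc,
    eq_sub_iff_add_eq, ← hprod, add_comm]
  simp only [mul_assoc]

end Chart

end

section

namespace Chart

open SuperRingedSpace

variable {M : SuperRingedSpace.{u}} (c c' c'' : Chart p q M) {W W' : Opens M.space}
  (h : W ≤ c.dom) (h' : W ≤ c'.dom) (h'' : W ≤ c''.dom)

/-! ### Square roots -/

theorem evenBody_eq (x : W) (f : M.even W) : c.evenBody h x f = c'.evenBody h' x f :=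
  c.bodyHom_eq c' h h' x _

theorem isSqrtAbs_iff (J r : M.even W) :
    c.IsSqrtAbs h J r ↔ (∀ x : W, 0 < c.evenBody h x r) ∧ r ^ 4 = J ^ 2 :=
  and_congr_left' (c.forall_body h (r : M.Fun W) (0 < ·))

/-- The sum r + s has positive body, so it is a unit and can be cancelled from (r + s)(r − s) = 0.
Applied twice, this makes positive fourth roots unique. -/
theorem eq_of_sq_eq_sq {r s : M.even W} (hr : ∀ x : W, 0 < c.evenBody h x r)
    (hs : ∀ x : W, 0 < c.evenBody h x s) (hrs : r ^ 2 = s ^ 2) : r = s := by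
  have hu : IsUnit (r + s) := (c.isUnit_even_iff h _).2 fun x => by
    rw [map_add]; exact (add_pos (hr x) (hs x)).ne'
  rw [← sub_eq_zero]
  refine hu.mul_left_cancel ?_
  rw [mul_zero]
  linear_combination hrs

theorem IsSqrtAbs.unique {J r s : M.even W} (hr : c.IsSqrtAbs h J r) (hs : c.IsSqrtAbs h J s) :
    r = s := by
  rw [isSqrtAbs_iff] at hr hs
  refine c.eq_of_sq_eq_sq h hr.1 hs.1 (c.eq_of_sq_eq_sq h (fun x => ?_) (fun x => ?_) ?_)
  · rw [map_pow]; exact pow_pos (hr.1 x) 2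
  · rw [map_pow]; exact pow_pos (hs.1 x) 2
  · linear_combination hr.2 - hs.2

theorem isNilpotent_even {f : M.even W} (hf : ∀ x : W, c.evenBody h x f = 0) : IsNilpotent f := by
  have h0 : ∀ y, SuperFun.bodyHom y (c.equiv W h (f : M.Fun W)) = 0 :=
    (c.forall_imageOpens h (P := fun y =>
      SuperFun.bodyHom y (c.equiv W h (f : M.Fun W)) = 0)).2 hf
  obtain ⟨n, hn⟩ := SuperFun.isNilpotent_of_bodyHom h0
  refine ⟨n, Subtype.ext ((c.equiv W h).injective ?_)⟩
  rw [coe_pow, map_pow, hn]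
  exact (map_zero _).symm

/-- The real fourth root of the body of J² solves X⁴ = J² modulo nilpotents. As the derivative 4x₀³
is a unit there, Newton's method corrects it to an exact root without changing the body. -/
theorem exists_isSqrtAbs {J : M.even W} (hJ : IsUnit J) : ∃ r, c.IsSqrtAbs h J r := by
  have hJb : ∀ x : W, 0 < c.evenBody h x (J ^ 2) := fun x => by
    have := (c.isUnit_even_iff h _).1 hJ x
    rw [map_pow]; positivity
  set F := c.equiv W h ((J ^ 2 : M.even W) : M.Fun W) with hF
  have hpos : ∀ y ∈ imageOpens c.φ W h, 0 < coeff F.1 ∅ y := by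
    rintro _ ⟨x, hx, rfl⟩
    have := hJb ⟨x, hx⟩
    rwa [evenBody_apply, bodyHom_eq_coeff] at this
  have hsm : ContDiffOn ℝ ∞ (fun y => (coeff F.1 ∅ y) ^ (1 / 4 : ℝ)) (imageOpens c.φ W h) :=
    (F.2 ∅).rpow_const_of_ne fun y hy => (hpos y hy).ne'
  let x₀ : M.even W := ⟨(c.equiv W h).symm (SuperFun.ofReal _ _ hsm), (c.equiv W h).injective <| by
    change c.equiv W h (M.inv W _) = c.equiv W h _
    rw [equiv_invol, AlgEquiv.apply_symm_apply, SuperFun.invol_ofReal]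
    exact (AlgEquiv.apply_symm_apply _ _).symm⟩
  have hx₀ : ∀ x : W, c.evenBody h x x₀ = (c.evenBody h x (J ^ 2)) ^ (1 / 4 : ℝ) := by
    intro x
    rw [evenBody_apply, evenBody_apply, bodyHom_eq_coeff _ _ _ ((J ^ 2 : M.even W) : M.Fun W)]
    change SuperFun.bodyHom _ (c.equiv W h ((c.equiv W h).symm _)) = _
    rw [AlgEquiv.apply_symm_apply, SuperFun.bodyHom_ofReal]
  have hx₀pos : ∀ x : W, 0 < c.evenBody h x x₀ := fun x => by
    rw [hx₀]; exact Real.rpow_pos_of_pos (hJb x) _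
  let P : Polynomial (M.even W) := Polynomial.X ^ 4 - Polynomial.C (J ^ 2)
  have haev : ∀ r : M.even W, Polynomial.aeval r P = r ^ 4 - J ^ 2 := fun r => by simp [P]
  have h1 : IsNilpotent (Polynomial.aeval x₀ P) := by
    refine c.isNilpotent_even h fun x => ?_
    rw [haev, map_sub, map_pow, hx₀, ← Real.rpow_natCast, ← Real.rpow_mul (hJb x).le]
    norm_num
  have h2 : IsUnit (Polynomial.aeval x₀ (Polynomial.derivative P)) := by
    refine (c.isUnit_even_iff h _).2 fun x => ?_
    have : Polynomial.aeval x₀ (Polynomial.derivative P) = 4 * x₀ ^ 3 := by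
      simp only [P]
      rw [Polynomial.derivative_sub, Polynomial.derivative_C, Polynomial.derivative_X_pow]
      simp
    rw [this, map_mul, map_pow, map_ofNat]
    exact mul_ne_zero (by norm_num) (pow_pos (hx₀pos x) 3).ne'
  obtain ⟨r, ⟨hr1, hr2⟩, -⟩ := Polynomial.existsUnique_nilpotent_sub_and_aeval_eq_zero h1 h2
  refine ⟨r, (c.isSqrtAbs_iff h J r).2 ⟨fun x => ?_, ?_⟩⟩
  · have := (hr1.map (c.evenBody h x)).eq_zero
    rw [map_sub, sub_eq_zero] at this
    rw [← this]; exact hx₀pos x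
  · rw [haev] at hr2
    exact sub_eq_zero.1 hr2

theorem isSqrtAbs_sqrtAbsBer : c.IsSqrtAbs h (c.ber c' h h') (c.sqrtAbsBer c' h h') :=
  Classical.epsilon_spec (c.exists_isSqrtAbs h (c.isUnit_ber c' h h'))

theorem evenBody_sqrtAbsBer_pos (x : W) : 0 < c.evenBody h x (c.sqrtAbsBer c' h h') :=
  ((c.isSqrtAbs_iff h _ _).1 (c.isSqrtAbs_sqrtAbsBer c' h h')).1 x

theorem sqrtAbsBer_pow_four : c.sqrtAbsBer c' h h' ^ 4 = c.ber c' h h' ^ 2 :=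
  (c.isSqrtAbs_sqrtAbsBer c' h h').2

theorem isUnit_sqrtAbsBer : IsUnit (c.sqrtAbsBer c' h h') :=
  (c.isUnit_even_iff h _).2 fun x => (c.evenBody_sqrtAbsBer_pos c' h h' x).ne'

theorem evenBody_res (hle : W' ≤ W) (x : W') (f : M.even W) :
    c.evenBody (hle.trans h) x (resEven hle f) = c.evenBody h ⟨x, hle x.2⟩ f :=
  c.bodyHom_res h hle x f

theorem sqrtAbsBer_res (hle : W' ≤ W) :
    M.res hle (c.sqrtAbsBer c' h h' : M.Fun W) =
      (c.sqrtAbsBer c' (hle.trans h) (hle.trans h') : M.Fun W') := by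
  have : resEven hle (c.sqrtAbsBer c' h h') = c.sqrtAbsBer c' (hle.trans h) (hle.trans h') := by
    refine IsSqrtAbs.unique c (hle.trans h) ?_ (c.isSqrtAbs_sqrtAbsBer c' _ _)
    rw [isSqrtAbs_iff]
    refine ⟨fun x => ?_, ?_⟩
    · rw [c.evenBody_res h hle]
      exact c.evenBody_sqrtAbsBer_pos c' h h' _
    · rw [← map_pow, sqrtAbsBer_pow_four, map_pow, ber_res]
  exact congrArg Subtype.val this

/-! ### The Piola identity -/

/-- The logarithmic derivative of the Berezinian. -/
def logDer (b : Idx p q) : M.Fun W :=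
  ∑ a, ∑ a', sgn (par a) • (c.d h b (c.jac c' h h' a a') * c'.jac c h' h a' a)

theorem d_sq_even (b : Idx p q) (f : M.even W) :
    c.d h b ((f ^ 2 : M.even W) : M.Fun W) = (2 : ℝ) • ((f : M.Fun W) * c.d h b (f : M.Fun W)) := by
  rw [coe_pow, pow_two, c.d_mul_of_hasParity h b (hasParity_even f), mul_zero, sgn_zero, one_smul,
    ← (hasParity_even f).commute, two_smul]

/-- r² is ±Ber, with the same logarithmic derivative. Differentiating (r²)² = Ber² avoids having to
choose the sign. -/
theorem d_sqrtAbsBer_sq (b : Idx p q) :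
    c.d h b ((c.sqrtAbsBer c' h h' ^ 2 : M.even W) : M.Fun W) =
      ((c.sqrtAbsBer c' h h' ^ 2 : M.even W) : M.Fun W) * c.logDer c' h h' b := by
  set r := c.sqrtAbsBer c' h h'
  have h4 : (r ^ 2) ^ 2 = c.ber c' h h' ^ 2 := by
    rw [← sqrtAbsBer_pow_four]; ring
  have h1 := congrArg (fun f : M.even W => c.d h b (f : M.Fun W)) h4
  simp only [d_sq_even c h b (r ^ 2), d_sq_even c h b (c.ber c' h h')] at h1
  have h2 : ((r ^ 2 : M.even W) : M.Fun W) * c.d h b ((r ^ 2 : M.even W) : M.Fun W) =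
      (c.ber c' h h' : M.Fun W) * c.d h b (c.ber c' h h' : M.Fun W) :=
    smul_right_injective _ (two_ne_zero (α := ℝ)) h1
  have h5 : (c.ber c' h h' : M.Fun W) * (c.ber c' h h' : M.Fun W) =
      ((r ^ 2 : M.even W) : M.Fun W) * ((r ^ 2 : M.even W) : M.Fun W) := by
    rw [← coe_mul, ← coe_mul, ← pow_two, ← pow_two (r ^ 2), h4]
  rw [d_ber, ← mul_assoc _ (c.ber c' h h' : M.Fun W), h5, mul_assoc _ _ (Finset.sum _ _)] at h2
  have hu : IsUnit ((r ^ 2 : M.even W) : M.Fun W) :=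
    ((c.isUnit_sqrtAbsBer c' h h').pow 2).map (M.evenVal W)
  exact hu.mul_left_cancel h2

theorem sum_jac_mul_jac_mul (f : Idx p q → M.Fun W) (a : Idx p q) :
    ∑ b, c.jac c' h h' a b * ∑ k, c'.jac c h' h b k * f k = f a := by
  simp only [Finset.mul_sum, ← mul_assoc]
  rw [Finset.sum_comm]
  simp only [← Finset.sum_mul, jac_mul_jac_inv]
  simp

/-- The divergence of the inverse Jacobi matrix. After multiplication by J, the relation J ∂(J⁻¹) =
∓∂(J) J⁻¹, from JJ⁻¹ = 1, together with the symmetry of the second derivatives of x', leaves minus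
the logarithmic derivative of Ber. -/
theorem sum_d_jac (a' : Idx p q) :
    ∑ a, sgn (par a * (par a + par a')) • c.d h a (c'.jac c h' h a' a) =
      -∑ a, c'.jac c h' h a' a * c.logDer c' h h' a := by
  set N : Idx p q → M.Fun W := fun a' =>
    ∑ a, sgn (par a * (par a + par a')) • c.d h a (c'.jac c h' h a' a) with hN
  have key : ∀ b, ∑ a', c.jac c' h h' b a' * N a' = -c.logDer c' h h' b := by
    intro b
    simp only [hN, Finset.mul_sum]
    rw [Finset.sum_comm, logDer, ← Finset.sum_neg_distrib]
    refine Finset.sum_congr rfl fun a _ => ?_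
    have h0 : ∑ k, c.d h a (c.jac c' h h' b k * c'.jac c h' h k a) = 0 := by
      rw [← d_sum, jac_mul_jac_inv]
      split_ifs
      · exact c.d_one h a
      · exact c.d_zero h a
    simp only [c.d_mul_of_hasParity h a (c.hasParity_jac c' h h' b _), Finset.sum_add_distrib] at h0
    have hs : ∀ k : Idx p q, sgn (par a * (par a + par k)) =
        sgn (par a + par a * par b) * sgn (par a * (par b + par k)) := by
      intro k
      rw [← sgn_add]
      have : ∀ x y z : ZMod 2, x * (x + z) = x + x * y + x * (y + z) := by decide
      rw [this (par a) (par b)]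
    -- Both sides are second derivatives of x'^k. Exchanging them turns the divergence into the
    -- supertrace.
    have hd : ∀ k, c.d h a (c.jac c' h h' b k) =
        sgn (par a * par b) • c.d h b (c.jac c' h h' a k) := fun k => c.d_comm h a b _
    simp only [hs, mul_smul, mul_smul_comm, ← Finset.smul_sum]
    rw [eq_neg_of_add_eq_zero_right h0, smul_neg]
    simp only [hd, smul_mul_assoc, ← Finset.smul_sum, smul_smul]
    rw [sgn_add, mul_assoc, sgn_mul_self, mul_one]
  have h2 := c'.sum_jac_mul_jac_mul c h' h N a'
  change N a' = _
  rw [← h2]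
  simp only [key, mul_neg, Finset.sum_neg_distrib]

/-- `ρ` satisfies the Piola identity with respect to a change of coordinates. -/
def IsPiola (ρ : M.Fun W) : Prop :=
  ∀ (a' : Idx p q) (f : M.Fun W), ρ * c'.d h' a' f =
    ∑ a, sgn (par a * (par a + par a')) • c.d h a (c'.jac c h' h a' a * (ρ * f))

/-- By Leibniz the right side has three parts. The divergence of J⁻¹ cancels the logarithmic
derivative of ρ by `sum_d_jac`, and the rest is the chain rule. -/
theorem isPiola_of_logDer {ρ : M.Fun W} (hρ : M.HasParity 0 ρ)
    (hd : ∀ b, c.d h b ρ = ρ * c.logDer c' h h' b) : c.IsPiola c' h h' ρ := by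
  intro a' f
  have h1 : ∀ a, sgn (par a * (par a + par a')) • c.d h a (c'.jac c h' h a' a * (ρ * f)) =
      sgn (par a * (par a + par a')) • c.d h a (c'.jac c h' h a' a) * (ρ * f) +
        (c'.jac c h' h a' a * c.logDer c' h h' a * (ρ * f) +
          ρ * (c'.jac c h' h a' a * c.d h a f)) := by
    intro a
    rw [c.d_mul_of_hasParity h a (c'.hasParity_jac c h' h a' a), add_comm (par a') (par a),
      smul_add, smul_smul, sgn_mul_self, one_smul, smul_mul_assoc,
      c.d_mul_of_hasParity h a hρ, mul_zero, sgn_zero, one_smul, mul_add (c'.jac c h' h a' a), hd,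
      hρ.commute (c.logDer c' h h' a), mul_assoc, mul_assoc, hρ.left_comm (c'.jac c h' h a' a)]
  rw [Finset.sum_congr rfl fun a _ => h1 a, Finset.sum_add_distrib, Finset.sum_add_distrib,
    ← Finset.sum_mul, ← Finset.sum_mul, sum_d_jac, ← Finset.mul_sum, ← c'.chain_rule c h' h,
    neg_mul, neg_add_cancel_left]

theorem isPiola_sqrtAbsBer :
    c.IsPiola c' h h' ((c.sqrtAbsBer c' h h' ^ 2 : M.even W) : M.Fun W) :=
  c.isPiola_of_logDer c' h h' (hasParity_even _) (c.d_sqrtAbsBer_sq c' h h')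

/-- Together with `d_eq_zero_of_isPiola` this stands in for multiplicativity of the Berezinian: the
product of two transition densities is a Piola density for the composite change. -/
theorem IsPiola.comp {ρ₁ ρ₂ : M.Fun W} (hρ₁ : M.HasParity 0 ρ₁)
    (h₁ : c.IsPiola c' h h' ρ₁) (h₂ : c'.IsPiola c'' h' h'' ρ₂) :
    c.IsPiola c'' h h'' (ρ₁ * ρ₂) := by
  intro a'' f
  rw [mul_assoc, h₂, Finset.mul_sum]
  simp only [mul_smul_comm, h₁ _ _, Finset.smul_sum, smul_smul]
  rw [Finset.sum_comm]
  refine Finset.sum_congr rfl fun a _ => ?_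
  rw [← jac_mul_jac c'' c' h'' h' c h, Finset.sum_mul, d_sum, Finset.smul_sum]
  refine Finset.sum_congr rfl fun a' _ => ?_
  rw [hρ₁.left_comm, ← mul_assoc (c'.jac c h' h a' a),
    (c'.hasParity_jac c h' h a' a).comm (c''.hasParity_jac c' h'' h' a'' a'), smul_mul_assoc,
    d_smul, smul_smul, mul_assoc ρ₁ ρ₂ f, ← sgn_add, ← sgn_add]
  congr 2
  have : ∀ x y z : ZMod 2, y * (y + z) + x * (x + y) + (y + x) * (z + y) = x * (x + z) := by decide
  exact this _ _ _

/-- The ratio of two Piola densities is constant. Taking f = 1 for ρt shows that the divergence of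
J⁻¹ρt is zero, and taking f = t for ρ identifies it with ρ ∂_{a'} t. -/
theorem d_eq_zero_of_isPiola {ρ t : M.Fun W} (hu : IsUnit ρ) (h₁ : c.IsPiola c' h h' ρ)
    (h₂ : c.IsPiola c' h h' (ρ * t)) (a' : Idx p q) : c'.d h' a' t = 0 := by
  refine hu.mul_left_cancel ?_
  rw [mul_zero, h₁]
  have := h₂ a' 1
  simp only [d_one, mul_zero, mul_one] at this
  exact this.symm

theorem eq_one_of_d_eq_zero {t : M.Fun W} (ht : ∀ a, c.d h a t = 0)
    (hb : ∀ x, c.bodyHom h x t = 1) : t = 1 := by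
  refine (c.equiv W h).injective ?_
  rw [map_one]
  refine SuperFun.eq_one_of_dOdd (fun j => ?_) ((c.forall_imageOpens h (P := fun y =>
    SuperFun.bodyHom y (c.equiv W h t) = 1)).2 hb)
  have := c.equiv_d h (Sum.inr j) t
  rw [ht, map_zero] at this
  exact this.symm

/-! ### The cocycle property -/

/-- On bodies the Jacobi matrices are block diagonal, so the chain rule multiplies each diagonal
block separately. Thus bodies of Berezinians multiply as ordinary determinants do. -/
theorem evenBody_jacOO_comp (x : W) : (c.jacOO c'' h h'').map (c.evenBody h x) =
    (c.jacOO c' h h').map (c.evenBody h x) * (c'.jacOO c'' h' h'').map (c'.evenBody h' x) := by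
  ext i j
  have := congrArg (c.bodyHom h x) (c.jac_mul_jac c' h h' c'' h'' (Sum.inr i) (Sum.inr j))
  simp only [Fintype.sum_sum_type, map_add, map_sum, map_mul] at this
  rw [Finset.sum_eq_zero (s := Finset.univ) (f := fun k => _ * c.bodyHom h x
    (c'.jac c'' h' h'' (Sum.inl k) (Sum.inr j))) (fun k _ => by
    rw [c.bodyHom_odd h x (c'.hasParity_jac c'' h' h'' (Sum.inl k) (Sum.inr j)), mul_zero]),
    zero_add] at this
  simp only [Matrix.mul_apply, Matrix.map_apply, jacOO, Matrix.of_apply, evenBody_apply,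
    bodyHom_evenPart, c.bodyHom_eq c' h h'] at this ⊢
  exact this.symm

theorem evenBody_jacEE_comp (x : W) : (c.jacEE c'' h h'').map (c.evenBody h x) =
    (c.jacEE c' h h').map (c.evenBody h x) * (c'.jacEE c'' h' h'').map (c'.evenBody h' x) := by
  ext i j
  have := congrArg (c.bodyHom h x) (c.jac_mul_jac c' h h' c'' h'' (Sum.inl i) (Sum.inl j))
  simp only [Fintype.sum_sum_type, map_add, map_sum, map_mul] at this
  rw [Finset.sum_eq_zero (s := Finset.univ) (f := fun k => _ * c.bodyHom h x
    (c'.jac c'' h' h'' (Sum.inr k) (Sum.inl j))) (fun k _ => by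
    rw [c.bodyHom_odd h x (c'.hasParity_jac c'' h' h'' (Sum.inr k) (Sum.inl j)), mul_zero]),
    add_zero] at this
  simp only [Matrix.mul_apply, Matrix.map_apply, jacEE, Matrix.of_apply, evenBody_apply,
    bodyHom_evenPart, c.bodyHom_eq c' h h'] at this ⊢
  exact this.symm

theorem evenBody_ber_mul (x : W) :
    c.evenBody h x (c.ber c' h h') * (((c.jacOO c' h h').map (c.evenBody h x)).det *
      ((c'.jacEE c h' h).map (c'.evenBody h' x)).det) = 1 := by
  have := congrArg (c.evenBody h x) (c.ber_mul c' h h')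
  rw [map_mul, map_mul, map_one, evenBody_det] at this
  rwa [← evenBody_det c' h', ← c.evenBody_eq c' h h']

theorem evenBody_ber_comp (x : W) : c.evenBody h x (c.ber c'' h h'') =
    c.evenBody h x (c.ber c' h h') * c'.evenBody h' x (c'.ber c'' h' h'') := by
  have h1 := c.evenBody_ber_mul c' h h' x
  have h2 := c'.evenBody_ber_mul c'' h' h'' x
  have h3 := c.evenBody_ber_mul c'' h h'' x
  rw [c.evenBody_jacOO_comp c' c'' h h' h'', c''.evenBody_jacEE_comp c' c h'' h' h,
    Matrix.det_mul, Matrix.det_mul] at h3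
  refine left_inv_eq_right_inv h3 ?_
  rw [mul_comm]
  linear_combination (c'.evenBody h' x (c'.ber c'' h' h'') *
    (((c'.jacOO c'' h' h'').map (c'.evenBody h' x)).det *
      ((c''.jacEE c' h'' h').map (c''.evenBody h'' x)).det)) * h1 + h2

/-- The cocycle property of the half-density transition factors. -/
theorem sqrtAbsBer_comp :
    c.sqrtAbsBer c'' h h'' = c.sqrtAbsBer c' h h' * c'.sqrtAbsBer c'' h' h'' := by
  set r₁ := c.sqrtAbsBer c' h h'
  set r₂ := c'.sqrtAbsBer c'' h' h''
  set r₃ := c.sqrtAbsBer c'' h h''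
  have hpos : ∀ x : W, 0 < c.evenBody h x (r₁ * r₂) := fun x => by
    rw [map_mul, c.evenBody_eq c' h h' x r₂]
    exact mul_pos (c.evenBody_sqrtAbsBer_pos c' h h' x) (c'.evenBody_sqrtAbsBer_pos c'' h' h'' x)
  have hpos₃ : ∀ x : W, 0 < c.evenBody h x r₃ := c.evenBody_sqrtAbsBer_pos c'' h h''
  -- With s = r₃⁻², the ratio s(r₁r₂)² of the two candidate densities is shown to be 1: its
  -- derivatives vanish by comparing Piola identities, and its body is 1.
  obtain ⟨s, hs⟩ := isUnit_iff_exists_inv.1 ((c.isUnit_sqrtAbsBer c'' h h'').pow 2)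
  change r₃ ^ 2 * s = 1 at hs
  have ht : r₃ ^ 2 * (s * (r₁ * r₂) ^ 2) = (r₁ * r₂) ^ 2 := by
    rw [← mul_assoc, hs, one_mul]
  have hu : IsUnit ((r₃ ^ 2 : M.even W) : M.Fun W) :=
    ((c.isUnit_sqrtAbsBer c'' h h'').pow 2).map (M.evenVal W)
  have hP : c.IsPiola c'' h h'' (((r₃ ^ 2 : M.even W) : M.Fun W) *
      ((s * (r₁ * r₂) ^ 2 : M.even W) : M.Fun W)) := by
    rw [← coe_mul, ht, mul_pow, coe_mul]
    exact IsPiola.comp c c' c'' h h' h'' (hasParity_even _) (c.isPiola_sqrtAbsBer c' h h')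
      (c'.isPiola_sqrtAbsBer c'' h' h'')
  have h1 := c''.eq_one_of_d_eq_zero h''
    (c.d_eq_zero_of_isPiola c'' h h'' hu (c.isPiola_sqrtAbsBer c'' h h'') hP) fun x => by
      rw [← c.bodyHom_eq c'' h h'']
      change c.evenBody h x (s * (r₁ * r₂) ^ 2) = 1
      -- On bodies the fourth powers are squares of Berezinians, which multiply. Positivity removes
      -- the fourth power.
      have e3 : (c.evenBody h x r₃) ^ 4 = (c.evenBody h x (r₁ * r₂)) ^ 4 := by
        rw [← map_pow, ← map_pow, mul_pow, map_mul, sqrtAbsBer_pow_four, sqrtAbsBer_pow_four,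
          sqrtAbsBer_pow_four, map_pow, map_pow, c.evenBody_eq c' h h' x (c'.ber c'' h' h'' ^ 2),
          map_pow, c.evenBody_ber_comp c' c'' h h' h'']
        ring
      have e4 := (pow_left_inj₀ (hpos₃ x).le (hpos x).le (by norm_num)).1 e3
      have e5 := congrArg (c.evenBody h x) hs
      rw [map_mul, map_pow, map_one, e4] at e5
      rw [map_mul, map_pow, mul_comm]
      exact e5
  have h2 : s * (r₁ * r₂) ^ 2 = 1 := Subtype.ext h1
  rw [h2, mul_one] at ht
  exact c.eq_of_sq_eq_sq h hpos₃ hpos ht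

theorem sqrtAbsBer_self : c.sqrtAbsBer c h h = 1 := by
  have h1 := c.sqrtAbsBer_comp c c h h h
  exact ((c.isUnit_sqrtAbsBer c h h).mul_left_cancel (by rw [mul_one]; exact h1)).symm

end Chart

end

section

/-! ### Half-densities -/

namespace SuperRingedSpace

variable {M : SuperRingedSpace.{u}} {U V W : Opens M.space}

theorem exists_glue_two {A B : Opens M.space} (hA : A ≤ U) (hB : B ≤ U) (hU : ∀ x ∈ U, x ∈ A ∨ x ∈ B)
    (f : M.Fun A) (g : M.Fun B)
    (h : M.res (inf_le_left : A ⊓ B ≤ A) f = M.res (inf_le_right : A ⊓ B ≤ B) g) :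
    ∃ k : M.Fun U, M.res hA k = f ∧ M.res hB k = g := by
  have hV : ∀ i : Bool, (if i then A else B) ≤ U := by rintro (_ | _) <;> assumption
  let s : ∀ i : Bool, M.Fun (if i then A else B) := fun i => match i with
    | true => f
    | false => g
  have hBA : M.res (inf_le_left : B ⊓ A ≤ B) g = M.res (inf_le_right : B ⊓ A ≤ A) f := by
    have := congrArg (M.res (inf_comm B A).le) h
    rw [res_trans, res_trans] at this
    exact this.symm
  obtain ⟨k, hk⟩ := exists_glue (fun i : Bool => if i then A else B) hV
    (fun x hx => (hU x hx).elim (fun h => ⟨true, h⟩) fun h => ⟨false, h⟩) s (by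
      rintro (_ | _) (_ | _)
      · rfl
      · exact hBA
      · exact h
      · rfl)
  exact ⟨k, hk true, hk false⟩

theorem res_eq_zero_of_le (hVU : V ≤ U) (hW : W ≤ V) {f : M.Fun U} (hf : M.res hVU f = 0) :
    M.res (hW.trans hVU) f = 0 := by
  rw [← res_trans hVU hW, hf, map_zero]

end SuperRingedSpace

open SuperRingedSpace

namespace HalfDensity

variable {M : Supermanifold.{u} p q} (c c' : Coords M) {W W' : Opens M.space}
  (h : W ≤ c.dom) (h' : W ≤ c'.dom)

theorem res_eq (s : HalfDensity M) :
    M.res h (s.1 c) = M.res h' (s.1 c') * (c.sqrtAbsBer c' h h' : M.Fun W) := by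
  have := congrArg (M.res (le_inf h h')) (s.2 c c')
  rwa [map_mul, res_trans, res_trans, Chart.sqrtAbsBer_res] at this

theorem of_res_eq {s : ∀ c : Coords M, M.Fun c.dom}
    (hs : ∀ (c c' : Coords M) (x : M.space), x ∈ c.dom → x ∈ c'.dom →
      ∃ (W : Opens M.space) (h : W ≤ c.dom) (h' : W ≤ c'.dom), x ∈ W ∧
        M.res h (s c) = M.res h' (s c') * (c.sqrtAbsBer c' h h' : M.Fun W)) :
    s ∈ HalfDensity M := by
  intro c c'
  refine ext_of_nhds fun x hx => ?_
  obtain ⟨W, h, h', hxW, he⟩ := hs c c' x hx.1 hx.2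
  refine ⟨W, le_inf h h', hxW, ?_⟩
  rw [map_mul, res_trans, res_trans, Chart.sqrtAbsBer_res]
  exact he

/-- Transition factors have positive body, so the sign of the body of a half-density at a point does
not depend on the chart. -/
theorem exists_bodyHom_eq (s : HalfDensity M) (x : M.space) (hx : x ∈ c.dom) (hx' : x ∈ c'.dom) :
    ∃ r : ℝ, 0 < r ∧
      c.bodyHom le_rfl ⟨x, hx⟩ (s.1 c) = c'.bodyHom le_rfl ⟨x, hx'⟩ (s.1 c') * r := by
  have h1 := congrArg (c.bodyHom inf_le_left ⟨x, hx, hx'⟩) (s.2 c c')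
  rw [map_mul, Chart.bodyHom_eq c c' inf_le_left inf_le_right _ (M.res inf_le_right (s.1 c')),
    Chart.bodyHom_res c le_rfl inf_le_left, Chart.bodyHom_res c' le_rfl inf_le_right] at h1
  exact ⟨_, Chart.evenBody_sqrtAbsBer_pos c c' inf_le_left inf_le_right _, h1⟩

/-- A function in a chart which vanishes off a closed subset of `M` contained in the domain
extends by zero to a half-density. -/
theorem exists_extend {K : Set M.space} (hK : IsClosed K) (hKc : K ⊆ c.dom) (f : M.Fun c.dom)
    (hf : ∀ (W : Opens M.space) (h : W ≤ c.dom), Disjoint (W : Set M.space) K → M.res h f = 0) :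
    ∃ s : HalfDensity M, s.1 c = f ∧
      (∀ (c' : Coords M) (W : Opens M.space) (h : W ≤ c'.dom), Disjoint (W : Set M.space) K →
        M.res h (s.1 c') = 0) ∧ ∀ δ, M.HasParity δ f → HasParity δ s := by
  let N : Opens M.space := ⟨Kᶜ, hK.isOpen_compl⟩
  have hN : ∀ (W : Opens M.space), W ≤ N ↔ Disjoint (W : Set M.space) K := fun W =>
    Set.subset_compl_iff_disjoint_right
  have hcov : ∀ x, x ∈ c.dom ∨ x ∈ N := fun x => by
    by_cases hx : x ∈ K
    · exact Or.inl (hKc hx)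
    · exact Or.inr hx
  -- In another chart, glue the transformed function on the overlap with zero off K. They agree
  -- where both are defined because f vanishes off K.
  have key : ∀ c' : Coords M, ∃ k : M.Fun c'.dom,
      M.res (inf_le_left : c'.dom ⊓ c.dom ≤ c'.dom) k = M.res inf_le_right f *
        (c'.sqrtAbsBer c (inf_le_left : c'.dom ⊓ c.dom ≤ c'.dom) inf_le_right : M.Fun _) ∧
      M.res (inf_le_left : c'.dom ⊓ N ≤ c'.dom) k = 0 := by
    intro c'
    refine exists_glue_two inf_le_left inf_le_left (fun x hx => (hcov x).imp (And.intro hx)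
      (And.intro hx)) _ _ ?_
    rw [map_mul, res_trans, hf _ _ ((hN _).1 (inf_le_right.trans inf_le_right)), zero_mul, map_zero]
  choose s hs1 hs2 using key
  have hs1' : ∀ (c' : Coords M) (W : Opens M.space) (h : W ≤ c.dom) (h' : W ≤ c'.dom),
      M.res h' (s c') = M.res h f * (c'.sqrtAbsBer c h' h : M.Fun W) := by
    intro c' W h h'
    have := congrArg (M.res (le_inf h' h)) (hs1 c')
    rwa [map_mul, res_trans, res_trans, Chart.sqrtAbsBer_res] at this
  have hs2' : ∀ (c' : Coords M) (W : Opens M.space) (h : W ≤ c'.dom),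
      Disjoint (W : Set M.space) K → M.res h (s c') = 0 := fun c' W h hW =>
    res_eq_zero_of_le inf_le_left (le_inf h ((hN W).2 hW)) (hs2 c')
  refine ⟨⟨s, of_res_eq fun c₁ c₂ x h₁ h₂ => ?_⟩, ?_, hs2', fun δ hδ c' => ?_⟩
  · rcases hcov x with hx | hx
    · refine ⟨c₁.dom ⊓ c₂.dom ⊓ c.dom, inf_le_left.trans inf_le_left,
        inf_le_left.trans inf_le_right, ⟨⟨h₁, h₂⟩, hx⟩, ?_⟩
      -- Here the cocycle property enters: both charts are compared through the original chart c.
      rw [hs1' c₁ _ inf_le_right, hs1' c₂ _ inf_le_right, mul_assoc, ← coe_mul,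
        mul_comm (c₂.sqrtAbsBer c _ _), ← Chart.sqrtAbsBer_comp]
    · have hd := (hN (c₁.dom ⊓ c₂.dom ⊓ N)).1 inf_le_right
      refine ⟨c₁.dom ⊓ c₂.dom ⊓ N, inf_le_left.trans inf_le_left,
        inf_le_left.trans inf_le_right, ⟨⟨h₁, h₂⟩, hx⟩, ?_⟩
      rw [hs2' c₁ _ _ hd, hs2' c₂ _ _ hd, zero_mul]
  · have := hs1' c c.dom le_rfl le_rfl
    rwa [Chart.sqrtAbsBer_self, coe_one, mul_one, res_self, res_self] at this
  · change M.inv _ (s c') = _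
    refine ext_of_nhds fun x hx => ?_
    rcases hcov x with hx' | hx'
    · refine ⟨c'.dom ⊓ c.dom, inf_le_left, ⟨hx, hx'⟩, ?_⟩
      rw [map_smul, ← inv_res, hs1]
      exact (((hδ.res _).mul (hasParity_even _)).cast (add_zero δ)).eq
    · refine ⟨c'.dom ⊓ N, inf_le_left, ⟨hx, hx'⟩, ?_⟩
      rw [map_smul, ← inv_res, hs2, map_zero, smul_zero]

/-- Locally finite sums of half-densities. -/
theorem exists_sum {ι : Type*} (s : ι → HalfDensity M) {K : ι → Set M.space}
    (hK : LocallyFinite K)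
    (hs : ∀ (i : ι) (c : Coords M) (W : Opens M.space) (h : W ≤ c.dom),
      Disjoint (W : Set M.space) (K i) → M.res h ((s i).1 c) = 0) :
    ∃ t : HalfDensity M, ∀ (c : Coords M) (W : Opens M.space) (h : W ≤ c.dom) (T : Finset ι),
      (∀ i ∉ T, Disjoint (W : Set M.space) (K i)) →
        M.res h (t.1 c) = ∑ i ∈ T, M.res h ((s i).1 c) := by
  classical
  have hex : ∀ x : M.space, ∃ (N : Opens M.space) (T : Finset ι), x ∈ N ∧
      ∀ i ∉ T, Disjoint (N : Set M.space) (K i) := by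
    intro x
    obtain ⟨N, hN, hfin⟩ := hK x
    obtain ⟨N', hN', ho, hx⟩ := mem_nhds_iff.1 hN
    refine ⟨⟨N', ho⟩, hfin.toFinset, hx, fun i hi => ?_⟩
    rw [Set.Finite.mem_toFinset, Set.mem_ofPred_eq, Set.not_nonempty_iff_eq_empty] at hi
    exact (Set.disjoint_iff_inter_eq_empty.2 (by rw [Set.inter_comm]; exact hi)).mono_left hN'
  choose N T hxN hT using hex
  have hsum : ∀ (c : Coords M) (W : Opens M.space) (h : W ≤ c.dom) (T₁ T₂ : Finset ι),
      (∀ i ∉ T₁, Disjoint (W : Set M.space) (K i)) → (∀ i ∉ T₂, Disjoint (W : Set M.space) (K i)) →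
      ∑ i ∈ T₁, M.res h ((s i).1 c) = ∑ i ∈ T₂, M.res h ((s i).1 c) := by
    intro c W h T₁ T₂ h₁ h₂
    rw [Finset.sum_subset (Finset.subset_union_left (s₂ := T₂)) fun i _ hi => hs i c W h (h₁ i hi),
      ← Finset.sum_subset (Finset.subset_union_right (s₁ := T₁)) fun i _ hi => hs i c W h (h₂ i hi)]
  have hglue : ∀ c : Coords M, ∃ f : M.Fun c.dom, ∀ x,
      M.res (inf_le_left : c.dom ⊓ N x ≤ c.dom) f = ∑ i ∈ T x, M.res inf_le_left ((s i).1 c) := by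
    intro c
    refine exists_glue (fun x => c.dom ⊓ N x) _ (fun x hx => ⟨x, hx, hxN x⟩) _ fun x y => ?_
    simp only [map_sum, res_trans]
    exact hsum c _ _ _ _ (fun i hi => (hT x i hi).mono_left (inf_le_left.trans inf_le_right))
      fun i hi => (hT y i hi).mono_left (inf_le_right.trans inf_le_right)
  choose t ht using hglue
  have ht' : ∀ (c : Coords M) (x : M.space) (W : Opens M.space) (h : W ≤ c.dom), W ≤ N x →
      M.res h (t c) = ∑ i ∈ T x, M.res h ((s i).1 c) := by
    intro c x W h hW
    have := congrArg (M.res (le_inf h hW)) (ht c x)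
    simpa only [map_sum, res_trans] using this
  refine ⟨⟨t, of_res_eq fun c c' x hx hx' => ?_⟩, fun c W h T' hT' => ?_⟩
  · refine ⟨c.dom ⊓ c'.dom ⊓ N x, inf_le_left.trans inf_le_left,
      inf_le_left.trans inf_le_right, ⟨⟨hx, hx'⟩, hxN x⟩, ?_⟩
    rw [ht' c x _ _ inf_le_right, ht' c' x _ _ inf_le_right, Finset.sum_mul]
    exact Finset.sum_congr rfl fun i _ => res_eq c c' _ _ (s i)
  · refine ext_of_nhds fun x hx => ⟨W ⊓ N x, inf_le_left, ⟨hx, hxN x⟩, ?_⟩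
    simp only [map_sum, res_trans]
    rw [ht' c x _ _ inf_le_right]
    exact hsum c _ _ _ _ (fun i hi => (hT x i hi).mono_left inf_le_right)
      fun i hi => (hT' i hi).mono_left inf_le_left

end HalfDensity

end

section

/-! ### A positive half-density -/

open SuperRingedSpace

namespace Chart

variable {M : SuperRingedSpace.{u}} (c : Chart p q M) {W : Opens M.space} (h : W ≤ c.dom)

/-- Passes between pointwise vanishing of Grassmann values and vanishing of restrictions. Closedness
of K makes its complement an admissible open set to restrict to. -/
theorem vanishesOff_iff {K : Set M.space} (hK : IsClosed K) (f : M.Fun c.dom) :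
    SuperFun.VanishesOff (c.equiv c.dom le_rfl f) (c.φ '' (K ∩ c.dom)) ↔
      ∀ (W : Opens M.space) (h : W ≤ c.dom), Disjoint (W : Set M.space) K → M.res h f = 0 := by
  constructor
  · intro hf W h hW
    refine (c.equiv W h).injective ?_
    rw [c.equiv_res c.dom W le_rfl h h, map_zero]
    refine Subtype.ext (funext ?_)
    rintro ⟨_, x, hx, rfl⟩
    refine hf ⟨c.φ x, Set.mem_image_of_mem _ (h hx)⟩ ?_
    rintro ⟨y, ⟨hyK, hy⟩, hyx⟩
    rw [c.φ.injOn hy (h hx) hyx] at hyK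
    exact Set.disjoint_left.1 hW hx hyK
  · intro hf
    rintro ⟨_, x, hx, rfl⟩ hxK
    have hxK' : x ∉ K := fun hxK' => hxK (Set.mem_image_of_mem _ ⟨hxK', hx⟩)
    let N : Opens M.space := c.dom ⊓ ⟨Kᶜ, hK.isOpen_compl⟩
    have h1 := hf N inf_le_left
      (Set.subset_compl_iff_disjoint_right.1 (inf_le_right : N ≤ ⟨Kᶜ, hK.isOpen_compl⟩))
    have h2 := congrArg (c.equiv N inf_le_left) h1
    rw [c.equiv_res c.dom N le_rfl inf_le_left inf_le_left, map_zero] at h2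
    exact congrFun (congrArg Subtype.val h2) ⟨c.φ x, Set.mem_image_of_mem _ ⟨hx, hxK'⟩⟩

/-- A smooth function of the even coordinates. -/
def ofReal (g : (Fin p → ℝ) → ℝ) (hg : ContDiff ℝ ∞ g) : M.Fun W :=
  (c.equiv W h).symm (SuperFun.ofReal _ g hg.contDiffOn)

theorem equiv_ofReal (g : (Fin p → ℝ) → ℝ) (hg : ContDiff ℝ ∞ g) :
    c.equiv W h (c.ofReal h g hg) = SuperFun.ofReal _ g hg.contDiffOn :=
  AlgEquiv.apply_symm_apply _ _

theorem hasParity_ofReal (g : (Fin p → ℝ) → ℝ) (hg : ContDiff ℝ ∞ g) :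
    M.HasParity 0 (c.ofReal h g hg) := by
  refine (c.equiv W h).injective ?_
  rw [equiv_invol, sgn_zero, one_smul, equiv_ofReal, SuperFun.invol_ofReal]

theorem bodyHom_ofReal (g : (Fin p → ℝ) → ℝ) (hg : ContDiff ℝ ∞ g) (x : W) :
    c.bodyHom h x (c.ofReal h g hg) = g (c.φ x) := by
  change SuperFun.bodyHom _ (c.equiv W h (c.ofReal h g hg)) = _
  rw [equiv_ofReal, SuperFun.bodyHom_ofReal]

end Chart

namespace Supermanifold

variable (M : Supermanifold.{u} p q)

theorem locallyCompactSpace : LocallyCompactSpace M.space := by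
  choose c hc using M.exists_chart
  let _ : ChartedSpace (Fin p → ℝ) M.space :=
    { atlas := Set.range fun x => (c x).φ
      chartAt := fun x => (c x).φ
      mem_chart_source := hc
      chart_mem_atlas := fun x => Set.mem_range_self x }
  exact ChartedSpace.locallyCompactSpace (Fin p → ℝ) M.space

/-- Paracompactness, from local compactness and second countability, gives a locally finite
refinement. Shrinking it puts the closures inside the chart domains. -/
theorem exists_locallyFinite_cover : ∃ (c : M.space → Coords M) (v : M.space → Set M.space),
    (∀ i, IsOpen (v i)) ∧ (∀ x, ∃ i, x ∈ v i) ∧ (∀ i, closure (v i) ⊆ (c i).dom) ∧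
      LocallyFinite fun i => closure (v i) := by
  have := M.t2
  have := M.secondCountable
  have := M.locallyCompactSpace
  choose c hc using M.exists_chart
  obtain ⟨u, huo, hu, hlf, huc⟩ := precise_refinement (fun i => ((c i).dom : Set M.space))
    (fun i => (c i).dom.isOpen) (Set.eq_univ_of_forall fun x => Set.mem_iUnion.2 ⟨x, hc x⟩)
  obtain ⟨v, hv, hvo, hvu⟩ := exists_iUnion_eq_closure_subset huo hlf.point_finite hu
  exact ⟨c, v, hvo, fun x => Set.mem_iUnion.1 (hv ▸ Set.mem_univ x),
    fun i => (hvu i).trans (huc i), hlf.subset hvu⟩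

/-- No partition of unity is needed: nonnegative functions in charts, extended by zero and summed,
stay nonnegative on bodies in every chart because transition factors are positive. At each point
some summand is strictly positive, since its function has support exactly the image of `v i` and
these sets cover M. -/
theorem exists_positive : ∃ σ : HalfDensity M, HalfDensity.HasParity 0 σ ∧
    ∀ (c : Coords M) (x : c.dom), 0 < c.bodyHom le_rfl x (σ.1 c) := by
  classical
  obtain ⟨c, v, hvo, hv, hvc, hlf⟩ := M.exists_locallyFinite_cover
  have hv' : ∀ i, v i ⊆ (c i).dom := fun i => subset_closure.trans (hvc i)
  have hg : ∀ i, ∃ g : (Fin p → ℝ) → ℝ, Function.support g = (c i).φ '' v i ∧ ContDiff ℝ ∞ g ∧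
      Set.range g ⊆ Set.Icc 0 1 := fun i =>
    ((c i).φ.isOpen_image_of_subset_source (hvo i) (hv' i)).exists_contDiff_support_eq
  choose g hgs hgd hgr using hg
  have hg0 : ∀ i y, 0 ≤ g i y := fun i y => (hgr i (Set.mem_range_self y)).1
  have hext := fun i => HalfDensity.exists_extend (c i) isClosed_closure (hvc i)
    ((c i).ofReal le_rfl (g i) (hgd i)) (((c i).vanishesOff_iff isClosed_closure _).1 (by
      intro y hy
      have : g i y = 0 := by
        by_contra h
        have : (y : Fin p → ℝ) ∈ Function.support (g i) := h
        rw [hgs] at this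
        obtain ⟨x, hx, hxy⟩ := this
        exact hy ⟨x, ⟨subset_closure hx, hv' i hx⟩, hxy⟩
      have h2 := congrFun (congrArg Subtype.val ((c i).equiv_ofReal le_rfl (g i) (hgd i))) y
      rw [SuperFun.ofReal_apply, this, map_zero] at h2
      exact h2))
  choose s hsc hs0 hsp using hext
  obtain ⟨σ, hσ⟩ := HalfDensity.exists_sum s hlf hs0
  have hloc : ∀ x : M.space, ∃ (N : Opens M.space) (T : Finset M.space), x ∈ N ∧
      ∀ i ∉ T, Disjoint (N : Set M.space) (closure (v i)) := by
    intro x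
    obtain ⟨N, hN, hfin⟩ := hlf x
    obtain ⟨N', hN', ho, hx⟩ := mem_nhds_iff.1 hN
    refine ⟨⟨N', ho⟩, hfin.toFinset, hx, fun i hi => ?_⟩
    rw [Set.Finite.mem_toFinset, Set.mem_ofPred_eq, Set.not_nonempty_iff_eq_empty] at hi
    exact (Set.disjoint_iff_inter_eq_empty.2 (by rw [Set.inter_comm]; exact hi)).mono_left hN'
  refine ⟨σ, fun c' => ?_, fun c' x => ?_⟩
  · change M.inv _ (σ.1 c') = _
    refine ext_of_nhds fun x hx => ?_
    obtain ⟨N, T, hxN, hT⟩ := hloc x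
    refine ⟨c'.dom ⊓ N, inf_le_left, ⟨hx, hxN⟩, ?_⟩
    rw [map_smul, ← inv_res, hσ c' _ _ T fun i hi => (hT i hi).mono_left inf_le_right]
    exact (HasParity.sum fun i _ => (hsp i 0 ((c i).hasParity_ofReal _ _ _) c').res _).eq
  · obtain ⟨x, hx⟩ := x
    obtain ⟨N, T, hxN, hT⟩ := hloc x
    have h1 := c'.bodyHom_res le_rfl (inf_le_left : c'.dom ⊓ N ≤ c'.dom) ⟨x, hx, hxN⟩ (σ.1 c')
    rw [hσ c' _ _ T fun i hi => (hT i hi).mono_left inf_le_right, map_sum] at h1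
    simp only [Chart.bodyHom_res c' le_rfl inf_le_left] at h1
    rw [← h1]
    have hbody : ∀ i, x ∈ (c i).dom → ∃ r : ℝ, 0 < r ∧
        c'.bodyHom le_rfl ⟨x, hx⟩ ((s i).1 c') = g i ((c i).φ x) * r := fun i hi => by
      have := HalfDensity.exists_bodyHom_eq c' (c i) (s i) x hx hi
      rwa [hsc, Chart.bodyHom_ofReal] at this
    obtain ⟨i, hi⟩ := hv x
    refine Finset.sum_pos' (fun j _ => ?_) ⟨i, ?_, ?_⟩
    · by_cases hj : x ∈ (c j).dom
      · obtain ⟨r, hr, he⟩ := hbody j hj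
        rw [he]
        exact mul_nonneg (hg0 j _) hr.le
      -- If x lies outside the j-th chart, it lies outside the closure of `v j`, and the j-th
      -- summand vanishes near x.
      · have h2 := c'.bodyHom_res le_rfl
          (inf_le_left : c'.dom ⊓ ⟨(closure (v j))ᶜ, isClosed_closure.isOpen_compl⟩ ≤ c'.dom)
          ⟨x, hx, fun h => hj (hvc j h)⟩ ((s j).1 c')
        rw [hs0 j c' _ _ (Set.subset_compl_iff_disjoint_right.1 inf_le_right), map_zero] at h2
        exact h2.le
    · by_contra hiT
      exact Set.disjoint_left.1 (hT i hiT) hxN (subset_closure hi)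
    · obtain ⟨r, hr, he⟩ := hbody i (hv' i hi)
      rw [he]
      refine mul_pos (lt_of_le_of_ne (hg0 i _) (Ne.symm ?_)) hr
      change (c i).φ x ∈ Function.support (g i)
      rw [hgs]
      exact Set.mem_image_of_mem _ hi

end Supermanifold

end

section

/-! ### Second order operators in divergence form -/

open SuperRingedSpace

namespace Chart

variable {M : SuperRingedSpace.{u}} (c c' : Chart p q M) {W W' : Opens M.space}
  (h : W ≤ c.dom) (h' : W ≤ c'.dom) {ε : ZMod 2} {T T' : Idx p q → Idx p q → M.Fun W}

/-- The operator `½ ∑ (-1)^{b(ε+a+b)} ∂_b T^{ab} ∂_a`. -/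
def div (ε : ZMod 2) (T : Idx p q → Idx p q → M.Fun W) (f : M.Fun W) : M.Fun W :=
  (1 / 2 : ℝ) • ∑ a, ∑ b, sgn (par b * (ε + par a + par b)) • c.d h b (T a b * c.d h a f)

theorem div_add (f g : M.Fun W) : c.div h ε T (f + g) = c.div h ε T f + c.div h ε T g := by
  simp only [div, d_add, mul_add, smul_add, Finset.sum_add_distrib]

theorem div_smul (r : ℝ) (f : M.Fun W) : c.div h ε T (r • f) = r • c.div h ε T f := by
  simp only [div, d_smul, mul_smul_comm, Finset.smul_sum, smul_comm r]

theorem div_res (hle : W' ≤ W) (f : M.Fun W) :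
    M.res hle (c.div h ε T f) = c.div (hle.trans h) ε (fun a b => M.res hle (T a b))
      (M.res hle f) := by
  simp only [div, map_smul, map_sum, ← c.d_res h hle, map_mul]

theorem hasParity_div (hT : ∀ a b, M.HasParity (ε + par a + par b) (T a b)) {δ : ZMod 2}
    {f : M.Fun W} (hf : M.HasParity δ f) : M.HasParity (ε + δ) (c.div h ε T f) := by
  refine HasParity.smul _ (HasParity.sum fun a _ => HasParity.sum fun b _ => HasParity.smul _ ?_)
  refine (c.hasParity_d h b ((hT a b).mul (c.hasParity_d h a hf))).cast ?_
  have : ∀ x y z w : ZMod 2, x + (y + z + x + (z + w)) = y + w := by decide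
  exact this _ _ _ _

/-- The sign in `div` is the one for moving ∂_b past T^{ab}. It squares away in the second order
part, so the principal symbol is T and there is no zeroth order term. -/
theorem div_eq (hT : ∀ a b, M.HasParity (ε + par a + par b) (T a b)) (f : M.Fun W) :
    c.div h ε T f = (1 / 2 : ℝ) • ∑ a, ∑ b, T a b * c.d h b (c.d h a f) +
      ∑ a, ((1 / 2 : ℝ) • ∑ b, sgn (par b * (ε + par a + par b)) • c.d h b (T a b)) *
        c.d h a f := by
  simp only [div, c.d_mul_of_hasParity h _ (hT _ _), smul_add, smul_smul, sgn_mul_self, one_smul,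
    Finset.sum_add_distrib, Finset.smul_sum, Finset.sum_mul, smul_mul_assoc]
  rw [add_comm]

/-- Piola turns the outer ∂_{b'}, weighted by ρ, into a divergence in the unprimed coordinates. The
tensor law and the chain rule turn the differentiated vector field into T^{ab} ∂_a f. The density ρ
stays inside the divergence. -/
theorem mul_div_eq_of_isPiola {ρ : M.Fun W} (hρ : M.HasParity 0 ρ) (hP : c.IsPiola c' h h' ρ)
    (hT : ∀ a b, M.HasParity (ε + par a + par b) (T' a b))
    (htr : ∀ a' b', T' a' b' = ∑ a, ∑ b, sgn (par b * (par a + par a')) •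
      (T a b * c.jac c' h h' a a' * c.jac c' h h' b b')) (f : M.Fun W) :
    ρ * c'.div h' ε T' f = (1 / 2 : ℝ) • ∑ a, ∑ b, sgn (par b * (ε + par a + par b)) •
      c.d h b (ρ * (T a b * c.d h a f)) := by
  -- The vector field T' ∂' f in the unprimed frame: contracting b' with J⁻¹ removes one Jacobi
  -- factor of T', and the other is absorbed by the chain rule.
  have key : ∀ b, ∑ a', ∑ b', sgn (par b' * (ε + par a' + par b') + par b * (par b + par b')) •
      (c'.jac c h' h b' b * (T' a' b' * c'.d h' a' f)) =
      ∑ a, sgn (par b * (ε + par a + par b)) • (T a b * c.d h a f) := by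
    intro b
    have h1 : ∀ a' b', sgn (par b' * (ε + par a' + par b') + par b * (par b + par b')) •
        (c'.jac c h' h b' b * (T' a' b' * c'.d h' a' f)) =
        sgn (par b * (ε + par a' + par b)) • (T' a' b' * c'.jac c h' h b' b * c'.d h' a' f) := by
      intro a' b'
      rw [← mul_assoc, (c'.hasParity_jac c h' h b' b).comm (hT a' b'), smul_mul_assoc, smul_smul,
        ← sgn_add]
      congr 2
      have : ∀ x y z w : ZMod 2, x * (y + z + x) + w * (w + x) + (x + w) * (y + z + x) =
        w * (y + z + w) := by decide
      exact this _ _ _ _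
    have h2 : ∀ a', ∑ b', T' a' b' * c'.jac c h' h b' b =
        ∑ a, sgn (par b * (par a + par a')) • (T a b * c.jac c' h h' a a') := by
      intro a'
      simp only [htr, Finset.sum_mul, smul_mul_assoc, mul_assoc]
      rw [Finset.sum_comm]
      refine Finset.sum_congr rfl fun a _ => ?_
      rw [Finset.sum_comm]
      simp only [← Finset.smul_sum, ← Finset.mul_sum, jac_mul_jac_inv]
      rw [Finset.sum_eq_single b]
      · rw [if_pos rfl, mul_one]
      · intro e _ he
        rw [if_neg he, mul_zero, mul_zero, smul_zero]
      · exact fun hb => absurd (Finset.mem_univ b) hb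
    simp only [h1, ← Finset.smul_sum, ← Finset.sum_mul, h2]
    simp only [Finset.sum_mul, Finset.smul_sum, smul_mul_assoc, smul_smul]
    rw [Finset.sum_comm]
    refine Finset.sum_congr rfl fun a _ => ?_
    rw [c.chain_rule c' h h', Finset.mul_sum, Finset.smul_sum]
    refine Finset.sum_congr rfl fun a' _ => ?_
    rw [← sgn_add, mul_assoc]
    congr 2
    have : ∀ w y z x : ZMod 2, w * (y + z + w) + w * (x + z) = w * (y + x + w) := by decide
    exact this _ _ _ _
  rw [div, mul_smul_comm]
  congr 1
  simp only [Finset.mul_sum, mul_smul_comm, hP _ _, Finset.smul_sum, smul_smul, ← sgn_add]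
  have h3 : ∑ a, ∑ b, sgn (par b * (ε + par a + par b)) • c.d h b (ρ * (T a b * c.d h a f)) =
      ∑ b, c.d h b (ρ * ∑ a, sgn (par b * (ε + par a + par b)) • (T a b * c.d h a f)) := by
    rw [Finset.sum_comm]
    simp only [Finset.mul_sum, d_sum, mul_smul_comm, d_smul]
  rw [h3]
  simp only [← key, Finset.mul_sum, d_sum, mul_smul_comm, d_smul, hρ.left_comm]
  rw [Finset.sum_comm (s := Finset.univ (α := Idx p q)) (t := Finset.univ (α := Idx p q))
    (f := fun b a' => ∑ b', _ • c.d h b (_ * (_ * (ρ * c'.d h' a' f))))]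
  exact Finset.sum_congr rfl fun a' _ => Finset.sum_comm

/-- The anomaly formula. After multiplication by r both sides are compared with the divergence of r²
T ∂f. The only mismatch is in the cross terms T ∂r ∂f with a and b exchanged, which agree because T
is symmetric. -/
theorem div_mul_of_isPiola {r : M.Fun W} (hr : M.HasParity 0 r) (hu : IsUnit r)
    (hP : c.IsPiola c' h h' (r * r))
    (hT : ∀ a b, M.HasParity (ε + par a + par b) (T a b))
    (hsymm : ∀ a b, T a b = sgn (par a * par b) • T b a)
    (hT' : ∀ a b, M.HasParity (ε + par a + par b) (T' a b))
    (htr : ∀ a' b', T' a' b' = ∑ a, ∑ b, sgn (par b * (par a + par a')) •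
      (T a b * c.jac c' h h' a a' * c.jac c' h h' b b')) (f : M.Fun W) :
    c.div h ε T (r * f) = r * c'.div h' ε T' f + c.div h ε T r * f := by
  refine hu.mul_left_cancel ?_
  rw [mul_add, ← mul_assoc r r, c.mul_div_eq_of_isPiola c' h h' ((hr.mul hr).cast (add_zero 0)) hP
    hT' htr]
  simp only [div, smul_mul_assoc, mul_smul_comm, ← smul_add]
  congr 1
  simp only [Finset.mul_sum, Finset.sum_mul]
  have hsw : ∑ a, ∑ b, sgn (par a * par b) • (r * (T a b * c.d h a r * c.d h b f)) =
      ∑ a, ∑ b, r * (T a b * c.d h b r * c.d h a f) := by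
    rw [Finset.sum_comm]
    refine Finset.sum_congr rfl fun a _ => Finset.sum_congr rfl fun b _ => ?_
    rw [hsymm a b, smul_mul_assoc, smul_mul_assoc, mul_smul_comm, mul_comm (par b)]
  have h1 : ∀ a b, r * sgn (par b * (ε + par a + par b)) • c.d h b (T a b * c.d h a (r * f)) =
      sgn (par b * (ε + par a + par b)) • (r * c.d h b (T a b * c.d h a r) * f) +
      (sgn (par a * par b) • (r * (T a b * c.d h a r * c.d h b f)) +
      sgn (par b * (ε + par a + par b)) • (r * c.d h b (r * (T a b * c.d h a f)))) := by
    intro a b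
    rw [c.d_mul_of_hasParity h a hr, mul_zero, sgn_zero, one_smul, mul_add (T a b),
      ← mul_assoc (T a b), ← hr.left_comm, d_add,
      c.d_mul_of_hasParity h b ((hT a b).mul (c.hasParity_d h a hr)), mul_smul_comm,
      mul_add r, mul_add r, smul_add, smul_add, mul_smul_comm, smul_smul, ← sgn_add,
      add_assoc (sgn _ • _), mul_assoc r]
    congr 4
    have : ∀ x y z : ZMod 2, x * (y + z + x) + x * (y + z + x + (z + 0)) = z * x := by decide
    exact this _ _ _
  have h2 : ∀ a b, sgn (par b * (ε + par a + par b)) • c.d h b (r * r * (T a b * c.d h a f)) =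
      r * (T a b * c.d h b r * c.d h a f) +
      sgn (par b * (ε + par a + par b)) • (r * c.d h b (r * (T a b * c.d h a f))) := by
    intro a b
    rw [mul_assoc r r, c.d_mul_of_hasParity h b hr, mul_zero, sgn_zero, one_smul, smul_add,
      ← hr.left_comm, ← mul_assoc (c.d h b r), (c.hasParity_d h b hr).comm (hT a b), smul_mul_assoc,
      mul_smul_comm, smul_smul, add_zero, sgn_mul_self, one_smul]
  simp only [h1, h2, Finset.sum_add_distrib, hsw]
  simp only [mul_smul_comm, smul_mul_assoc, mul_assoc]
  abel

/-- Integration by parts. -/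
theorem exists_div_mul_eq (hT : ∀ a b, M.HasParity (ε + par a + par b) (T a b))
    (hsymm : ∀ a b, T a b = sgn (par a * par b) • T b a) {δ : ZMod 2} {f : M.Fun W}
    (hf : M.HasParity δ f) (g : M.Fun W) : ∃ Y : Idx p q → M.Fun W,
      c.div h ε T f * g = sgn (ε * δ) • (f * c.div h ε T g) + ∑ b, c.d h b (Y b) ∧
      ∀ (V : Opens M.space) (hV : V ≤ W), M.res hV f = 0 → ∀ b, M.res hV (Y b) = 0 := by
  -- Green's vector field T ∂f · g ∓ f · T ∂g. Each term contains f or a derivative of f, so it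
  -- vanishes wherever f does.
  refine ⟨fun b => (1 / 2 : ℝ) • ∑ a, (sgn (par b * (ε + par a + par b)) •
    (T a b * c.d h a f * g) - sgn (ε * δ + (par b * (ε + par a + par b) + par b * δ)) •
      (f * (T a b * c.d h a g))), ?_, ?_⟩
  -- Symmetry of T makes the two terms with one derivative on each of f and g cancel.
  · have hsw : ∑ a, ∑ b, sgn (par a * par b + par b * δ) • (T a b * c.d h a f * c.d h b g) =
        ∑ a, ∑ b, sgn (par a * δ) • (T a b * c.d h b f * c.d h a g) := by
      rw [Finset.sum_comm]
      refine Finset.sum_congr rfl fun a _ => Finset.sum_congr rfl fun b _ => ?_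
      rw [hsymm a b, smul_mul_assoc, smul_mul_assoc, smul_smul, mul_comm (par b), add_comm, sgn_add]
    have h1 : ∀ a b, sgn (par b * (ε + par a + par b)) • c.d h b (T a b * c.d h a f * g) =
        sgn (par b * (ε + par a + par b)) • (c.d h b (T a b * c.d h a f) * g) +
        sgn (par a * par b + par b * δ) • (T a b * c.d h a f * c.d h b g) := by
      intro a b
      rw [c.d_mul_of_hasParity h b ((hT a b).mul (c.hasParity_d h a hf)), smul_add, smul_smul,
        ← sgn_add]
      congr 3
      have : ∀ x y z w : ZMod 2, x * (y + z + x) + x * (y + z + x + (z + w)) = z * x + x * w := by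
        decide
      exact this _ _ _ _
    have h2 : ∀ a b, sgn (ε * δ + (par b * (ε + par a + par b) + par b * δ)) •
        c.d h b (f * (T a b * c.d h a g)) = sgn (par a * δ) • (T a b * c.d h b f * c.d h a g) +
        sgn (ε * δ) • sgn (par b * (ε + par a + par b)) • (f * c.d h b (T a b * c.d h a g)) := by
      intro a b
      rw [c.d_mul_of_hasParity h b hf, smul_add, smul_smul, ← mul_assoc (c.d h b f),
        (c.hasParity_d h b hf).comm (hT a b), smul_mul_assoc, smul_smul, smul_smul, ← sgn_add,
        ← sgn_add, ← sgn_add]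
      congr 3
      · have : ∀ x y z w : ZMod 2, y * w + (x * (y + z + x) + x * w) + (x + w) * (y + z + x) =
          z * w := by decide
        exact this _ _ _ _
      · have : ∀ x y z w : ZMod 2, y * w + (x * (y + z + x) + x * w) + x * w =
          y * w + x * (y + z + x) := by decide
        exact this _ _ _ _
    simp only [d_smul, d_sum, d_sub, h1, h2, ← Finset.smul_sum]
    rw [Finset.sum_comm]
    simp only [Finset.sum_sub_distrib, Finset.sum_add_distrib, hsw, div]
    rw [smul_mul_assoc, mul_smul_comm, smul_comm (sgn (ε * δ)) (1 / 2 : ℝ), ← smul_add]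
    congr 1
    simp only [smul_mul_assoc, mul_smul_comm, Finset.mul_sum, Finset.sum_mul, Finset.smul_sum]
    abel
  · intro V hV hz b
    simp only [map_smul, map_sum, map_sub, map_mul, ← c.d_res h hV, hz, d_zero, mul_zero, zero_mul,
      smul_zero, sub_zero, Finset.sum_const_zero]

end Chart

end

section

/-! ### Supports and integrals -/

namespace SuperRingedSpace

variable {M : SuperRingedSpace.{u}} {U : Opens M.space} {K : Set M.space} {f g : M.Fun U}

/-- The superfunction `f` vanishes on the complement of `K`. -/
def VanishesOff (M : SuperRingedSpace.{u}) {U : Opens M.space} (K : Set M.space) (f : M.Fun U) :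
    Prop :=
  ∀ (W : Opens M.space) (h : W ≤ U), Disjoint (W : Set M.space) K → M.res h f = 0

namespace VanishesOff

theorem add (hf : M.VanishesOff K f) (hg : M.VanishesOff K g) : M.VanishesOff K (f + g) :=
  fun W h hW => by rw [map_add, hf W h hW, hg W h hW, add_zero]

theorem smul (r : ℝ) (hf : M.VanishesOff K f) : M.VanishesOff K (r • f) :=
  fun W h hW => by rw [map_smul, hf W h hW, smul_zero]

theorem mul_right (hf : M.VanishesOff K f) (g : M.Fun U) : M.VanishesOff K (f * g) :=
  fun W h hW => by rw [map_mul, hf W h hW, zero_mul]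

theorem mul_left (hf : M.VanishesOff K f) (g : M.Fun U) : M.VanishesOff K (g * f) :=
  fun W h hW => by rw [map_mul, hf W h hW, mul_zero]

theorem sum {ι : Type*} {s : Finset ι} {f : ι → M.Fun U} (hf : ∀ i ∈ s, M.VanishesOff K (f i)) :
    M.VanishesOff K (∑ i ∈ s, f i) :=
  fun W h hW => by rw [map_sum, Finset.sum_eq_zero fun i hi => hf i hi W h hW]

theorem d (c : Chart p q M) (h : U ≤ c.dom) (a : Idx p q) (hf : M.VanishesOff K f) :
    M.VanishesOff K (c.d h a f) :=
  fun W hW hd => by rw [← c.d_res h hW, hf W hW hd, Chart.d_zero]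

end VanishesOff

end SuperRingedSpace

open SuperRingedSpace

namespace Chart

variable {M : SuperRingedSpace.{u}} (c : Chart p q M) {K : Set M.space} {f g : M.Fun c.dom}

theorem isCompact_image (hK : IsCompact K) (hKc : K ⊆ c.dom) :
    IsCompact (c.φ '' (K ∩ c.dom)) := by
  rw [Set.inter_eq_left.2 hKc]
  exact hK.image_of_continuousOn (c.φ.continuousOn.mono hKc)

theorem image_subset : c.φ '' (K ∩ c.dom) ⊆ imageOpens c.φ c.dom le_rfl :=
  Set.image_mono Set.inter_subset_right

theorem integral_eq (h : c.dom ≤ c.dom) (f : M.Fun c.dom) :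
    c.integral f = SuperFun.berezin (c.equiv c.dom h f) := rfl

theorem integral_smul (r : ℝ) (f : M.Fun c.dom) : c.integral (r • f) = r * c.integral f := by
  rw [integral, map_smul]
  exact SuperFun.berezin_smul r _

variable [T2Space M.space]

theorem integral_add (hK : IsCompact K) (hKc : K ⊆ c.dom) (hf : M.VanishesOff K f)
    (hg : M.VanishesOff K g) : c.integral (f + g) = c.integral f + c.integral g := by
  rw [integral, map_add]
  exact SuperFun.berezin_add ((c.vanishesOff_iff hK.isClosed f).2 hf)
    ((c.vanishesOff_iff hK.isClosed g).2 hg) (c.isCompact_image hK hKc) c.image_subset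

theorem integral_sub (hK : IsCompact K) (hKc : K ⊆ c.dom) (hf : M.VanishesOff K f)
    (hg : M.VanishesOff K g) : c.integral (f - g) = c.integral f - c.integral g := by
  have h1 : f - g = f + (-1 : ℝ) • g := by rw [neg_smul, one_smul, sub_eq_add_neg]
  rw [h1, c.integral_add hK hKc hf (hg.smul _), integral_smul]
  ring

theorem integral_d (hK : IsCompact K) (hKc : K ⊆ c.dom) (hf : M.VanishesOff K f) (a : Idx p q) :
    c.integral (c.d le_rfl a f) = 0 := by
  rw [c.integral_eq le_rfl, equiv_d]
  exact SuperFun.berezin_d ((c.vanishesOff_iff hK.isClosed f).2 hf) (c.isCompact_image hK hKc)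
    c.image_subset a

theorem integral_add_sum_d (hK : IsCompact K) (hKc : K ⊆ c.dom) (hf : M.VanishesOff K f)
    {Y : Idx p q → M.Fun c.dom} (hY : ∀ b, M.VanishesOff K (Y b)) :
    c.integral (f + ∑ b, c.d le_rfl b (Y b)) = c.integral f := by
  suffices h : ∀ s : Finset (Idx p q),
      c.integral (f + ∑ b ∈ s, c.d le_rfl b (Y b)) = c.integral f from h _
  intro s
  induction s using Finset.induction_on with
  | empty => rw [Finset.sum_empty, add_zero]
  | insert b s hb ih =>
    rw [Finset.sum_insert hb, add_left_comm, c.integral_add hK hKc ((hY b).d c le_rfl b)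
      (hf.add (VanishesOff.sum fun b _ => (hY b).d c le_rfl b)), ih, c.integral_d hK hKc (hY b),
      zero_add]

/-- Test functions: even functions with compact support in the coordinate domain. -/
theorem exists_vanishesOff_ofReal {χ : (Fin p → ℝ) → ℝ} (hχ : ContDiff ℝ ∞ χ)
    (hc : HasCompactSupport χ) (hs : tsupport χ ⊆ imageOpens c.φ c.dom le_rfl) :
    ∃ K : Set M.space, IsCompact K ∧ K ⊆ c.dom ∧ M.VanishesOff K (c.ofReal le_rfl χ hχ) := by
  have hs' : tsupport χ ⊆ c.φ.target := fun y hy => by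
    obtain ⟨x, hx, rfl⟩ := hs hy
    exact c.φ.map_source hx
  have hK : IsCompact (c.φ.symm '' tsupport χ) :=
    hc.isCompact.image_of_continuousOn (c.φ.symm.continuousOn.mono hs')
  have hKc : c.φ.symm '' tsupport χ ⊆ c.dom := by
    rintro _ ⟨y, hy, rfl⟩
    exact c.φ.map_target (hs' hy)
  refine ⟨_, hK, hKc, (c.vanishesOff_iff hK.isClosed _).1 fun y hy => ?_⟩
  have h0 : χ y = 0 := by
    by_contra h
    have hyt : (y : Fin p → ℝ) ∈ tsupport χ := subset_tsupport _ h
    exact hy ⟨c.φ.symm y, ⟨Set.mem_image_of_mem _ hyt, hKc (Set.mem_image_of_mem _ hyt)⟩,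
      c.φ.right_inv (hs' hyt)⟩
  have h2 := congrFun (congrArg Subtype.val (c.equiv_ofReal le_rfl χ hχ)) y
  rw [SuperFun.ofReal_apply, h0, map_zero] at h2
  exact h2

/-- Both test factors have compact support, since both must extend from the chart to half-densities
on M. One factor is used as a cutoff χ to get fχ = 0 by duality, and then χ = 1 at the given point.
-/
theorem eq_zero_of_integral
    (h : ∀ (f₁ f₂ : M.Fun c.dom) (K₁ K₂ : Set M.space), IsCompact K₁ → K₁ ⊆ c.dom →
      M.VanishesOff K₁ f₁ → M.HasParity 0 f₁ → IsCompact K₂ → K₂ ⊆ c.dom → M.VanishesOff K₂ f₂ →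
      c.integral (f * f₁ * f₂) = 0) : f = 0 := by
  refine (c.equiv c.dom le_rfl).injective ?_
  rw [map_zero]
  have h1 : ∀ (χ : (Fin p → ℝ) → ℝ) (hχ : ContDiff ℝ ∞ χ), HasCompactSupport χ →
      tsupport χ ⊆ imageOpens c.φ c.dom le_rfl →
      c.equiv c.dom le_rfl f * SuperFun.ofReal _ χ hχ.contDiffOn = 0 := by
    intro χ hχ hc hs
    refine SuperFun.eq_zero_of_berezin fun χ' hχ' hc' hs' I => ?_
    obtain ⟨K, hK, hKc, hv⟩ := c.exists_vanishesOff_ofReal hχ hc hs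
    obtain ⟨K', hK', hKc', hv'⟩ := c.exists_vanishesOff_ofReal hχ' hc' hs'
    have := h _ (c.ofReal le_rfl χ' hχ' *
      (c.equiv c.dom le_rfl).symm ⟨fun _ => monomial q I, IsSmooth.const _⟩) K K' hK hKc hv
      (c.hasParity_ofReal _ _ _) hK' hKc' (hv'.mul_right _)
    rw [c.integral_eq le_rfl, map_mul, map_mul, map_mul, equiv_ofReal, equiv_ofReal,
      AlgEquiv.apply_symm_apply] at this
    exact this
  refine Subtype.ext (funext fun y => ?_)
  obtain ⟨χ, hχ, hc, hs, -, h1y⟩ := exists_cutoff (imageOpens c.φ c.dom le_rfl).isOpen y.2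
  have h2 := congrFun (congrArg Subtype.val (h1 χ hχ hc hs)) y
  change (c.equiv c.dom le_rfl f).1 y * algebraMap ℝ _ (χ y) = 0 at h2
  rwa [h1y.self_of_nhds, map_one, mul_one] at h2

end Chart

end

section

/-! ### Half-densities and functions -/

open SuperRingedSpace

theorem SuperRingedSpace.HasParity.of_mul_eq_one {M : SuperRingedSpace.{u}} {U : Opens M.space}
    {f g : M.Fun U} (hf : M.HasParity 0 f) (h : g * f = 1) : M.HasParity 0 g := by
  have h1 : M.inv U g * f = 1 := by
    have := congrArg (M.inv U) h
    rwa [map_mul, hf.eq, sgn_zero, one_smul, map_one] at this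
  have h2 : f * g = 1 := by rw [hf.commute, h]
  rw [HasParity, sgn_zero, one_smul]
  exact left_inv_eq_right_inv h1 h2

namespace HalfDensity

variable {M : Supermanifold.{u} p q}

theorem exists_inverse {σ : HalfDensity M} (hσ : HasParity 0 σ)
    (hpos : ∀ (c : Coords M) (x : c.dom), 0 < c.bodyHom le_rfl x (σ.1 c)) :
    ∃ τ : ∀ c : Coords M, M.Fun c.dom, ∀ c, M.HasParity 0 (τ c) ∧ τ c * σ.1 c = 1 := by
  have : ∀ c : Coords M, ∃ t, t * σ.1 c = 1 := fun c =>
    ((c.isUnit_iff le_rfl (σ.1 c)).2 fun x => (hpos c x).ne').exists_left_inv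
  choose τ hτ using this
  exact ⟨τ, fun c => ⟨(hσ c).of_mul_eq_one (hτ c), hτ c⟩⟩

variable {σ : HalfDensity M} {τ : ∀ c : Coords M, M.Fun c.dom}

theorem mul_inverse (hσ : HasParity 0 σ) (hτ : ∀ c, M.HasParity 0 (τ c) ∧ τ c * σ.1 c = 1)
    (s : HalfDensity M) (c : Coords M) : σ.1 c * (τ c * s.1 c) = s.1 c := by
  rw [← mul_assoc, (hσ c).commute, (hτ c).2, one_mul]

/-- The transition factors of s and σ are the same, so they cancel in s/σ. -/
theorem inverse_mul_res (hσ : HasParity 0 σ) (hτ : ∀ c, M.HasParity 0 (τ c) ∧ τ c * σ.1 c = 1)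
    (s : HalfDensity M) (c c' : Coords M) {W : Opens M.space} (h : W ≤ c.dom) (h' : W ≤ c'.dom) :
    M.res h (τ c * s.1 c) = M.res h' (τ c' * s.1 c') := by
  have hu : IsUnit (M.res h (σ.1 c)) := by
    have h1 : IsUnit (σ.1 c) :=
      isUnit_iff_exists.2 ⟨τ c, by rw [(hσ c).commute, (hτ c).2], (hτ c).2⟩
    exact h1.map (M.res h)
  refine hu.mul_left_cancel ?_
  rw [← map_mul, mul_inverse hσ hτ, res_eq c c' h h' σ, res_eq c c' h h' s,
    ← mul_inverse hσ hτ s c', map_mul, mul_assoc, mul_assoc, (hasParity_even _).commute]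
  rw [mul_inverse hσ hτ s c']

/-- The quotient of a half-density by a positive half-density is a function. -/
theorem exists_quotient (hσ : HasParity 0 σ) (hτ : ∀ c, M.HasParity 0 (τ c) ∧ τ c * σ.1 c = 1)
    (s : HalfDensity M) : ∃ F : M.Fun ⊤, ∀ c, M.res le_top F = τ c * s.1 c :=
  exists_glue (fun c : Coords M => c.dom) (fun _ => le_top)
    (fun x _ => (M.exists_chart x)) (fun c => τ c * s.1 c)
    fun c c' => inverse_mul_res hσ hτ s c c' inf_le_left inf_le_right

/-- The parity involution of half-densities. -/
theorem exists_invol (s : HalfDensity M) : ∃ t : HalfDensity M, ∀ c, t.1 c = M.inv _ (s.1 c) :=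
  ⟨⟨fun c => M.inv _ (s.1 c), fun c c' => by
    rw [← inv_res, s.2 c c', map_mul, inv_res]
    congr 1
    exact Subtype.prop (c.sqrtAbsBer c' _ _)⟩, fun _ => rfl⟩

theorem homogeneous_induction {P : HalfDensity M → Prop} (s : HalfDensity M)
    (hom : ∀ δ (t : HalfDensity M), HasParity δ t → P t) (add : ∀ t t', P t → P t' → P (t + t')) :
    P s := by
  obtain ⟨t, ht⟩ := exists_invol s
  have h : s = (1 / 2 : ℝ) • (s + t) + (1 / 2 : ℝ) • (s - t) := by
    rw [← smul_add, add_add_sub_cancel, ← two_smul ℝ s, smul_smul]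
    norm_num
  rw [h]
  refine add _ _ (hom 0 _ fun c => ?_) (hom 1 _ fun c => ?_)
  · change M.HasParity 0 ((1 / 2 : ℝ) • (s.1 c + t.1 c))
    rw [ht]
    exact hasParity_evenPart _
  · change M.HasParity 1 ((1 / 2 : ℝ) • (s.1 c - t.1 c))
    rw [ht]
    exact hasParity_oddPart _

end HalfDensity

/-! ### Existence -/

variable {M : Supermanifold.{u} p q} {ε : ZMod 2} (S : SymTensor M ε)

namespace SymTensor

theorem div_mul (c c' : Coords M) (f : M.Fun (c.dom ⊓ c'.dom)) :
    c.div inf_le_left ε (fun a b => M.res inf_le_left (S.comp c a b))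
        ((c.sqrtAbsBer c' inf_le_left inf_le_right : M.Fun (c.dom ⊓ c'.dom)) * f) =
      (c.sqrtAbsBer c' inf_le_left inf_le_right : M.Fun (c.dom ⊓ c'.dom)) *
        c'.div inf_le_right ε (fun a b => M.res inf_le_right (S.comp c' a b)) f +
      c.div inf_le_left ε (fun a b => M.res inf_le_left (S.comp c a b))
        (c.sqrtAbsBer c' inf_le_left inf_le_right : M.Fun (c.dom ⊓ c'.dom)) * f := by
  refine c.div_mul_of_isPiola c' _ _ (hasParity_even _)
    ((c.isUnit_sqrtAbsBer c' _ _).map (M.evenVal _)) ?_ (fun a b => (S.parity c a b).res _)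
    (fun a b => ?_) (fun a b => (S.parity c' a b).res _) (fun a b => S.transform c c' a b) f
  · have := c.isPiola_sqrtAbsBer c' (W := c.dom ⊓ c'.dom) inf_le_left inf_le_right
    rwa [coe_pow, pow_two] at this
  · rw [← map_smul, ← S.symm c a b]

variable {σ : HalfDensity M} {τ : ∀ c : Coords M, M.Fun c.dom}

/-- Changing coordinates adds D(r) s' to D s and D(r) σ' to Dσ. After multiplication of the latter
by s/σ the two anomalies coincide and drop out of the difference. -/
theorem op_mem (hσ : HalfDensity.HasParity 0 σ)
    (hτ : ∀ c, M.HasParity 0 (τ c) ∧ τ c * σ.1 c = 1) (s : HalfDensity M) :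
    (fun c : Coords M => c.div le_rfl ε (S.comp c) (s.1 c) -
      c.div le_rfl ε (S.comp c) (σ.1 c) * (τ c * s.1 c)) ∈ HalfDensity M := by
  intro c c'
  have hr := hasParity_even (c.sqrtAbsBer c' (W := c.dom ⊓ c'.dom) inf_le_left inf_le_right)
  have h1 : ∀ t : HalfDensity M, M.res inf_le_left (c.div le_rfl ε (S.comp c) (t.1 c)) =
      (c.sqrtAbsBer c' inf_le_left inf_le_right : M.Fun (c.dom ⊓ c'.dom)) *
        M.res inf_le_right (c'.div le_rfl ε (S.comp c') (t.1 c')) +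
      c.div inf_le_left ε (fun a b => M.res inf_le_left (S.comp c a b))
        (c.sqrtAbsBer c' inf_le_left inf_le_right : M.Fun (c.dom ⊓ c'.dom)) *
        M.res inf_le_right (t.1 c') := by
    intro t
    rw [c.div_res le_rfl inf_le_left, t.2 c c', ← hr.commute, S.div_mul,
      c'.div_res le_rfl inf_le_right]
  have h2 := HalfDensity.inverse_mul_res hσ hτ s c c' (W := c.dom ⊓ c'.dom) inf_le_left inf_le_right
  have h3 := congrArg (M.res (inf_le_right : c.dom ⊓ c'.dom ≤ c'.dom))
    (HalfDensity.mul_inverse hσ hτ s c')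
  rw [map_mul] at h3
  simp only [map_sub]
  rw [map_mul (M.res inf_le_left), h1, h1, h2, add_mul, mul_assoc _ (M.res _ (σ.1 c')), h3,
    sub_mul, ← hr.commute, ← hr.commute]
  simp only [map_mul, mul_assoc]
  abel

/-- The operator with principal symbol `S` which is determined by a half-density. -/
def op (hσ : HalfDensity.HasParity 0 σ) (hτ : ∀ c, M.HasParity 0 (τ c) ∧ τ c * σ.1 c = 1) :
    Module.End ℝ (HalfDensity M) where
  toFun s := ⟨_, S.op_mem hσ hτ s⟩
  map_add' s t := Subtype.ext (funext fun c => by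
    change c.div le_rfl ε (S.comp c) (s.1 c + t.1 c) -
      c.div le_rfl ε (S.comp c) (σ.1 c) * (τ c * (s.1 c + t.1 c)) =
      c.div le_rfl ε (S.comp c) (s.1 c) - c.div le_rfl ε (S.comp c) (σ.1 c) * (τ c * s.1 c) +
      (c.div le_rfl ε (S.comp c) (t.1 c) - c.div le_rfl ε (S.comp c) (σ.1 c) * (τ c * t.1 c))
    rw [Chart.div_add, mul_add, mul_add]
    abel)
  map_smul' r s := Subtype.ext (funext fun c => by
    change c.div le_rfl ε (S.comp c) (r • s.1 c) -
      c.div le_rfl ε (S.comp c) (σ.1 c) * (τ c * (r • s.1 c)) =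
      r • (c.div le_rfl ε (S.comp c) (s.1 c) -
        c.div le_rfl ε (S.comp c) (σ.1 c) * (τ c * s.1 c))
    rw [Chart.div_smul, mul_smul_comm, mul_smul_comm, smul_sub])

theorem op_apply (hσ : HalfDensity.HasParity 0 σ)
    (hτ : ∀ c, M.HasParity 0 (τ c) ∧ τ c * σ.1 c = 1) (s : HalfDensity M) (c : Coords M) :
    (S.op hσ hτ s).1 c = c.div le_rfl ε (S.comp c) (s.1 c) -
      c.div le_rfl ε (S.comp c) (σ.1 c) * (τ c * s.1 c) := rfl

theorem op_mem_classF (hσ : HalfDensity.HasParity 0 σ)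
    (hτ : ∀ c, M.HasParity 0 (τ c) ∧ τ c * σ.1 c = 1) : S.op hσ hτ ∈ classF S := by
  have hD : ∀ c : Coords M, M.HasParity ε (c.div le_rfl ε (S.comp c) (σ.1 c)) := fun c =>
    (c.hasParity_div le_rfl (S.parity c) (hσ c)).cast (add_zero ε)
  refine ⟨fun c => ⟨fun a => (1 / 2 : ℝ) • ∑ b, sgn (par b * (ε + par a + par b)) •
      c.d le_rfl b (S.comp c a b), -(c.div le_rfl ε (S.comp c) (σ.1 c) * τ c), fun s => ?_⟩,
    fun δ s hs c => ?_, fun c δ s₁ s₂ hs₁ hK => ?_⟩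
  · rw [op_apply, c.div_eq le_rfl (S.parity c) (s.1 c), neg_mul, mul_assoc, sub_eq_add_neg]
  · rw [op_apply]
    refine (c.hasParity_div le_rfl (S.parity c) (hs c)).sub (((hD c).mul
      ((hτ c).1.mul (hs c))).cast ?_)
    rw [zero_add]
  · obtain ⟨K, hK, hKc, hv⟩ := hK
    have := M.t2
    have hv' : M.VanishesOff K (s₁.1 c) := hv c
    obtain ⟨Y, hY, hY0⟩ := c.exists_div_mul_eq le_rfl (S.parity c) (S.symm c) (hs₁ c) (s₂.1 c)
    have h1 : (S.op hσ hτ s₁).1 c * s₂.1 c =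
        sgn (ε * δ) • (s₁.1 c * (S.op hσ hτ s₂).1 c) + ∑ b, c.d le_rfl b (Y b) := by
      -- The potential Dσ/σ has parity ε, so it passes s₁ with exactly the sign required by
      -- self-adjointness. The rest is a sum of derivatives of compactly supported functions.
      have hu := ((hD c).mul (hτ c).1).cast (add_zero ε)
      rw [op_apply, op_apply, sub_mul, mul_sub, smul_sub, hY, ← mul_assoc _ (τ c) (s₁.1 c),
        hu.comm (hs₁ c), smul_mul_assoc, mul_assoc (s₁.1 c), mul_assoc _ (τ c) (s₂.1 c)]
      abel
    rw [pairing, pairing, h1, c.integral_add_sum_d hK hKc ((hv'.mul_right _).smul _)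
      fun b W hW hd => hY0 W hW (hv' W hW hd) b, Chart.integral_smul]

end SymTensor

theorem classF_nonempty : (classF S).Nonempty := by
  obtain ⟨σ, hσ, hpos⟩ := M.exists_positive
  obtain ⟨τ, hτ⟩ := HalfDensity.exists_inverse hσ hpos
  exact ⟨_, S.op_mem_classF hσ hτ⟩

/-! ### Adding functions -/

variable {S}

/-- Operators with a symbol do not enlarge supports. This keeps the integrands compactly supported,
as additivity of the integral requires. -/
theorem HasSymbol.vanishesOff {Δ : Module.End ℝ (HalfDensity M)} (hΔ : HasSymbol S Δ)
    {s : HalfDensity M} {c : Coords M} {K : Set M.space} (hs : M.VanishesOff K (s.1 c)) :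
    M.VanishesOff K ((Δ s).1 c) := by
  obtain ⟨L, U, h⟩ := hΔ c
  rw [h]
  exact ((VanishesOff.smul _ (VanishesOff.sum fun a _ => VanishesOff.sum fun b _ =>
    ((hs.d c le_rfl a).d c le_rfl b).mul_left _)).add
    (VanishesOff.sum fun a _ => (hs.d c le_rfl a).mul_left _)).add (hs.mul_left _)

theorem add_mulOp_mem_classF {Δ : Module.End ℝ (HalfDensity M)} (hΔ : Δ ∈ classF S)
    {F : M.Fun ⊤} (hF : M.HasParity ε F) : Δ + mulOp F ∈ classF S := by
  have happ : ∀ (s : HalfDensity M) (c : Coords M),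
      ((Δ + mulOp F) s).1 c = (Δ s).1 c + M.res le_top F * s.1 c := fun _ _ => rfl
  obtain ⟨h1, h2, h3⟩ := hΔ
  refine ⟨fun c => ?_, fun δ s hs c => ?_, fun c δ s₁ s₂ hs₁ hK => ?_⟩
  · obtain ⟨L, U, h⟩ := h1 c
    refine ⟨L, U + M.res le_top F, fun s => ?_⟩
    rw [happ, h, add_mul, add_assoc]
  · rw [happ]
    exact (h2 δ s hs c).add ((hF.res _).mul (hs c))
  · have h4 := h3 c δ s₁ s₂ hs₁ hK
    obtain ⟨K, hK, hKc, hv⟩ := hK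
    have := M.t2
    have hv' : M.VanishesOff K (s₁.1 c) := hv c
    rw [pairing, pairing] at h4 ⊢
    rw [happ, happ, add_mul, mul_add, c.integral_add hK hKc ((h1.vanishesOff hv').mul_right _)
      ((hv'.mul_left _).mul_right _), c.integral_add hK hKc (hv'.mul_right _) (hv'.mul_right _),
      h4, (hF.res _).comm (hs₁ c), smul_mul_assoc, Chart.integral_smul, mul_assoc, mul_add]

end

section

/-! ### Uniqueness -/

open SuperRingedSpace

namespace SuperRingedSpace

variable {M : SuperRingedSpace.{u}} {U : Opens M.space}

/-- The projection to the component of parity `α`. -/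
def proj (α : ZMod 2) (f : M.Fun U) : M.Fun U := (1 / 2 : ℝ) • (f + sgn α • M.inv U f)

theorem hasParity_proj (α : ZMod 2) (f : M.Fun U) : M.HasParity α (proj α f) := by
  rw [HasParity, proj, map_smul, map_add, map_smul, inv_inv, smul_comm (sgn α) (1 / 2 : ℝ),
    smul_add (sgn α), smul_smul (sgn α), sgn_mul_self, one_smul, add_comm]

theorem HasParity.proj_eq {α : ZMod 2} {f : M.Fun U} (hf : M.HasParity α f) : proj α f = f := by
  rw [proj, hf.eq, smul_smul, sgn_mul_self, one_smul, ← two_smul ℝ f, smul_smul]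
  norm_num

theorem proj_add (α : ZMod 2) (f g : M.Fun U) : proj α (f + g) = proj α f + proj α g := by
  rw [proj, proj, proj, map_add, smul_add (sgn α), ← smul_add (1 / 2 : ℝ), add_add_add_comm]

theorem proj_sum {ι : Type*} (α : ZMod 2) (s : Finset ι) (f : ι → M.Fun U) :
    proj α (∑ i ∈ s, f i) = ∑ i ∈ s, proj α (f i) := by
  simp only [proj, map_sum, Finset.smul_sum, ← Finset.sum_add_distrib]

theorem HasParity.proj_mul {β γ : ZMod 2} {g : M.Fun U} (hg : M.HasParity β g) (α : ZMod 2)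
    (f : M.Fun U) (h : γ = α + β) : proj γ (f * g) = proj α f * g := by
  rw [proj, proj, h, map_mul, hg.eq, mul_smul_comm, smul_smul, sgn_add, mul_assoc, sgn_mul_self,
    mul_one, smul_mul_assoc, add_mul, smul_mul_assoc]

end SuperRingedSpace

variable {M : Supermanifold.{u} p q} {ε : ZMod 2} {X : Module.End ℝ (HalfDensity M)}

/-- `X` is a differential operator of first order in the coordinate system `c`. -/
def IsFirstOrder (c : Coords M) (X : Module.End ℝ (HalfDensity M)) (L : Idx p q → M.Fun c.dom)
    (U : M.Fun c.dom) : Prop :=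
  ∀ s : HalfDensity M, (X s).1 c = ∑ a, L a * c.d le_rfl a (s.1 c) + U * s.1 c

/-- The local coefficients of an operator come without parity. As X shifts parity by ε, applying the
parity projection to the identity for homogeneous s replaces each coefficient by its component of
the right parity. -/
theorem IsFirstOrder.exists_homogeneous {c : Coords M} {L : Idx p q → M.Fun c.dom}
    {U : M.Fun c.dom} (h : IsFirstOrder c X L U) (hX : OpHasParity ε X) :
    ∃ (L' : Idx p q → M.Fun c.dom) (U' : M.Fun c.dom), IsFirstOrder c X L' U' ∧
      (∀ a, M.HasParity (ε + par a) (L' a)) ∧ M.HasParity ε U' := by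
  refine ⟨fun a => proj (ε + par a) (L a), proj ε U, fun s => ?_, fun a => hasParity_proj _ _,
    hasParity_proj _ _⟩
  induction s using HalfDensity.homogeneous_induction with
  | hom δ s hs =>
    have h1 := (hX δ s hs c).proj_eq
    rw [h, proj_add, proj_sum, (hs c).proj_mul ε U rfl] at h1
    rw [h, ← h1]
    congr 1
    refine Finset.sum_congr rfl fun a _ => (c.hasParity_d le_rfl a (hs c)).proj_mul _ _ ?_
    have : ∀ x y z : ZMod 2, x + y = x + z + (z + y) := by decide
    exact this _ _ _
  | add s t hs ht =>
    have h1 : (X (s + t)).1 c = (X s).1 c + (X t).1 c := by rw [map_add]; rfl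
    have h2 : (s + t).1 c = s.1 c + t.1 c := rfl
    rw [h1, hs, ht, h2]
    simp only [Chart.d_add, mul_add, Finset.sum_add_distrib]
    abel

/-- The supercommutator of X with multiplication by x^a is multiplication by L^a. -/
theorem IsFirstOrder.mul_coord {c : Coords M} {L : Idx p q → M.Fun c.dom}
    {U : M.Fun c.dom} (h : IsFirstOrder c X L U) (hL : ∀ a, M.HasParity (ε + par a) (L a))
    (hU : M.HasParity ε U) (a : Idx p q) {s t : HalfDensity M}
    (hst : t.1 c = c.coord le_rfl a * s.1 c) :
    (X t).1 c = L a * s.1 c + sgn (ε * par a) • (c.coord le_rfl a * (X s).1 c) := by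
  have hx := c.hasParity_coord le_rfl a
  have h1 : ∀ b, L b * c.d le_rfl b (c.coord le_rfl a * s.1 c) =
      (if b = a then L a * s.1 c else 0) +
        sgn (ε * par a) • (c.coord le_rfl a * (L b * c.d le_rfl b (s.1 c))) := by
    intro b
    rw [c.d_mul_of_hasParity le_rfl b hx, c.d_coord, mul_add, mul_smul_comm,
      ← mul_assoc (L b) (c.coord le_rfl a), (hL b).comm hx, smul_mul_assoc, smul_smul, ← sgn_add,
      mul_assoc]
    congr 1
    · split_ifs with hb
      · rw [one_mul, hb]
      · rw [zero_mul, mul_zero]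
    · congr 2
      have : ∀ x y z : ZMod 2, x * y + (z + x) * y = z * y := by decide
      exact this _ _ _
  rw [h, h, hst]
  simp only [h1]
  rw [Finset.sum_add_distrib, Finset.sum_ite_eq' Finset.univ a, if_pos (Finset.mem_univ a),
    ← mul_assoc U, hU.comm hx, smul_mul_assoc, mul_add, smul_add, Finset.mul_sum, Finset.smul_sum,
    mul_assoc, add_assoc]

theorem IsFirstOrder.vanishesOff {c : Coords M} {L : Idx p q → M.Fun c.dom}
    {U : M.Fun c.dom} (h : IsFirstOrder c X L U) {s : HalfDensity M} {K : Set M.space}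
    (hs : M.VanishesOff K (s.1 c)) : M.VanishesOff K ((X s).1 c) := by
  rw [h]
  exact (VanishesOff.sum fun a _ => (hs.d c le_rfl a).mul_left _).add (hs.mul_left _)

/-- A self-adjoint first order operator is of order zero. -/
theorem IsFirstOrder.eq_zero {c : Coords M} {L : Idx p q → M.Fun c.dom}
    {U : M.Fun c.dom} (h : IsFirstOrder c X L U) (hL : ∀ a, M.HasParity (ε + par a) (L a))
    (hU : M.HasParity ε U) (hX : OpHasParity ε X) (hsa : IsSelfAdjoint ε X) (a : Idx p q) :
    L a = 0 := by
  have := M.t2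
  refine c.eq_zero_of_integral fun f₁ f₂ K₁ K₂ hK₁ hKc₁ hv₁ hp₁ hK₂ hKc₂ hv₂ => ?_
  obtain ⟨s₁, hs₁, hz₁, hps₁⟩ := HalfDensity.exists_extend c hK₁.isClosed hKc₁ f₁ hv₁
  obtain ⟨s₂, hs₂, -, -⟩ := HalfDensity.exists_extend c hK₂.isClosed hKc₂ f₂ hv₂
  -- The coordinate x^a exists only in the chart, so the products x^a f₁ and x^a f₂ are formed there
  -- and extended by zero.
  obtain ⟨t₁, ht₁, hzt₁, hpt₁⟩ := HalfDensity.exists_extend c hK₁.isClosed hKc₁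
    (c.coord le_rfl a * f₁) (hv₁.mul_left _)
  obtain ⟨t₂, ht₂, -, -⟩ := HalfDensity.exists_extend c hK₂.isClosed hKc₂
    (c.coord le_rfl a * f₂) (hv₂.mul_left _)
  have hx := c.hasParity_coord le_rfl a
  have e₁ := h.mul_coord hL hU a (ht₁.trans (by rw [hs₁]))
  have e₂ := h.mul_coord hL hU a (ht₂.trans (by rw [hs₂]))
  -- Self-adjointness with x^a in the first and then in the second argument. The commutator
  -- contributes +∫L^a f₁f₂ on the left in one and on the right in the other, while all other terms
  -- agree, so 2∫L^a f₁f₂ = 0.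
  have q₁ := hsa c (par a) t₁ s₂ (hpt₁ _ ((hx.mul hp₁).cast (add_zero _))) ⟨K₁, hK₁, hKc₁, hzt₁⟩
  have q₂ := hsa c 0 s₁ t₂ (hps₁ _ hp₁) ⟨K₁, hK₁, hKc₁, hz₁⟩
  have hvX : M.VanishesOff K₁ ((X s₁).1 c) := h.vanishesOff (by rw [hs₁]; exact hv₁)
  have hXp : M.HasParity ε ((X s₁).1 c) := (hX 0 s₁ (hps₁ _ hp₁) c).cast (add_zero ε)
  rw [pairing, pairing, e₁, hs₁, hs₂, ht₁, add_mul, c.integral_add hK₁ hKc₁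
    ((hv₁.mul_left _).mul_right _) (((hvX.mul_left _).smul _).mul_right _)] at q₁
  rw [pairing, pairing, e₂, hs₁, hs₂, ht₂, mul_add, c.integral_add hK₁ hKc₁
    (hv₁.mul_right _) (hv₁.mul_right _), mul_zero, sgn_zero, one_mul, hp₁.left_comm (L a),
    ← mul_assoc _ f₁ f₂] at q₂
  have e₃ : sgn (ε * par a) • (c.coord le_rfl a * (X s₁).1 c) = (X s₁).1 c * c.coord le_rfl a :=
    (hXp.comm hx).symm
  have e₄ : f₁ * sgn (ε * par a) • (c.coord le_rfl a * (X s₂).1 c) =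
      sgn (ε * par a) • (c.coord le_rfl a * f₁ * (X s₂).1 c) := by
    rw [mul_smul_comm, hp₁.left_comm, mul_assoc]
  rw [e₃, mul_assoc ((X s₁).1 c)] at q₁
  rw [e₄, Chart.integral_smul] at q₂
  linarith

/-- The function is Xσ/σ for a positive σ. Once the first order part is gone, X is multiplication by
some U in each chart, and evaluating on σ gives U = Xσ/σ. The same evaluation gives uniqueness. -/
theorem exists_eq_mulOp (hX : OpHasParity ε X) (hsa : IsSelfAdjoint ε X)
    (h : ∀ c, ∃ L U, IsFirstOrder c X L U) : ∃! F : M.Fun ⊤, M.HasParity ε F ∧ X = mulOp F := by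
  obtain ⟨σ, hσ, hpos⟩ := M.exists_positive
  obtain ⟨τ, hτ⟩ := HalfDensity.exists_inverse hσ hpos
  obtain ⟨F, hF⟩ := HalfDensity.exists_quotient hσ hτ (X σ)
  refine ⟨F, ⟨?_, LinearMap.ext fun s => Subtype.ext (funext fun c => ?_)⟩, ?_⟩
  · refine ext_of_cover (fun c : Coords M => c.dom) (fun _ => le_top)
      (fun x _ => M.exists_chart x) fun c => ?_
    rw [map_smul, ← inv_res, hF]
    exact (((hτ c).1.mul (hX 0 σ hσ c)).cast (by rw [zero_add, add_zero])).eq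
  · obtain ⟨L, U, hLU⟩ := h c
    obtain ⟨L, U, hLU, hL, hU⟩ := hLU.exists_homogeneous hX
    have h1 : ∀ s : HalfDensity M, (X s).1 c = U * s.1 c := fun s => by
      rw [hLU, Finset.sum_eq_zero fun a _ => by rw [hLU.eq_zero hL hU hX hsa a, zero_mul], zero_add]
    change (X s).1 c = M.res le_top F * s.1 c
    rw [hF, h1, h1, (hτ c).1.left_comm, (hτ c).2, mul_one]
  · rintro G ⟨-, hG⟩
    refine ext_of_cover (fun c : Coords M => c.dom) (fun _ => le_top)
      (fun x _ => M.exists_chart x) fun c => ?_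
    rw [hF, hG]
    change _ = τ c * (M.res le_top G * σ.1 c)
    rw [(hτ c).1.left_comm, (hτ c).2, mul_one]

variable {S : SymTensor M ε} {Δ Δ' : Module.End ℝ (HalfDensity M)}

theorem existsUnique_mulOp (hΔ : Δ ∈ classF S) (hΔ' : Δ' ∈ classF S) :
    ∃! F : M.Fun ⊤, M.HasParity ε F ∧ Δ' - Δ = mulOp F := by
  have happ : ∀ (s : HalfDensity M) (c : Coords M),
      ((Δ' - Δ) s).1 c = (Δ' s).1 c - (Δ s).1 c := fun _ _ => rfl
  obtain ⟨h1, h2, h3⟩ := hΔ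
  obtain ⟨h1', h2', h3'⟩ := hΔ'
  refine exists_eq_mulOp (fun δ s hs c => ?_) (fun c δ s₁ s₂ hs₁ hK => ?_) fun c => ?_
  · rw [happ]
    exact (h2' δ s hs c).sub (h2 δ s hs c)
  · have h4 := h3 c δ s₁ s₂ hs₁ hK
    have h4' := h3' c δ s₁ s₂ hs₁ hK
    obtain ⟨K, hK, hKc, hv⟩ := hK
    have := M.t2
    have hv' : M.VanishesOff K (s₁.1 c) := hv c
    rw [pairing, pairing] at h4 h4' ⊢
    rw [happ, happ, sub_mul, mul_sub, c.integral_sub hK hKc ((h1'.vanishesOff hv').mul_right _)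
      ((h1.vanishesOff hv').mul_right _), c.integral_sub hK hKc (hv'.mul_right _)
      (hv'.mul_right _), h4, h4', mul_sub]
  · obtain ⟨L, U, h⟩ := h1 c
    obtain ⟨L', U', h'⟩ := h1' c
    refine ⟨fun a => L' a - L a, U' - U, fun s => ?_⟩
    rw [happ, h, h']
    simp only [sub_mul, Finset.sum_sub_distrib]
    abel

end

end SuperGeom

end

theorem mainTheorem3 {p q : ℕ} (M : SuperGeom.Supermanifold.{u} p q) (ε : ZMod 2)
    (S : SuperGeom.SymTensor M ε) :
    (SuperGeom.classF S).Nonempty ∧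
    (∀ Δ ∈ SuperGeom.classF S, ∀ Δ' ∈ SuperGeom.classF S,
      ∃! F : M.Fun ⊤, M.HasParity ε F ∧ Δ' - Δ = SuperGeom.mulOp F) ∧
    (∀ Δ ∈ SuperGeom.classF S, ∀ F : M.Fun ⊤, M.HasParity ε F →
      Δ + SuperGeom.mulOp F ∈ SuperGeom.classF S) := by
  exact ⟨SuperGeom.classF_nonempty S,
    fun _ hΔ _ hΔ' => SuperGeom.existsUnique_mulOp hΔ hΔ',
    fun _ hΔ _ hF => SuperGeom.add_mulOp_mem_classF hΔ hF⟩
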